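/- **Notation.** $\mathbb N=\{1,2,\dots\}$, $\mathbb N_n=\{1,\dots,n\}$, $d\ge1$ is the fixed dimension, $\mathbb T^d=\mathbb R^d/\mathbb Z^d$. Write $\mathcal Ff(\xi)=\int_{\mathbb R^d} f(x)e^{2\pi i\xi\cdot x}\,dx$ on $\mathbb R^d$, $\hat f(\xi)=\sum_{x\in\mathbb Z^d}f(x)e^{2\pi i\xi\cdot x}$ on $\mathbb Z^d$, and, for a function $m$ on $\mathbb T^d$, $\mathcal F^{-1}m(x)=\int_{\mathbb T^d}m(\xi)e^{-2\pi i\xi\cdot x}\,d\xi$ for $x\in\mathbb Z^d$. Let $\eta:\mathbb R^d\to[0,1]$ be smooth with $\eta(x)=1$ for $|x|\le 1/(16d)$ and $\eta(x)=0$ for $|x|\ge1/(8d)$. Let $\Theta:\mathbb R^d\to\mathbb C$ be a measurable multiplier such that for every $p\in(1,\infty)$ there is $\mathbf A_p>0$ with $\|\mathcal F^{-1}(\Theta\mathcal Ff)\|_{L^p}\le\mathbf A_p\|f\|_{L^p}$ for all $f\in L^2(\mathbb R^d)\cap L^p(\mathbb R^d)$. For $\rho>0$ and $N\in\mathbb N$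 put $D=\lfloor2/\rho\rfloor+1$, $N_0=\lfloor N^{\rho/2}\rfloor+1$, $Q_0=(N_0!)^D$, and let $\mathbb P_N$ be the set of primes in $(N_0,N]$. Let $\Pi(\mathbb P_N)$ be the set of all products $p_1^{\gamma_1}\cdots p_n^{\gamma_n}$ with $n\in\mathbb N_D$, distinct $p_l\in\mathbb P_N$ and $\gamma_l\in\mathbb N_D$. Let $\varepsilon_1,\dots,\varepsilon_d$ satisfy $0<\varepsilon_i\le e^{-N^{2\rho}}$, let $\mathcal E_N=\mathrm{diag}(\varepsilon_1,\dots,\varepsilon_d)$ and $\Omega_N(\xi)=\Theta(\xi)\,\eta(\mathcal E_N^{-1}\xi)$, regarded as a function on $\mathbb T^d$ by periodization. A set $\Lambda\subseteq\Pi(\mathbb P_N)\cup\{1\}$ *has the $\mathcal O$ property* with respect to an integer $0\le k\le D$ and sets $S_j=\{q_{j,1},\dots,q_{j,\beta_j}\}$, $j\in\mathbb N_k$, $\beta_j\in\mathbb N$, if: each $q_{j,s}$ is of the form $p^{\gamma}$ with $p\in\mathbb P_N$ and $\gamma\in\mathbb N_D$; for each $w\in\Lambda$ there are unique $s_j\in\mathbb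 N_{\beta_j}$ ($j\in\mathbb N_k$) with $w=q_{1,s_1}\cdots q_{k,s_k}$; and $\gcd(q_{j,s},q_{j',s'})=1$ whenever $(j,s)\ne(j',s')$. (The case $k=0$ covers $\Lambda=\{1\}$.) For $q\in\mathbb N$ let $A_q=\{a\in\mathbb N_q^d:\gcd(q,a_1,\dots,a_d)=1\}$. For $M\subseteq\mathbb N_k$ let $\mathcal U_M\subset\mathbb T^d$ be the set of all sums $\sum_{j\in M}a_j/q_{j,s_j}$ with $s_j\in\mathbb N_{\beta_j}$ and $a_j\in A_{q_{j,s_j}}$, and for a fixed tuple $\sigma=(s_j)_{j\in M}\in\prod_{j\in M}\mathbb N_{\beta_j}$ let $\mathcal V_M^\sigma$ be the set of all sums $\sum_{j\in M}a_j/q_{j,s_j}$ with $a_j\in A_{q_{j,s_j}}$; $\mathcal U_\emptyset=\mathcal V_\emptyset=\{0\}$. For $u=\sum_{j=1}^ka_j/q_{j,s_j}\in\mathcal U_{\mathbb N_k}$ let $$m_u(\xi)=\mathbf 1_\Lambda(q_{1,s_1}\cdots q_{k,s_k})\sum_{b\in\mathbb N_{Q_0}^d}\Omega_N(\xi-b/Q_0-u),\qquad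 f_u=\mathcal F^{-1}(m_u\hat f),$$ where for a general $f\in\ell^{2r}(\mathbb Z^d)$ the last formula means the convolution $f_u(x)=\sum_{y\in\mathbb Z^d}(\mathcal F^{-1}m_u)(x-y)f(y)$. For $L\subseteq M\subseteq\mathbb N_k$ and $\sigma\in\prod_{j\in L}\mathbb N_{\beta_j}$ define, with $M^c=\mathbb N_k\setminus M$, $$\mathcal S_{L,M}^\sigma(f_u:u\in\mathcal U_{\mathbb N_k})(x)=\Big(\sum_{w\in\mathcal U_{M^c}}\Big|\sum_{u\in\mathcal U_{M\setminus L}}\sum_{v\in\mathcal V_L^\sigma}f_{w+u+v}(x)\Big|^2\Big)^{1/2}.$$ **Theorem.** Let $\rho>0$ and $r\in\mathbb N$. There is a constant $C_{\rho,r}>0$ (depending only on $\rho$, $r$ and the fixed dimension $d$) such that for all $\Theta$, $\eta$, $(\varepsilon_i)$ as above, every integer $N>8^{2r/\rho}$, every $\Lambda\subseteq\Pi(\mathbb P_N)\cup\{1\}$ having the $\mathcal O$ property with respect to some $k$ and $S_1,\dots,S_k$, and every $f\in\ell^{2r}(\mathbb Z^d)$, the series defining $f_u(x)$ converges absolutely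 for all $u\in\mathcal U_{\mathbb N_k}$ and $x\in\mathbb Z^d$, and $$\Big\|\sum_{u\in\mathcal U_{\mathbb N_k}}f_u\Big\|_{\ell^{2r}}^{2r}\le C_{\rho,r}\sum_{M\subseteq\mathbb N_k}\ \sum_{\sigma\in\prod_{j\in M}\mathbb N_{\beta_j}}\big\|\mathcal S_{M,M}^\sigma(f_u:u\in\mathcal U_{\mathbb N_k})\big\|_{\ell^{2r}}^{2r}.$$ -/

import Mathlib

open MeasureTheory UnitAddTorus
open scoped ENNReal NNReal FourierTransform ContDiff

noncomputable section

namespace IonescuWainger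

/-! Throughout, `d` is the dimension, `EuclideanSpace ℝ (Fin d)` is `ℝ^d`, `Fin d → ℤ` is `ℤ^d` and
`UnitAddTorus (Fin d)` is `𝕋^d = ℝ^d / ℤ^d`, so that sums of fractions are taken modulo `1`.
The Fourier transform is `ℱ f(ξ) = ∫ f(x) e^{2πi ξ·x} dx` (with a plus sign), which is Mathlib's
`𝓕⁻`. On the integer side `f̂(ξ) = ∑ₓ f(x) e^{2πi ξ·x}`, and the inverse transform of a function `m`
on the torus is `x ↦ ∫ m(ξ) e^{-2πi ξ·x} dξ`, which is Mathlib's `mFourierCoeff m x`. -/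

/-- `Θ` is an `L^p(ℝ^d)` Fourier multiplier for all `1 < p < ∞`: there are constants `A_p > 0` with
`‖ℱ⁻¹(Θ ℱ f)‖_p ≤ A_p ‖f‖_p` for all `f ∈ L² ∩ L^p`. Here `g` is the function `ℱ⁻¹(Θ ℱ f)`, i.e.
the `L²` function with `ℱ g = Θ ℱ f`. -/
def IsLpMultiplier {d : ℕ} (Θ : EuclideanSpace ℝ (Fin d) → ℂ) : Prop :=
  AEStronglyMeasurable Θ volume ∧
  ∀ p : ℝ≥0∞, 1 < p → p < ⊤ → ∃ A : ℝ≥0, 0 < A ∧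
    ∀ f : Lp (α := EuclideanSpace ℝ (Fin d)) ℂ 2, MemLp f p volume →
      ∃ g : Lp (α := EuclideanSpace ℝ (Fin d)) ℂ 2,
        (𝓕⁻ g : Lp (α := EuclideanSpace ℝ (Fin d)) ℂ 2)
          =ᵐ[volume] (fun ξ => Θ ξ * (𝓕⁻ f : Lp (α := EuclideanSpace ℝ (Fin d)) ℂ 2) ξ) ∧
        eLpNorm g p volume ≤ A * eLpNorm f p volume

/-- The smooth cut-off function: `0 ≤ η ≤ 1`, `η = 1` for `|x| ≤ 1/(16d)` and `η = 0` for
`|x| ≥ 1/(8d)`, where `|x|` is the Euclidean norm. -/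
structure IsCutoff {d : ℕ} (η : EuclideanSpace ℝ (Fin d) → ℝ) : Prop where
  smooth : ContDiff ℝ ∞ η
  nonneg : ∀ x, 0 ≤ η x
  le_one : ∀ x, η x ≤ 1
  eq_one : ∀ x, ‖x‖ ≤ 1 / (16 * (d : ℝ)) → η x = 1
  eq_zero : ∀ x, 1 / (8 * (d : ℝ)) ≤ ‖x‖ → η x = 0

/-- `D = ⌊2/ρ⌋ + 1`. -/
def degD (ρ : ℝ) : ℕ := ⌊2 / ρ⌋₊ + 1

/-- `N₀ = ⌊N^{ρ/2}⌋ + 1`. -/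
def smallN (ρ : ℝ) (N : ℕ) : ℕ := ⌊(N : ℝ) ^ (ρ / 2)⌋₊ + 1

/-- `Q₀ = (N₀!)^D`. -/
def bigQ (ρ : ℝ) (N : ℕ) : ℕ := (smallN ρ N).factorial ^ degD ρ

/-- `ℙ_N = ℙ ∩ (N₀, N]`, a set of primes. -/
def primesIn (ρ : ℝ) (N : ℕ) : Set ℕ := {p | p.Prime ∧ smallN ρ N < p ∧ p ≤ N}

/-- `Π(V)`: all products `p₁^{γ₁} ⋯ p_k^{γ_k}` with `1 ≤ k ≤ D`, distinct `p_l ∈ V` and exponents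
`1 ≤ γ_l ≤ D`. -/
def primeProducts (D : ℕ) (V : Set ℕ) : Set ℕ :=
  {w | ∃ k ∈ Finset.Icc 1 D, ∃ p γ : Fin k → ℕ, Function.Injective p ∧
    (∀ l, p l ∈ V) ∧ (∀ l, γ l ∈ Finset.Icc 1 D) ∧ w = ∏ l, p l ^ γ l}

/-- `Λ` has the `𝒪` property, as witnessed by the integer `k` and the sets
`S_j = {q_{j,1}, …, q_{j,β_j}}`, `1 ≤ j ≤ k`. The value `k = 0` occurs for `Λ = {1}`. -/
structure HasOProperty (D : ℕ) (V Λ : Set ℕ) {k : ℕ} (β : Fin k → ℕ)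
    (q : (j : Fin k) → Fin (β j) → ℕ) : Prop where
  le : k ≤ D
  pos : ∀ j, 0 < β j
  prime_pow : ∀ j s, ∃ p ∈ V, ∃ γ ∈ Finset.Icc 1 D, q j s = p ^ γ
  unique : ∀ w ∈ Λ, ∃! s : (j : Fin k) → Fin (β j), w = ∏ j, q j (s j)
  coprime : ∀ x y : (Σ j : Fin k, Fin (β j)), x ≠ y → Nat.Coprime (q x.1 x.2) (q y.1 y.2)

/-- `A_q = {a ∈ {1,…,q}^d : gcd(q, a₁, …, a_d) = 1}`. -/
def numerators (d q : ℕ) : Finset (Fin d → ℕ) :=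
  (Fintype.piFinset fun _ => Finset.Icc 1 q).filter fun a =>
    Nat.gcd q (Finset.univ.gcd a) = 1

/-- The point `a/q` of the torus. -/
def frac {d : ℕ} (a : Fin d → ℕ) (q : ℕ) : UnitAddTorus (Fin d) :=
  fun i => (((a i : ℝ) / (q : ℝ) : ℝ) : UnitAddCircle)

open scoped Classical in
/-- `{a/q : a ∈ A_q}`. -/
def fracs (d q : ℕ) : Finset (UnitAddTorus (Fin d)) :=
  (numerators d q).image fun a => frac a q

open scoped Classical in
/-- `𝒰_M`: the set of all sums `∑_{j ∈ M} u_j`, where `u_j` has the form `a/q_{j,s}` with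
`1 ≤ s ≤ β_j` and `a ∈ A_{q_{j,s}}`; `𝒰_∅ = {0}`. -/
def setU (d : ℕ) {k : ℕ} {β : Fin k → ℕ} (q : (j : Fin k) → Fin (β j) → ℕ)
    (M : Finset (Fin k)) : Finset (UnitAddTorus (Fin d)) :=
  (Fintype.piFinset fun j : M => Finset.univ.biUnion fun s : Fin (β j) => fracs d (q j s)).image
    fun u => ∑ j, u j

open scoped Classical in
/-- `𝒱_L^σ`: the set of all sums `∑_{j ∈ L} a_j/q_{j,σ_j}` with `a_j ∈ A_{q_{j,σ_j}}`, for
`σ ∈ ∏_{j ∈ L} {1,…,β_j}`; `𝒱_∅ = {0}`. -/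
def setV (d : ℕ) {k : ℕ} {β : Fin k → ℕ} (q : (j : Fin k) → Fin (β j) → ℕ)
    (L : Finset (Fin k)) (σ : (j : L) → Fin (β j)) : Finset (UnitAddTorus (Fin d)) :=
  (Fintype.piFinset fun j : L => fracs d (q j (σ j))).image fun v => ∑ j, v j

/-- `Ω_N(ξ) = Θ(ξ) η_N(ξ)` with `η_N(ξ) = η(ℰ⁻¹ ξ)`, `ℰ` the diagonal matrix with entries `ε_i`. -/
def localMultiplier {d : ℕ} (Θ : EuclideanSpace ℝ (Fin d) → ℂ)
    (η : EuclideanSpace ℝ (Fin d) → ℝ) (ε : Fin d → ℝ) (ξ : EuclideanSpace ℝ (Fin d)) : ℂ :=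
  Θ ξ * (η (WithLp.toLp 2 fun i => ξ i / ε i) : ℂ)

/-- A function on `ℝ^d` regarded as a function on the torus, by summing over all lifts. -/
def periodize {d : ℕ} (Ω : EuclideanSpace ℝ (Fin d) → ℂ) (θ : UnitAddTorus (Fin d)) : ℂ :=
  ∑' x : {x : EuclideanSpace ℝ (Fin d) // (fun i => ((x i : ℝ) : UnitAddCircle)) = θ}, Ω x

open scoped Classical in
/-- The multiplier `m_u(ξ) = 1_Λ(q_{1,s₁} ⋯ q_{k,s_k}) ∑_{b ∈ {1,…,Q₀}^d} Ω_N(ξ - b/Q₀ - u)` on the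
torus, for `u = a₁/q_{1,s₁} + ⋯ + a_k/q_{k,s_k}`. -/
def multiplierAt {d : ℕ} (Θ : EuclideanSpace ℝ (Fin d) → ℂ) (η : EuclideanSpace ℝ (Fin d) → ℝ)
    (ε : Fin d → ℝ) (Q₀ : ℕ) (Λ : Set ℕ) {k : ℕ} {β : Fin k → ℕ}
    (q : (j : Fin k) → Fin (β j) → ℕ) (u ξ : UnitAddTorus (Fin d)) : ℂ :=
  if ∃ s : (j : Fin k) → Fin (β j),
      u ∈ setV d q Finset.univ (fun j => s j) ∧ (∏ j, q j (s j)) ∈ Λ then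
    ∑ b ∈ Fintype.piFinset (fun _ : Fin d => Finset.Icc 1 Q₀),
      periodize (localMultiplier Θ η ε) (ξ - frac b Q₀ - u)
  else 0

/-- The operator `f ↦ ℱ⁻¹(m f̂)` on functions on `ℤ^d`, as convolution with the kernel `ℱ⁻¹ m`. -/
def multiplierOp {d : ℕ} (m : UnitAddTorus (Fin d) → ℂ) (f : (Fin d → ℤ) → ℂ)
    (x : Fin d → ℤ) : ℂ :=
  ∑' y, mFourierCoeff m (x - y) * f y

/-- For finitely supported `f` the operator is literally `f ↦ ℱ⁻¹(m f̂)`. -/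
theorem multiplierOp_eq {d : ℕ} (m : UnitAddTorus (Fin d) → ℂ)
    (hm : Integrable m (Measure.pi fun _ => AddCircle.haarAddCircle))
    (f : (Fin d → ℤ) → ℂ) (F : Finset (Fin d → ℤ)) (hf : ∀ y ∉ F, f y = 0) (x : Fin d → ℤ) :
    multiplierOp m f x = mFourierCoeff (fun ξ => m ξ * ∑' y, f y * mFourier y ξ) x := by
  have h1 : ∀ ξ : UnitAddTorus (Fin d), ∑' y, f y * mFourier y ξ = ∑ y ∈ F, f y * mFourier y ξ :=
    fun ξ => tsum_eq_sum fun y hy => by simp [hf y hy]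
  have h2 : multiplierOp m f x = ∑ y ∈ F, mFourierCoeff m (x - y) * f y :=
    tsum_eq_sum fun y hy => by simp [hf y hy]
  rw [h2]
  simp only [mFourierCoeff, h1, smul_eq_mul, Finset.mul_sum]
  have h3 : ∀ y ∈ F, Integrable
      (fun t : UnitAddTorus (Fin d) => mFourier (-x) t * (m t * (f y * mFourier y t)))
      (Measure.pi fun _ => AddCircle.haarAddCircle) := by
    intro y _
    have h := hm.bdd_mul (c := ‖f y‖)
      (f := fun t : UnitAddTorus (Fin d) => f y * (mFourier (-x) t * mFourier y t))
      (Continuous.aestronglyMeasurable (by fun_prop))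
      (Filter.Eventually.of_forall fun t => by
        rw [norm_mul]
        refine mul_le_of_le_one_right (norm_nonneg _) ?_
        rw [← mFourier_add]
        exact ((mFourier _).norm_coe_le_norm t).trans mFourier_norm.le)
    refine h.congr (Filter.Eventually.of_forall fun t => ?_)
    ring
  refine Eq.trans ?_ (integral_finsetSum F h3).symm
  refine Finset.sum_congr rfl fun y _ => ?_
  rw [← integral_mul_const]
  refine integral_congr_ae (Filter.Eventually.of_forall fun t => ?_)
  have : mFourier (-(x - y)) t = mFourier (-x) t * mFourier y t := by
    rw [← mFourier_add]; congr 2; abel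
  simp only [this]
  ring

/-- The square function
`𝒮_{L,M}^σ(f_u)(x) = (∑_{w ∈ 𝒰_{M^c}} |∑_{u ∈ 𝒰_{M∖L}} ∑_{v ∈ 𝒱_L^σ} f_{w+u+v}(x)|²)^{1/2}`,
for `L ⊆ M ⊆ {1,…,k}` and `σ ∈ ∏_{j ∈ L} {1,…,β_j}`. -/
def squareFunction {d k : ℕ} {β : Fin k → ℕ} (q : (j : Fin k) → Fin (β j) → ℕ)
    (L M : Finset (Fin k)) (σ : (j : L) → Fin (β j))
    (F : UnitAddTorus (Fin d) → (Fin d → ℤ) → ℂ) (x : Fin d → ℤ) : ℝ :=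
  Real.sqrt (∑ w ∈ setU d q Mᶜ,
    ‖∑ u ∈ setU d q (M \ L), ∑ v ∈ setV d q L σ, F (w + u + v) x‖ ^ 2)

/-- `‖g‖_{ℓ^p(ℤ^d)}^p = ∑_x |g(x)|^p`, with values in `[0, ∞]`. -/
def lpNormPow {d : ℕ} {E : Type*} [NormedAddCommGroup E] (p : ℕ) (g : (Fin d → ℤ) → E) : ℝ≥0∞ :=
  ∑' x, ‖g x‖ₑ ^ p

end IonescuWainger

end

open IonescuWainger

noncomputable section

namespace IonescuWainger

/-! ### Counting inequalities for tuples: repeated values and distinct values. -/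

section Combinatorics

/-! The spectrum of `f_u` lies within 2κ of the points u + y with Q₀y = 0, where κ = exp(-N^{2ρ}).
Single out one column j and let t be the part of u in that column. Expanding a 2r-th power into r
factors and r conjugates produces correlations whose spectrum lies near ∑(t_i - t'_i) plus a
rational point with denominator prime to the column. For large N the common denominator of
everything is much smaller than 1/κ, so a nonzero correlation forces the whole rational point to
vanish exactly, and coprimality then forces ∑(t_i - t'_i) = 0 (`CoprimeModuli.sum_sub_eq_zero`).
Since the moduli within the column are pairwise coprime, this is impossible if some modulus occurs
exactly once among the 2r fractions (`sum_sub_ne_zero_of_single`), and it gives t = t' if t_i and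
t'_i share a modulus that is different for different i (`eq_of_sum_sub_eq_zero`).

The first fact is superorthogonality: up to a constant, the sum over the column may be replaced by a
square function over its moduli. The r-th power of that square is then split into tuples of distinct
moduli, for which the second fact passes to the square function over individual fractions, and r-th
powers belonging to a single modulus. Thus, at the cost of `stepConst r`, a column is either
square-summed or has its modulus fixed (`tsum_sum_norm_sum_sq_pow_le_add`,
`tsum_mixedSquare_insert_le`). Induction over the k ≤ D columns (`tsum_mixedSquare_le`) produces
exactly the pairs (M, σ).

Two analytic points underlie this. A function in ℓ^{2r} need not have a Fourier transform that is a
function, so spectra are tested after multiplication by summable cut-offs with shrinking spectrum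
(`banded_multiplierOp`, `tsum_prod_mul_conj_eq_zero`). The kernel of the localized multiplier is
dominated by a Schwartz average of a function in the dual Lebesgue space, which makes the
convolutions absolutely convergent and bounded (`exists_tsum_mFourierCoeff_periodize_le`). No ℓ^{2r}
bound for the `f_u` is required: if the right side is finite, its M = ∅ summand already puts each of
them in ℓ^{2r}. The finitely many N for which separation is not available are handled by
Cauchy–Schwarz. -/

theorem sum_biUnion_le_of_nonneg {α β : Type*} [DecidableEq β] (s : Finset α)
    (t : α → Finset β) (φ : β → ℝ) (hφ : ∀ b, 0 ≤ φ b) :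
    ∑ b ∈ s.biUnion t, φ b ≤ ∑ a ∈ s, ∑ b ∈ t a, φ b := by
  classical
  induction s using Finset.induction_on with
  | empty => simp
  | insert a s ha ih =>
    rw [Finset.biUnion_insert, Finset.sum_insert ha]
    have h := Finset.sum_union_inter (s₁ := t a) (s₂ := s.biUnion t) (f := φ)
    have h2 : 0 ≤ ∑ b ∈ t a ∩ s.biUnion t, φ b := Finset.sum_nonneg fun b _ => hφ b
    linarith

open scoped Classical in
/-- Tuples in which no value occurs exactly once, normalized case. -/
theorem sum_prod_le_of_forall_exists_ne_of_le_one {ι S : Type*} [Fintype ι] [Fintype S]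
    (g : S → ℝ) (hg : ∀ s, 0 ≤ g s) (hsum : ∑ s, g s ^ 2 ≤ 1) :
    ∑ σ : ι → S with ∀ i, ∃ j, j ≠ i ∧ σ j = σ i, ∏ i, g (σ i) ≤
      (Fintype.card ι : ℝ) ^ Fintype.card ι := by
  have hg1 : ∀ s, g s ≤ 1 := fun s => by
    have h1 : g s ^ 2 ≤ 1 :=
      (Finset.single_le_sum (f := fun s => g s ^ 2) (fun s _ => sq_nonneg _)
        (Finset.mem_univ s)).trans hsum
    nlinarith [hg s]
  -- `e σ` picks one representative from each level set of σ. The choice is made from the predicate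
  -- alone, so it is constant on level sets.
  let e : (ι → S) → ι → ι := fun σ i =>
    Classical.choose (p := fun j => σ j = σ i) ⟨i, rfl⟩
  have he : ∀ (σ : ι → S) i, σ (e σ i) = σ i := fun σ i =>
    Classical.choose_spec (p := fun j => σ j = σ i) ⟨i, rfl⟩
  have he2 : ∀ (σ : ι → S) i j, σ i = σ j → e σ i = e σ j := by
    intro σ i j h
    have : (fun l => σ l = σ i) = (fun l => σ l = σ j) := by rw [h]
    simp only [e]
    congr 1
  rw [← Finset.sum_fiberwise_of_maps_to (g := e) (t := Finset.univ) (fun _ _ => Finset.mem_univ _)]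
  have key : ∀ τ : ι → ι, ∑ σ ∈ (Finset.univ.filter fun σ : ι → S =>
      ∀ i, ∃ j, j ≠ i ∧ σ j = σ i).filter (fun σ => e σ = τ), ∏ i, g (σ i) ≤ 1 := by
    intro τ
    set R := Finset.univ.image τ with hR
    calc _ ≤ ∑ σ ∈ (Finset.univ.filter fun σ : ι → S =>
      ∀ i, ∃ j, j ≠ i ∧ σ j = σ i).filter (fun σ => e σ = τ), ∏ a : R, g (σ a) ^ 2 := by
          refine Finset.sum_le_sum fun σ hσ => ?_
          simp only [Finset.mem_filter, Finset.mem_univ, true_and] at hσ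
          obtain ⟨h1, h2⟩ := hσ
          rw [Finset.prod_coe_sort R (fun a => g (σ a) ^ 2),
            ← Finset.prod_fiberwise_of_maps_to (g := τ) (t := R) (fun i _ => by simp [hR])]
          refine Finset.prod_le_prod (fun a _ => Finset.prod_nonneg fun i _ => hg _) fun a ha => ?_
          obtain ⟨i, -, hi⟩ := Finset.mem_image.1 ha
          have h3 : ∀ l ∈ Finset.univ.filter (fun l => τ l = a), g (σ l) = g (σ a) := by
            intro l hl
            simp only [Finset.mem_filter, Finset.mem_univ, true_and] at hl
            rw [← hl, ← h2, he σ l]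
          rw [Finset.prod_congr rfl h3, Finset.prod_const]
          -- Each level set has at least two elements and g ≤ 1, so its contribution is at most g².
          refine pow_le_pow_of_le_one (hg _) (hg1 _) ?_
          obtain ⟨j, hj, hji⟩ := h1 i
          rw [← Nat.lt_iff_add_one_le, Finset.one_lt_card]
          refine ⟨j, ?_, i, ?_, hj⟩
          · simp only [Finset.mem_filter, Finset.mem_univ, true_and]
            rw [← hi, ← h2]; exact he2 _ _ _ hji
          · simpa using hi
      _ = ∑ ρ ∈ ((Finset.univ.filter fun σ : ι → S =>
      ∀ i, ∃ j, j ≠ i ∧ σ j = σ i).filter (fun σ => e σ = τ)).image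
          (fun σ (a : R) => σ a), ∏ a : R, g (ρ a) ^ 2 := by
          -- A tuple with `e σ = τ` is determined by its values on the range of τ, because σ i = σ
          -- (τ i).
          rw [Finset.sum_image]
          intro σ hσ σ' hσ' h
          simp only [Finset.coe_filter, Finset.mem_filter, Finset.mem_univ, true_and,
            Set.mem_ofPred_eq] at hσ hσ'
          funext i
          rw [← he σ i, ← he σ' i, hσ.2, hσ'.2]
          exact congrFun h ⟨τ i, by simp [hR]⟩
      _ ≤ ∑ ρ : R → S, ∏ a : R, g (ρ a) ^ 2 :=
          Finset.sum_le_univ_sum_of_nonneg fun ρ => Finset.prod_nonneg fun a _ => sq_nonneg _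
      _ = (∑ s, g s ^ 2) ^ (Fintype.card R) := by
          have := Finset.prod_univ_sum (fun _ : R => (Finset.univ : Finset S))
            (fun _ s => g s ^ 2)
          rw [Fintype.piFinset_univ] at this
          rw [← this, Finset.prod_const, Finset.card_univ]
      _ ≤ 1 := pow_le_one₀ (Finset.sum_nonneg fun s _ => sq_nonneg _) hsum
  calc _ ≤ ∑ τ : ι → ι, (1 : ℝ) := Finset.sum_le_sum fun τ _ => key τ
    _ = _ := by simp

open scoped Classical in
/-- Sum over the tuples of length `2r` in which no value occurs exactly once. -/
theorem sum_prod_le_of_forall_exists_ne {ι S : Type*} [Fintype ι] [Fintype S]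
    (r : ℕ) (hι : Fintype.card ι = 2 * r) (h : S → ℝ) (hh : ∀ s, 0 ≤ h s) :
    ∑ σ : ι → S with ∀ i, ∃ j, j ≠ i ∧ σ j = σ i, ∏ i, h (σ i) ≤
      (2 * r : ℝ) ^ (2 * r) * (∑ s, h s ^ 2) ^ r := by
  set B := ∑ s, h s ^ 2 with hB
  have hB0 : 0 ≤ B := Finset.sum_nonneg fun s _ => sq_nonneg _
  rcases hB0.eq_or_lt with h0 | hpos
  · have hz : ∀ s, h s = 0 := by
      intro s
      have := (Finset.sum_eq_zero_iff_of_nonneg (fun s _ => sq_nonneg (h s))).1 (hB ▸ h0.symm) s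
        (Finset.mem_univ s)
      exact pow_eq_zero_iff (two_ne_zero) |>.1 this
    -- For r = 0 there is only the empty tuple, and both sides equal 1.
    rcases Nat.eq_zero_or_pos r with rfl | hr
    · have : IsEmpty ι := Fintype.card_eq_zero_iff.1 (by simpa using hι)
      simp
    · have : Nonempty ι := Fintype.card_pos_iff.1 (by omega)
      refine le_trans (le_of_eq ?_) (by positivity : (0 : ℝ) ≤ _)
      refine Finset.sum_eq_zero fun σ _ => ?_
      exact Finset.prod_eq_zero (Finset.mem_univ (Classical.arbitrary ι)) (hz _)
  · have hs : 0 < Real.sqrt B := Real.sqrt_pos.2 hpos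
    have hsq : Real.sqrt B ^ 2 = B := Real.sq_sqrt hB0
    have h1 := sum_prod_le_of_forall_exists_ne_of_le_one (ι := ι) (fun s => h s / Real.sqrt B)
      (fun s => div_nonneg (hh s) hs.le) (by
        simp only [div_pow, hsq]
        rw [← Finset.sum_div, ← hB, div_self hpos.ne'])
    simp only [Finset.prod_div_distrib, Finset.prod_const, Finset.card_univ] at h1
    rw [← Finset.sum_div, div_le_iff₀ (by positivity), hι, pow_mul (Real.sqrt B), hsq] at h1
    exact_mod_cast h1

open scoped Classical in
/-- A power of a sum is controlled by its off-diagonal part and the sum of the powers. -/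
theorem sum_pow_le_injective_add {S : Type*} [Fintype S] (r : ℕ) (hr : 1 ≤ r) (a : S → ℝ)
    (ha : ∀ s, 0 ≤ a s) :
    (∑ s, a s) ^ r ≤ 2 * ∑ σ : Fin r → S with Function.Injective σ, ∏ i, a (σ i) +
      (2 * (r : ℝ) ^ 2) ^ r * ∑ s, a s ^ r := by
  obtain ⟨n, rfl⟩ : ∃ n, r = n + 1 := ⟨r - 1, by omega⟩
  rcases isEmpty_or_nonempty S with hS | hS
  · simp
  obtain ⟨s₀, hs₀⟩ := Finite.exists_max a
  set A := ∑ s, a s with hA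
  have hA0 : 0 ≤ A := Finset.sum_nonneg fun s _ => ha s
  have hexp : A ^ (n + 1) = ∑ σ : Fin (n + 1) → S with Function.Injective σ, ∏ i, a (σ i) +
      ∑ σ : Fin (n + 1) → S with ¬ Function.Injective σ, ∏ i, a (σ i) := by
    rw [Finset.sum_filter_add_sum_filter_not, hA, Fintype.sum_pow]
  have hpair : ∀ i j : Fin (n + 1), i ≠ j →
      ∑ σ : Fin (n + 1) → S with σ i = σ j, ∏ l, a (σ l) ≤ a s₀ * A ^ n := by
    intro i j hij
    -- The i-th factor is replaced by the maximum. Deleting the i-th entry loses no information,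
    -- since it equals the retained j-th one.
    calc _ ≤ ∑ σ : Fin (n + 1) → S with σ i = σ j, a s₀ * ∏ l, a (σ (i.succAbove l)) := by
          refine Finset.sum_le_sum fun σ _ => ?_
          rw [Fin.prod_univ_succAbove _ i]
          exact mul_le_mul_of_nonneg_right (hs₀ _) (Finset.prod_nonneg fun l _ => ha _)
      _ = ∑ ρ ∈ (Finset.univ.filter fun σ : Fin (n + 1) → S => σ i = σ j).image
            (fun σ l => σ (i.succAbove l)), a s₀ * ∏ l, a (ρ l) := by
          rw [Finset.sum_image]
          intro σ hσ σ' hσ' h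
          simp only [Finset.coe_filter, Finset.mem_univ, true_and, Set.mem_ofPred_eq] at hσ hσ'
          obtain ⟨l, hl⟩ := Fin.exists_succAbove_eq hij.symm
          have hj : σ j = σ' j := by rw [← hl]; exact congrFun h l
          funext m
          rcases eq_or_ne m i with rfl | hm
          · rw [hσ, hσ', hj]
          · obtain ⟨l', rfl⟩ := Fin.exists_succAbove_eq hm
            exact congrFun h l'
      _ ≤ ∑ ρ : Fin n → S, a s₀ * ∏ l, a (ρ l) :=
          Finset.sum_le_univ_sum_of_nonneg fun ρ =>
            mul_nonneg (ha _) (Finset.prod_nonneg fun l _ => ha _)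
      _ = _ := by rw [← Finset.mul_sum, ← Fintype.sum_pow]
  have hnon : ∑ σ : Fin (n + 1) → S with ¬ Function.Injective σ, ∏ i, a (σ i) ≤
      ((n + 1 : ℕ) : ℝ) ^ 2 * (a s₀ * A ^ n) := by
    calc _ ≤ ∑ σ ∈ (Finset.univ.filter fun p : Fin (n + 1) × Fin (n + 1) => p.1 ≠ p.2).biUnion
            (fun p => Finset.univ.filter fun σ : Fin (n + 1) → S => σ p.1 = σ p.2),
            ∏ i, a (σ i) := by
          refine Finset.sum_le_sum_of_subset_of_nonneg ?_
            fun σ _ _ => Finset.prod_nonneg fun l _ => ha _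
          intro σ hσ
          have hσ2 := (Finset.mem_filter.1 hσ).2
          rw [Function.Injective] at hσ2
          push Not at hσ2
          obtain ⟨i, j, h, hij⟩ := hσ2
          simp only [Finset.mem_biUnion, Finset.mem_filter, Finset.mem_univ, true_and]
          exact ⟨(i, j), hij, h⟩
      _ ≤ ∑ p ∈ (Finset.univ.filter fun p : Fin (n + 1) × Fin (n + 1) => p.1 ≠ p.2),
            ∑ σ : Fin (n + 1) → S with σ p.1 = σ p.2, ∏ i, a (σ i) := by
          refine sum_biUnion_le_of_nonneg _ _ _ ?_
          exact fun σ => Finset.prod_nonneg fun l _ => ha _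
      _ ≤ ∑ p ∈ (Finset.univ.filter fun p : Fin (n + 1) × Fin (n + 1) => p.1 ≠ p.2),
            a s₀ * A ^ n := Finset.sum_le_sum fun p hp => hpair _ _ (Finset.mem_filter.1 hp).2
      _ ≤ ∑ p : Fin (n + 1) × Fin (n + 1), a s₀ * A ^ n :=
          Finset.sum_le_univ_sum_of_nonneg fun p => mul_nonneg (ha _) (pow_nonneg hA0 _)
      _ = _ := by simp [pow_two]
  have hI : 0 ≤ ∑ σ : Fin (n + 1) → S with Function.Injective σ, ∏ i, a (σ i) :=
    Finset.sum_nonneg fun σ _ => Finset.prod_nonneg fun l _ => ha _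
  have hmax : a s₀ ^ (n + 1) ≤ ∑ s, a s ^ (n + 1) :=
    Finset.single_le_sum (f := fun s => a s ^ (n + 1)) (fun s _ => pow_nonneg (ha s) _)
      (Finset.mem_univ s₀)
  have hP : 0 ≤ ∑ s, a s ^ (n + 1) := Finset.sum_nonneg fun s _ => pow_nonneg (ha s) _
  -- If the maximum is small compared with A, the non-injective tuples contribute at most half of
  -- A^r and are absorbed, whence the factor 2. Otherwise A is at most 2r² times the maximum, and
  -- the sum of r-th powers suffices alone.
  rcases le_total (2 * ((n + 1 : ℕ) : ℝ) ^ 2 * a s₀) A with hc | hc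
  · have h2 : ((n + 1 : ℕ) : ℝ) ^ 2 * (a s₀ * A ^ n) ≤ A ^ (n + 1) / 2 := by
      have := mul_le_mul_of_nonneg_right hc (pow_nonneg hA0 n)
      rw [pow_succ A n]
      linarith
    have h3 : 0 ≤ (2 * ((n + 1 : ℕ) : ℝ) ^ 2) ^ (n + 1) * ∑ s, a s ^ (n + 1) := by positivity
    linarith
  · have h2 : A ^ (n + 1) ≤ (2 * ((n + 1 : ℕ) : ℝ) ^ 2) ^ (n + 1) * a s₀ ^ (n + 1) := by
      rw [← mul_pow]; exact pow_le_pow_left₀ hA0 hc _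
    have h3 := mul_le_mul_of_nonneg_left hmax
      (by positivity : 0 ≤ (2 * ((n + 1 : ℕ) : ℝ) ^ 2) ^ (n + 1))
    linarith

end Combinatorics

/-! ### Superorthogonality and the one-column inequality, in abstract form. -/

section SuperOrthogonality

open ComplexConjugate

/-- A product is at most the corresponding power of its largest factor. This provides the
summability without which `tsum` could not be interchanged with the finite sums of the expansions.
-/
theorem summable_prod_norm {X ι : Type*} [Fintype ι] [Nonempty ι] (g : ι → X → ℂ)
    (h : ∀ i, Summable fun x => ‖g i x‖ ^ Fintype.card ι) :
    Summable fun x => ∏ i, ‖g i x‖ := by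
  refine Summable.of_nonneg_of_le (fun x => Finset.prod_nonneg fun i _ => norm_nonneg _) (fun x => ?_)
    (summable_sum fun i _ => h i : Summable fun x => ∑ i, ‖g i x‖ ^ Fintype.card ι)
  obtain ⟨i₀, hi₀⟩ := Finite.exists_max fun i => ‖g i x‖
  calc ∏ i, ‖g i x‖ ≤ ∏ _i : ι, ‖g i₀ x‖ :=
        Finset.prod_le_prod (fun i _ => norm_nonneg _) fun i _ => hi₀ i
    _ = ‖g i₀ x‖ ^ Fintype.card ι := by simp
    _ ≤ _ := Finset.single_le_sum (f := fun i => ‖g i x‖ ^ Fintype.card ι)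
        (fun i _ => by positivity) (Finset.mem_univ i₀)

theorem summable_prod_mul_conj {X : Type*} {r : ℕ} (hr : 1 ≤ r) (a b : Fin r → X → ℂ)
    (ha : ∀ i, Summable fun x => ‖a i x‖ ^ (2 * r)) (hb : ∀ i, Summable fun x => ‖b i x‖ ^ (2 * r)) :
    Summable fun x => ∏ i, (a i x * conj (b i x)) := by
  have : Nonempty (Fin r) := ⟨⟨0, hr⟩⟩
  have hc : Fintype.card (Fin r ⊕ Fin r) = 2 * r := by simp; ring
  have h := summable_prod_norm (ι := Fin r ⊕ Fin r) (Sum.elim a b) (by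
    rw [hc]; rintro (i | i)
    · exact ha i
    · exact hb i)
  refine Summable.of_norm (h.congr fun x => ?_)
  simp [Finset.prod_mul_distrib]

theorem summable_norm_sum_pow {X T : Type*} (p : ℕ) (F : Finset T) (g : T → X → ℂ)
    (h : ∀ t ∈ F, Summable fun x => ‖g t x‖ ^ (p + 1)) :
    Summable fun x => ‖∑ t ∈ F, g t x‖ ^ (p + 1) := by
  refine Summable.of_nonneg_of_le (fun x => by positivity) (fun x => ?_)
    ((summable_sum h).mul_left ((F.card : ℝ) ^ p))
  calc ‖∑ t ∈ F, g t x‖ ^ (p + 1) ≤ (∑ t ∈ F, ‖g t x‖) ^ (p + 1) :=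
        pow_le_pow_left₀ (norm_nonneg _) (norm_sum_le _ _) _
    _ ≤ _ := pow_sum_le_card_mul_sum_pow (fun t _ => norm_nonneg (g t x)) p

theorem summable_norm_sum_pow' {X T : Type*} {p : ℕ} (hp : p ≠ 0) (F : Finset T) (g : T → X → ℂ)
    (h : ∀ t ∈ F, Summable fun x => ‖g t x‖ ^ p) :
    Summable fun x => ‖∑ t ∈ F, g t x‖ ^ p := by
  obtain ⟨n, rfl⟩ := Nat.exists_eq_succ_of_ne_zero hp
  exact summable_norm_sum_pow n F g h

/-- Writing |z|² as z times its conjugate turns the product into a 2r-linear form. The i-th factor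
and the i-th conjugate share the same w, which later permits Cauchy–Schwarz in w. -/
theorem prod_sum_norm_sum_sq {W T : Type*} [Fintype W] {r : ℕ} (g : W → T → ℂ)
    (F : Fin r → Finset T) :
    ((∏ i, ∑ w, ‖∑ t ∈ F i, g w t‖ ^ 2 : ℝ) : ℂ) =
      ∑ w : Fin r → W, ∑ t ∈ Fintype.piFinset F, ∑ t' ∈ Fintype.piFinset F,
        ∏ i, (g (w i) (t i) * conj (g (w i) (t' i))) := by
  classical
  push_cast
  rw [Finset.prod_univ_sum, Fintype.piFinset_univ]
  refine Finset.sum_congr rfl fun w _ => ?_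
  have : ∀ i, ((‖∑ t ∈ F i, g (w i) t‖ : ℂ)) ^ 2 =
      (∑ t ∈ F i, g (w i) t) * ∑ t ∈ F i, conj (g (w i) t) := fun i => by
    rw [← map_sum, Complex.mul_conj, Complex.normSq_eq_norm_sq]
    push_cast; rfl
  simp only [this, Finset.prod_mul_distrib]
  rw [Finset.prod_univ_sum, Finset.prod_univ_sum, Finset.sum_mul_sum]

theorem summable_prod_sum_norm_sum_sq {X W T : Type*} [Fintype W] {r : ℕ} (hr : 1 ≤ r)
    (g : W → T → X → ℂ) (hg : ∀ w t, Summable fun x => ‖g w t x‖ ^ (2 * r))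
    (F : Fin r → Finset T) :
    Summable fun x => ∏ i, ∑ w, ‖∑ t ∈ F i, g w t x‖ ^ 2 := by
  rw [← Complex.summable_ofReal]
  simp only [prod_sum_norm_sum_sq (fun w t => g w t _) F]
  exact summable_sum fun w _ => summable_sum fun t _ => summable_sum fun t' _ =>
    summable_prod_mul_conj hr _ _ (fun i => hg _ _) fun i => hg _ _

theorem summable_sum_norm_sum_sq_pow {X W T : Type*} [Fintype W] {r : ℕ} (hr : 1 ≤ r)
    (g : W → T → X → ℂ) (hg : ∀ w t, Summable fun x => ‖g w t x‖ ^ (2 * r)) (F : Finset T) :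
    Summable fun x => (∑ w, ‖∑ t ∈ F, g w t x‖ ^ 2) ^ r := by
  simpa using summable_prod_sum_norm_sum_sq hr g hg fun _ => F

/-- The previous case with outer index set W × T and a one-point inner family. -/
theorem summable_sum_sum_norm_sq_pow {X W T : Type*} [Fintype W] [Fintype T] {r : ℕ} (hr : 1 ≤ r)
    (g : W → T → X → ℂ) (hg : ∀ w t, Summable fun x => ‖g w t x‖ ^ (2 * r)) :
    Summable fun x => (∑ w, ∑ t, ‖g w t x‖ ^ 2) ^ r := by
  have := summable_sum_norm_sum_sq_pow (W := W × T) (T := Unit) hr (fun p _ => g p.1 p.2)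
    (fun p _ => hg _ _) Finset.univ
  simpa [Fintype.sum_prod_type] using this

/-- Superorthogonality: if the mixed correlations vanish whenever an index occurs exactly once,
then the sum is controlled by the square function. -/
theorem tsum_sum_norm_sum_sq_pow_le {X W S : Type*} [Fintype W] [Fintype S] {r : ℕ} (hr : 1 ≤ r)
    (G : W → S → X → ℂ) (hG : ∀ w s, Summable fun x => ‖G w s x‖ ^ (2 * r))
    (horth : ∀ (w : Fin r → W) (σ : Fin r ⊕ Fin r → S), (∃ i, ∀ j, j ≠ i → σ j ≠ σ i) →
      ∑' x, ∏ i, (G (w i) (σ (.inl i)) x * conj (G (w i) (σ (.inr i)) x)) = 0) :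
    ∑' x, (∑ w, ‖∑ s, G w s x‖ ^ 2) ^ r ≤
      (2 * r : ℝ) ^ (2 * r) * ∑' x, (∑ s, ∑ w, ‖G w s x‖ ^ 2) ^ r := by
  classical
  set Z : (Fin r → W) → (Fin r ⊕ Fin r → S) → X → ℂ := fun w σ x =>
    ∏ i, (G (w i) (σ (.inl i)) x * conj (G (w i) (σ (.inr i)) x)) with hZ
  have hZs : ∀ w σ, Summable (Z w σ) := fun w σ =>
    summable_prod_mul_conj hr _ _ (fun i => hG _ _) fun i => hG _ _
  have hexp : ∀ x, (((∑ w, ‖∑ s, G w s x‖ ^ 2) ^ r : ℝ) : ℂ) = ∑ σ, ∑ w, Z w σ x := by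
    intro x
    have h := prod_sum_norm_sum_sq (r := r) (fun w s => G w s x) (fun _ => Finset.univ)
    rw [Finset.prod_const, Finset.card_univ, Fintype.card_fin] at h
    rw [h, Finset.sum_comm (s := (Finset.univ : Finset (Fin r ⊕ Fin r → S)))]
    refine Finset.sum_congr rfl fun w _ => ?_
    rw [Fintype.piFinset_univ, ← Finset.sum_product', Finset.univ_product_univ]
    exact Fintype.sum_equiv (Equiv.sumArrowEquivProdArrow _ _ _).symm _ _ fun p => rfl
  set good : Finset (Fin r ⊕ Fin r → S) :=
    Finset.univ.filter fun σ => ∀ i, ∃ j, j ≠ i ∧ σ j = σ i with hgood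
  have hL : ((∑' x, (∑ w, ‖∑ s, G w s x‖ ^ 2) ^ r : ℝ) : ℂ) = ∑' x, ∑ σ ∈ good, ∑ w, Z w σ x := by
    rw [Complex.ofReal_tsum]
    simp only [hexp]
    rw [Summable.tsum_finsetSum fun σ _ => summable_sum fun w _ => hZs w σ,
      Summable.tsum_finsetSum fun σ _ => summable_sum fun w _ => hZs w σ]
    symm
    refine Finset.sum_subset (Finset.subset_univ _) fun σ _ hσ => ?_
    rw [Summable.tsum_finsetSum fun w _ => hZs w σ]
    refine Finset.sum_eq_zero fun w _ => horth w σ ?_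
    simp only [hgood, Finset.mem_filter, Finset.mem_univ, true_and, not_forall] at hσ
    obtain ⟨i, hi⟩ := hσ
    exact ⟨i, fun j hj h => hi ⟨j, hj, h⟩⟩
  have hpt : ∀ x, ‖∑ σ ∈ good, ∑ w, Z w σ x‖ ≤
      (2 * r : ℝ) ^ (2 * r) * (∑ s, ∑ w, ‖G w s x‖ ^ 2) ^ r := by
    intro x
    set h : S → ℝ := fun s => Real.sqrt (∑ w, ‖G w s x‖ ^ 2) with hh
    have hsq : ∀ s, h s ^ 2 = ∑ w, ‖G w s x‖ ^ 2 := fun s =>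
      Real.sq_sqrt (Finset.sum_nonneg fun w _ => by positivity)
    calc _ ≤ ∑ σ ∈ good, ∑ w, ‖Z w σ x‖ :=
          (norm_sum_le _ _).trans (Finset.sum_le_sum fun σ _ => norm_sum_le _ _)
      -- For fixed σ the sum over w factors over i, and each factor is estimated by Cauchy–Schwarz
      -- in one variable w.
      _ ≤ ∑ σ ∈ good, ∏ i, h (σ i) := by
          refine Finset.sum_le_sum fun σ _ => ?_
          simp only [hZ, norm_prod, norm_mul, RCLike.norm_conj]
          have := Finset.prod_univ_sum (fun _ : Fin r => (Finset.univ : Finset W))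
            (fun i w => ‖G w (σ (.inl i)) x‖ * ‖G w (σ (.inr i)) x‖)
          rw [Fintype.piFinset_univ] at this
          rw [← this, Fintype.prod_sum_type, ← Finset.prod_mul_distrib]
          refine Finset.prod_le_prod (fun i _ => Finset.sum_nonneg fun w _ => by positivity)
            fun i _ => ?_
          exact Real.sum_mul_le_sqrt_mul_sqrt _ _ _
      _ ≤ (2 * r : ℝ) ^ (2 * r) * (∑ s, h s ^ 2) ^ r := by
          have h1 := sum_prod_le_of_forall_exists_ne (ι := Fin r ⊕ Fin r) r
            (by simp; ring) h (fun s => Real.sqrt_nonneg _)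
          refine le_trans (le_of_eq (Finset.sum_congr ?_ fun _ _ => rfl)) h1
          ext σ; simp [hgood]
      _ = _ := by simp only [hsq]
  have hsR : Summable fun x => (2 * r : ℝ) ^ (2 * r) * (∑ s, ∑ w, ‖G w s x‖ ^ 2) ^ r := by
    have := summable_sum_sum_norm_sq_pow hr G hG
    simp only [Finset.sum_comm (s := (Finset.univ : Finset S))]
    exact this.mul_left _
  have hsN : Summable fun x => ‖∑ σ ∈ good, ∑ w, Z w σ x‖ :=
    Summable.of_nonneg_of_le (fun x => norm_nonneg _) hpt hsR
  calc _ = ‖((∑' x, (∑ w, ‖∑ s, G w s x‖ ^ 2) ^ r : ℝ) : ℂ)‖ := by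
        rw [Complex.norm_real, Real.norm_of_nonneg]
        exact tsum_nonneg fun x => pow_nonneg (Finset.sum_nonneg fun w _ => by positivity) _
    _ ≤ ∑' x, ‖∑ σ ∈ good, ∑ w, Z w σ x‖ := by
        rw [hL]; exact norm_tsum_le_tsum_norm hsN
    _ ≤ _ := by
        rw [← tsum_mul_left]
        exact hsN.tsum_le_tsum hpt hsR

/-- One step of the superorthogonality argument, for a family indexed by `T` which is partitioned
into the fibres of `π`. -/
theorem tsum_sum_norm_sum_sq_pow_le_add {X W T S : Type*} [Fintype W] [Fintype T] [Fintype S]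
    [DecidableEq S]
    {r : ℕ} (hr : 1 ≤ r) (π : T → S)
    (H : W → T → X → ℂ) (hH : ∀ w t, Summable fun x => ‖H w t x‖ ^ (2 * r))
    (horth₁ : ∀ (w : Fin r → W) (τ : Fin r ⊕ Fin r → T), (∃ i, ∀ j, j ≠ i → π (τ j) ≠ π (τ i)) →
      ∑' x, ∏ i, (H (w i) (τ (.inl i)) x * conj (H (w i) (τ (.inr i)) x)) = 0)
    (horth₂ : ∀ (w : Fin r → W) (t t' : Fin r → T), Function.Injective (π ∘ t) → π ∘ t = π ∘ t' →
      t ≠ t' → ∑' x, ∏ i, (H (w i) (t i) x * conj (H (w i) (t' i) x)) = 0) :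
    ∑' x, (∑ w, ‖∑ t, H w t x‖ ^ 2) ^ r ≤
      (2 * r : ℝ) ^ (2 * r) * (2 * ∑' x, (∑ w, ∑ t, ‖H w t x‖ ^ 2) ^ r +
        (2 * (r : ℝ) ^ 2) ^ r * ∑ s, ∑' x, (∑ w, ‖∑ t with π t = s, H w t x‖ ^ 2) ^ r) := by
  classical
  have h2r : 2 * r ≠ 0 := by omega
  set Ts : S → Finset T := fun s => Finset.univ.filter fun t => π t = s with hTs
  set G : W → S → X → ℂ := fun w s x => ∑ t ∈ Ts s, H w t x with hGdef
  have hG : ∀ w s, Summable fun x => ‖G w s x‖ ^ (2 * r) := fun w s =>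
    summable_norm_sum_pow' h2r _ _ fun t _ => hH w t
  have hZs : ∀ (w : Fin r → W) (t t' : Fin r → T), Summable fun x =>
      ∏ i : Fin r, (H (w i) (t i) x * conj (H (w i) (t' i) x)) := fun w t t' =>
    summable_prod_mul_conj hr _ _ (fun i => hH _ _) fun i => hH _ _
  have hGorth : ∀ (w : Fin r → W) (σ : Fin r ⊕ Fin r → S), (∃ i, ∀ j, j ≠ i → σ j ≠ σ i) →
      ∑' x, ∏ i, (G (w i) (σ (.inl i)) x * conj (G (w i) (σ (.inr i)) x)) = 0 := by
    rintro w σ ⟨i₀, hi₀⟩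
    simp only [hGdef, map_sum, Finset.prod_mul_distrib, Finset.prod_univ_sum]
    simp only [Finset.sum_mul_sum, ← Finset.prod_mul_distrib]
    rw [Summable.tsum_finsetSum fun t _ => summable_sum fun t' _ => hZs w t t']
    refine Finset.sum_eq_zero fun t ht => ?_
    rw [Summable.tsum_finsetSum fun t' _ => hZs w t t']
    refine Finset.sum_eq_zero fun t' ht' => ?_
    simp only [Fintype.mem_piFinset, hTs, Finset.mem_filter, Finset.mem_univ, true_and] at ht ht'
    refine horth₁ w (Sum.elim t t') ⟨i₀, fun j hj => ?_⟩
    have : ∀ j, π (Sum.elim t t' j) = σ j := by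
      rintro (j | j)
      · exact ht j
      · exact ht' j
    rw [this, this]; exact hi₀ j hj
  have h1 := tsum_sum_norm_sum_sq_pow_le hr G hG hGorth
  have hfib : ∀ w x, ∑ s, G w s x = ∑ t, H w t x := fun w x =>
    Finset.sum_fiberwise_of_maps_to (fun _ _ => Finset.mem_univ _) _
  simp only [hfib] at h1
  refine h1.trans (mul_le_mul_of_nonneg_left ?_ (by positivity))
  -- For pairwise distinct fibres, `horth₂` leaves only the terms t = t', so the inner sums may be
  -- replaced by sums of squares with equality.
  have hinj : ∀ s : Fin r → S, Function.Injective s →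
      ∑' x, ∏ i, ∑ w, ‖∑ t ∈ Ts (s i), H w t x‖ ^ 2 =
        ∑' x, ∏ i, ∑ w, ∑ t ∈ Ts (s i), ‖H w t x‖ ^ 2 := by
    intro s hs
    rw [← Complex.ofReal_inj, Complex.ofReal_tsum, Complex.ofReal_tsum]
    simp only [prod_sum_norm_sum_sq (fun w t => H w t _)]
    have hR : ∀ x, ((∏ i, ∑ w, ∑ t ∈ Ts (s i), ‖H w t x‖ ^ 2 : ℝ) : ℂ) =
        ∑ w : Fin r → W, ∑ t ∈ Fintype.piFinset fun i => Ts (s i),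
          ∏ i, (H (w i) (t i) x * conj (H (w i) (t i) x)) := by
      intro x
      push_cast
      simp only [Finset.prod_univ_sum, Fintype.piFinset_univ, Complex.mul_conj,
        Complex.normSq_eq_norm_sq]
      push_cast
      rfl
    simp only [hR]
    rw [Summable.tsum_finsetSum fun w _ => summable_sum fun t _ => summable_sum fun t' _ =>
        hZs w t t', Summable.tsum_finsetSum fun w _ => summable_sum fun t _ => hZs w t t]
    refine Finset.sum_congr rfl fun w _ => ?_
    rw [Summable.tsum_finsetSum fun t _ => summable_sum fun t' _ =>
        hZs w t t', Summable.tsum_finsetSum fun t _ => hZs w t t]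
    refine Finset.sum_congr rfl fun t ht => ?_
    rw [Summable.tsum_finsetSum fun t' _ => hZs w t t']
    refine Finset.sum_eq_single_of_mem t ht fun t' ht' hne => ?_
    simp only [Fintype.mem_piFinset, hTs, Finset.mem_filter, Finset.mem_univ, true_and] at ht ht'
    have e1 : π ∘ t = s := funext ht
    have e2 : π ∘ t' = s := funext ht'
    exact horth₂ w t t' (e1 ▸ hs) (e1.trans e2.symm) hne.symm
  have hsP : ∀ s : Fin r → S, Summable fun x => ∏ i, ∑ w, ‖∑ t ∈ Ts (s i), H w t x‖ ^ 2 := fun s =>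
    summable_prod_sum_norm_sum_sq hr H hH _
  have hsT := summable_sum_sum_norm_sq_pow hr H hH
  have hsQ : ∀ s : Fin r → S, Summable fun x => ∏ i, ∑ w, ∑ t ∈ Ts (s i), ‖H w t x‖ ^ 2 := by
    intro s
    refine Summable.of_nonneg_of_le (fun x => Finset.prod_nonneg fun i _ => Finset.sum_nonneg
      fun w _ => Finset.sum_nonneg fun t _ => by positivity) (fun x => ?_) hsT
    calc _ ≤ ∏ _i : Fin r, ∑ w, ∑ t, ‖H w t x‖ ^ 2 := by
          refine Finset.prod_le_prod (fun i _ => Finset.sum_nonneg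
            fun w _ => Finset.sum_nonneg fun t _ => by positivity) fun i _ => ?_
          exact Finset.sum_le_sum fun w _ => Finset.sum_le_univ_sum_of_nonneg fun t => by positivity
      _ = _ := by simp
  have hsD : ∀ s, Summable fun x => (∑ w, ‖∑ t ∈ Ts s, H w t x‖ ^ 2) ^ r := fun s =>
    summable_sum_norm_sum_sq_pow hr H hH _
  set inj : Finset (Fin r → S) := Finset.univ.filter fun σ => Function.Injective σ with hinjdef
  calc ∑' x, (∑ s, ∑ w, ‖G w s x‖ ^ 2) ^ r
      -- `sum_pow_le_injective_add` is applied pointwise to the numbers ∑_w |G_{w,s}(x)|². The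
      -- distinct tuples go to `hinj`, while the pure r-th powers are the terms with one fibre
      -- fixed.
      ≤ ∑' x, (2 * ∑ σ ∈ inj, ∏ i, ∑ w, ‖∑ t ∈ Ts (σ i), H w t x‖ ^ 2 +
          (2 * (r : ℝ) ^ 2) ^ r * ∑ s, (∑ w, ‖∑ t ∈ Ts s, H w t x‖ ^ 2) ^ r) := by
        refine Summable.tsum_le_tsum (fun x => ?_) ?_ ?_
        · have h3 := sum_pow_le_injective_add r hr (fun s => ∑ w, ‖G w s x‖ ^ 2)
            (fun s => Finset.sum_nonneg fun w _ => by positivity)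
          refine h3.trans (le_of_eq ?_)
          congr 2
          exact Finset.sum_congr (by ext σ; simp [hinjdef]) fun _ _ => rfl
        · have := summable_sum_sum_norm_sq_pow hr G hG
          simpa only [Finset.sum_comm (s := (Finset.univ : Finset S))] using this
        · exact ((summable_sum fun σ _ => hsP σ).mul_left _).add
            ((summable_sum fun s _ => hsD s).mul_left _)
    _ = 2 * ∑ σ ∈ inj, ∑' x, ∏ i, ∑ w, ‖∑ t ∈ Ts (σ i), H w t x‖ ^ 2 +
          (2 * (r : ℝ) ^ 2) ^ r * ∑ s, ∑' x, (∑ w, ‖∑ t ∈ Ts s, H w t x‖ ^ 2) ^ r := by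
        rw [Summable.tsum_add ((summable_sum fun σ _ => hsP σ).mul_left _)
            ((summable_sum fun s _ => hsD s).mul_left _), tsum_mul_left, tsum_mul_left,
          Summable.tsum_finsetSum fun σ _ => hsP σ, Summable.tsum_finsetSum fun s _ => hsD s]
    _ ≤ _ := by
        refine add_le_add (mul_le_mul_of_nonneg_left ?_ zero_le_two) le_rfl
        rw [Finset.sum_congr rfl fun σ hσ => hinj σ (Finset.mem_filter.1 hσ).2,
          ← Summable.tsum_finsetSum fun σ _ => hsQ σ]
        refine Summable.tsum_le_tsum (fun x => ?_) (summable_sum fun σ _ => hsQ σ) hsT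
        calc _ ≤ ∑ σ : Fin r → S, ∏ i, ∑ w, ∑ t ∈ Ts (σ i), ‖H w t x‖ ^ 2 :=
              Finset.sum_le_univ_sum_of_nonneg fun σ => Finset.prod_nonneg fun i _ =>
                Finset.sum_nonneg fun w _ => Finset.sum_nonneg fun t _ => by positivity
          _ = (∑ s, ∑ w, ∑ t ∈ Ts s, ‖H w t x‖ ^ 2) ^ r := by
              rw [Fintype.sum_pow]
          _ = _ := by
              congr 1
              rw [Finset.sum_comm]
              refine Finset.sum_congr rfl fun w _ => ?_
              exact Finset.sum_fiberwise_of_maps_to (fun _ _ => Finset.mem_univ _) _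

end SuperOrthogonality

/-! ### Spectra of sequences on ℤ^d and vanishing of correlations. -/

section Spectrum

open ComplexConjugate Filter Topology

variable {d : ℕ}

/-- The Haar probability measure on the torus. -/
abbrev torusMeasure (d : ℕ) : Measure (UnitAddTorus (Fin d)) :=
  Measure.pi fun _ => AddCircle.haarAddCircle

theorem mFourierCoeff_eq_integral_torusMeasure (f : UnitAddTorus (Fin d) → ℂ) (n : Fin d → ℤ) :
    mFourierCoeff f n = ∫ t, mFourier (-n) t * f t ∂torusMeasure d := rfl

theorem norm_mFourier_apply (n : Fin d → ℤ) (t : UnitAddTorus (Fin d)) : ‖mFourier n t‖ = 1 := by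
  simp [mFourier, norm_prod, Circle.norm_coe, fourier_apply]

theorem mFourier_apply_add (n : Fin d → ℤ) (s t : UnitAddTorus (Fin d)) :
    mFourier n (s + t) = mFourier n s * mFourier n t := by
  simp [mFourier, ← Finset.prod_mul_distrib, fourier_apply, smul_add, AddCircle.toCircle_add]

theorem mFourier_apply_neg (n : Fin d → ℤ) (t : UnitAddTorus (Fin d)) :
    mFourier n (-t) = conj (mFourier n t) := by
  rw [← mFourier_neg]
  simp [mFourier, fourier_apply]

theorem mFourier_apply_zero (n : Fin d → ℤ) : mFourier n (0 : UnitAddTorus (Fin d)) = 1 := by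
  simp [mFourier, fourier_apply]

/-- Convolution on the torus. -/
def torusConv (a b : UnitAddTorus (Fin d) → ℂ) (θ : UnitAddTorus (Fin d)) : ℂ :=
  ∫ φ, a φ * b (θ - φ) ∂torusMeasure d

theorem continuous_torusConv {a b : UnitAddTorus (Fin d) → ℂ}
    (ha : Integrable a (torusMeasure d)) (hb : Continuous b) : Continuous (torusConv a b) := by
  obtain ⟨C, hC⟩ := isCompact_univ.exists_bound_of_continuousOn hb.continuousOn
  refine continuous_of_dominated (bound := fun φ => ‖a φ‖ * C) (fun θ => ?_) (fun θ => ?_) ?_ ?_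
  · exact ha.1.mul (Continuous.aestronglyMeasurable (by fun_prop))
  · refine Eventually.of_forall fun φ => ?_
    rw [norm_mul]
    exact mul_le_mul_of_nonneg_left (hC _ (Set.mem_univ _)) (norm_nonneg _)
  · exact ha.norm.mul_const _
  · exact Eventually.of_forall fun φ => by fun_prop

/-- Fubini, translation invariance of Haar measure, and multiplicativity of characters. -/
theorem mFourierCoeff_torusConv {a b : UnitAddTorus (Fin d) → ℂ}
    (ha : Integrable a (torusMeasure d)) (hb : Continuous b) (n : Fin d → ℤ) :
    mFourierCoeff (torusConv a b) n = mFourierCoeff a n * mFourierCoeff b n := by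
  obtain ⟨C, hC⟩ := isCompact_univ.exists_bound_of_continuousOn hb.continuousOn
  simp only [mFourierCoeff_eq_integral_torusMeasure, torusConv]
  have hint : Integrable (Function.uncurry fun θ φ : UnitAddTorus (Fin d) =>
      mFourier (-n) θ * (a φ * b (θ - φ))) ((torusMeasure d).prod (torusMeasure d)) := by
    have h1 : Integrable (fun p : UnitAddTorus (Fin d) × UnitAddTorus (Fin d) => a p.2)
        ((torusMeasure d).prod (torusMeasure d)) := ha.comp_snd _
    have h2 := h1.bdd_mul (c := C)
      (f := fun p : UnitAddTorus (Fin d) × UnitAddTorus (Fin d) =>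
        mFourier (-n) p.1 * b (p.1 - p.2))
      (Continuous.aestronglyMeasurable (by fun_prop))
      (Eventually.of_forall fun p => by
        rw [norm_mul, norm_mFourier_apply, one_mul]; exact hC _ (Set.mem_univ _))
    refine h2.congr (Eventually.of_forall fun p => ?_)
    simp only [Function.uncurry]
    ring
  calc _ = ∫ θ, ∫ φ, mFourier (-n) θ * (a φ * b (θ - φ)) ∂torusMeasure d ∂torusMeasure d := by
        simp only [integral_const_mul]
    _ = ∫ φ, ∫ θ, mFourier (-n) θ * (a φ * b (θ - φ)) ∂torusMeasure d ∂torusMeasure d :=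
        integral_integral_swap hint
    _ = ∫ φ, (mFourier (-n) φ * a φ) * ∫ θ, mFourier (-n) θ * b θ ∂torusMeasure d
          ∂torusMeasure d := by
        congr 1; funext φ
        rw [← integral_sub_right_eq_self (μ := torusMeasure d)
          (fun θ => mFourier (-n) θ * b θ) φ, ← integral_const_mul]
        congr 1; funext θ
        have : mFourier (-n) θ = mFourier (-n) φ * mFourier (-n) (θ - φ) := by
          rw [← mFourier_apply_add]; congr 1; abel
        rw [this]; ring
    _ = _ := integral_mul_const _ _

/-- The trigonometric series of a summable sequence has the given coefficients. -/
theorem mFourierCoeff_tsum {G : (Fin d → ℤ) → ℂ} (hG : Summable G) (x : Fin d → ℤ) :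
    mFourierCoeff (∑' n, G n • mFourier n : C(UnitAddTorus (Fin d), ℂ)) x = G x := by
  have hs : Summable fun n => G n • (mFourier n : C(UnitAddTorus (Fin d), ℂ)) := by
    refine Summable.of_norm ?_
    simpa only [norm_smul, mFourier_norm, mul_one] using hG.norm
  have h1 := hs.hasSum.mapL (ContinuousMap.toLp (E := ℂ) 2 (torusMeasure d) ℂ)
  have h2 := h1.mapL (innerSL ℂ (mFourierLp 2 x))
  have h3 : ∀ n, innerSL ℂ (mFourierLp 2 x)
      (ContinuousMap.toLp (E := ℂ) 2 (torusMeasure d) ℂ (G n • mFourier n)) =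
      if x = n then G n else 0 := by
    intro n
    rw [map_smul, map_smul]
    have := (orthonormal_iff_ite.1 (orthonormal_mFourier (d := Fin d))) x n
    rw [innerSL_apply_apply]
    erw [this]
    simp
  simp only [h3] at h2
  have h4 : innerSL ℂ (mFourierLp 2 x)
      (ContinuousMap.toLp (E := ℂ) 2 (torusMeasure d) ℂ (∑' n, G n • mFourier n)) =
      mFourierCoeff (∑' n, G n • mFourier n : C(UnitAddTorus (Fin d), ℂ)) x := by
    rw [← mFourierCoeff_toLp, ← mFourierBasis_repr, HilbertBasis.repr_apply_apply]
    simp; rfl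
  rw [h4] at h2
  have h5 := hasSum_ite_eq x (G x)
  refine h2.unique (h5.congr_fun ?_)
  intro n
  by_cases h : x = n
  · simp [h]
  · simp [h, Ne.symm h]

/-- `G` is the sequence of Fourier coefficients of a continuous function with absolutely convergent
Fourier series that vanishes outside `E`. -/
def HasSpectrum (G : (Fin d → ℤ) → ℂ) (E : Set (UnitAddTorus (Fin d))) : Prop :=
  Summable G ∧ ∃ h : C(UnitAddTorus (Fin d), ℂ), (∀ θ ∉ E, h θ = 0) ∧ ∀ x, mFourierCoeff h x = G x

theorem hasSpectrum_of_tsum {G : (Fin d → ℤ) → ℂ} {E : Set (UnitAddTorus (Fin d))}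
    (hG : Summable G) (h : ∀ θ ∉ E, ∑' n, G n * mFourier n θ = 0) : HasSpectrum G E := by
  refine ⟨hG, ∑' n, G n • mFourier n, fun θ hθ => ?_, mFourierCoeff_tsum hG⟩
  have hs : Summable fun n => G n • (mFourier n : C(UnitAddTorus (Fin d), ℂ)) := by
    refine Summable.of_norm ?_
    simpa only [norm_smul, mFourier_norm, mul_one] using hG.norm
  rw [← h θ hθ, ← ContinuousMap.tsum_apply hs]
  rfl

namespace HasSpectrum

variable {G G' : (Fin d → ℤ) → ℂ} {E E' : Set (UnitAddTorus (Fin d))}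

theorem mono (h : HasSpectrum G E) (hE : E ⊆ E') : HasSpectrum G E' :=
  ⟨h.1, h.2.choose, fun θ hθ => h.2.choose_spec.1 θ fun hh => hθ (hE hh), h.2.choose_spec.2⟩

/-- The sum of the coefficients is the value of the Fourier series at 0. -/
theorem tsum_eq_zero (h : HasSpectrum G E) (h0 : (0 : UnitAddTorus (Fin d)) ∉ E) :
    ∑' x, G x = 0 := by
  obtain ⟨hs, f, hf, hc⟩ := h
  have hc' : mFourierCoeff f = G := funext hc
  have := hasSum_mFourier_series_apply_of_summable (f := f) (by rw [hc']; exact hs) 0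
  simp only [hc', mFourier_apply_zero, smul_eq_mul, mul_one, hf 0 h0] at this
  exact this.tsum_eq

theorem zero : HasSpectrum (fun _ : Fin d → ℤ => 0) E :=
  hasSpectrum_of_tsum summable_zero (by simp)

theorem add (h : HasSpectrum G E) (h' : HasSpectrum G' E) :
    HasSpectrum (fun x => G x + G' x) E := by
  obtain ⟨hs, f, hf, hc⟩ := h
  obtain ⟨hs', f', hf', hc'⟩ := h'
  refine ⟨hs.add hs', f + f', fun θ hθ => by simp [hf θ hθ, hf' θ hθ], fun x => ?_⟩
  dsimp only
  rw [← hc, ← hc']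
  simp only [mFourierCoeff_eq_integral_torusMeasure]
  rw [← integral_add]
  · congr 1; funext t; simp [mul_add]
  · exact (Continuous.integrable_of_hasCompactSupport (by fun_prop)
      (HasCompactSupport.of_compactSpace _))
  · exact (Continuous.integrable_of_hasCompactSupport (by fun_prop)
      (HasCompactSupport.of_compactSpace _))

theorem sum {α : Type*} (F : Finset α) (g : α → (Fin d → ℤ) → ℂ)
    (h : ∀ a ∈ F, HasSpectrum (g a) E) : HasSpectrum (fun x => ∑ a ∈ F, g a x) E := by
  classical
  induction F using Finset.induction_on with
  | empty => simpa using zero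
  | insert a F ha ih =>
    simp only [Finset.sum_insert ha]
    exact (h a (by simp)).add (ih fun b hb => h b (by simp [hb]))

/-- The conjugate coefficients belong to the conjugate of the reflected function. -/
theorem map_conj (h : HasSpectrum G E) : HasSpectrum (fun x => conj (G x)) {θ | -θ ∈ E} := by
  obtain ⟨hs, f, hf, hc⟩ := h
  refine ⟨(Complex.hasSum_conj'.2 (by simpa using hs.hasSum)).summable,
    ⟨fun θ => starRingEnd ℂ (f (-θ)), by fun_prop⟩,
    fun θ hθ => by simpa using hf _ hθ, fun x => ?_⟩
  have : (torusMeasure d).IsNegInvariant :=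
    Measure.IsAddHaarMeasure.isNegInvariant_of_regular _
  dsimp only
  rw [← hc]
  simp only [mFourierCoeff_eq_integral_torusMeasure]
  rw [← integral_conj, 
    ← integral_neg_eq_self (μ := torusMeasure d)
      fun t => starRingEnd ℂ (mFourier (-x) t * f t)]
  congr 1; funext t
  simp [mFourier_apply_neg]

/-- A product of coefficients corresponds to a convolution on the torus, whose support lies in the
sum of the supports. -/
theorem mul (h : HasSpectrum G E) (h' : HasSpectrum G' E') :
    HasSpectrum (fun x => G x * G' x) {θ | ∃ φ ∈ E, ∃ φ' ∈ E', θ = φ + φ'} := by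
  obtain ⟨hs, f, hf, hc⟩ := h
  obtain ⟨hs', f', hf', hc'⟩ := h'
  have hi : Integrable f (torusMeasure d) := Continuous.integrable_of_hasCompactSupport
    (by fun_prop) (HasCompactSupport.of_compactSpace _)
  refine ⟨?_, ⟨torusConv f f', continuous_torusConv hi (by fun_prop)⟩, fun θ hθ => ?_, fun x => ?_⟩
  · obtain ⟨C, hC⟩ := (Summable.norm hs').tendsto_cofinite_zero.bddAbove_range_of_cofinite
    refine Summable.of_norm_bounded (g := fun x => ‖G x‖ * C) (hs.norm.mul_right C) fun x => ?_
    rw [norm_mul]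
    exact mul_le_mul_of_nonneg_left (hC ⟨x, rfl⟩) (norm_nonneg _)
  · simp only [ContinuousMap.coe_mk, torusConv]
    refine integral_eq_zero_of_ae (Eventually.of_forall fun φ => ?_)
    by_cases h1 : φ ∈ E
    · have h2 : θ - φ ∉ E' := fun h2 => hθ ⟨φ, h1, θ - φ, h2, by abel⟩
      simp [hf' _ h2]
    · simp [hf _ h1]
  · dsimp only
    rw [← hc, ← hc', ← mFourierCoeff_torusConv hi (by fun_prop)]
    rfl

/-- Nonemptiness matters: the empty product is the constant 1, which is not summable for d ≥ 1. -/
theorem prod {α : Type*} (F : Finset α) (hF : F.Nonempty) (g : α → (Fin d → ℤ) → ℂ)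
    (E : α → Set (UnitAddTorus (Fin d)))
    (h : ∀ a ∈ F, HasSpectrum (g a) (E a)) :
    HasSpectrum (fun x => ∏ a ∈ F, g a x)
      {θ | ∃ φ : α → UnitAddTorus (Fin d), (∀ a ∈ F, φ a ∈ E a) ∧ θ = ∑ a ∈ F, φ a} := by
  classical
  induction hF using Finset.Nonempty.cons_induction with
  | singleton a =>
    simp only [Finset.prod_singleton]
    exact (h a (by simp)).mono fun θ hθ => ⟨fun _ => θ, by simpa using hθ, by simp⟩
  | cons a F ha hF ih =>
    simp only [Finset.prod_cons]
    refine ((h a (by simp)).mul (ih fun b hb => h b (by simp [hb]))).mono ?_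
    rintro θ ⟨φ, hφ, _, ⟨ψ, hψ, rfl⟩, rfl⟩
    refine ⟨Function.update ψ a φ, fun b hb => ?_, ?_⟩
    · rcases eq_or_ne b a with rfl | hba
      · simpa using hφ
      · rw [Function.update_of_ne hba]
        exact hψ b ((Finset.mem_cons.1 hb).resolve_left hba)
    · rw [Finset.sum_cons, Function.update_self]
      congr 1
      refine Finset.sum_congr rfl fun b hb => ?_
      rw [Function.update_of_ne]
      rintro rfl; exact ha hb

end HasSpectrum

/-- A continuous bump on the torus, supported in the ball of radius `1/(n+1)`. -/
def torusBump (d n : ℕ) : C(UnitAddTorus (Fin d), ℂ) where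
  toFun θ := ((max 0 (1 / ((n : ℝ) + 1) - ‖θ‖) : ℝ) : ℂ)
  continuous_toFun := by fun_prop

theorem integrable_torusBump (d n : ℕ) : Integrable (torusBump d n) (torusMeasure d) :=
  Continuous.integrable_of_hasCompactSupport (by fun_prop) (HasCompactSupport.of_compactSpace _)

theorem integral_norm_torusBump (d n : ℕ) :
    mFourierCoeff (torusBump d n) 0 = ((∫ θ, ‖torusBump d n θ‖ ∂torusMeasure d : ℝ) : ℂ) := by
  rw [mFourierCoeff_eq_integral_torusMeasure, ← integral_complex_ofReal]
  congr 1; funext θ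
  have h : (0 : ℝ) ≤ max 0 (1 / ((n : ℝ) + 1) - ‖θ‖) := le_max_left _ _
  simp only [neg_zero, mFourier_zero, torusBump, ContinuousMap.one_apply, one_mul,
    ContinuousMap.coe_mk, Complex.norm_real, Real.norm_of_nonneg h]

theorem integral_norm_torusBump_pos (d n : ℕ) : 0 < ∫ θ, ‖torusBump d n θ‖ ∂torusMeasure d := by
  refine Continuous.integral_pos_of_hasCompactSupport_nonneg_nonzero (x := 0) (by fun_prop)
    (HasCompactSupport.of_compactSpace _) (fun θ => norm_nonneg _) ?_
  have : (0 : ℝ) < 1 / ((n : ℝ) + 1) := by positivity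
  simp only [torusBump, ContinuousMap.coe_mk, norm_zero, sub_zero, max_eq_right this.le,
    Complex.norm_real]
  exact norm_ne_zero_iff.2 this.ne'

/-- Cut-offs on `ℤ^d` with shrinking spectrum, tending to `1`. -/
def cutoffSeq (d n : ℕ) (x : Fin d → ℤ) : ℂ :=
  (mFourierCoeff (torusBump d n) x / mFourierCoeff (torusBump d n) 0) ^ 2

theorem norm_mFourierCoeff_torusBump_le (d n : ℕ) (x : Fin d → ℤ) :
    ‖mFourierCoeff (torusBump d n) x‖ ≤ ∫ θ, ‖torusBump d n θ‖ ∂torusMeasure d := by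
  rw [mFourierCoeff_eq_integral_torusMeasure]
  refine (norm_integral_le_integral_norm _).trans (le_of_eq ?_)
  simp [norm_mFourier_apply]

theorem norm_cutoffSeq_le_one (d n : ℕ) (x : Fin d → ℤ) : ‖cutoffSeq d n x‖ ≤ 1 := by
  rw [cutoffSeq, norm_pow, norm_div, integral_norm_torusBump, Complex.norm_real,
    Real.norm_of_nonneg (integral_norm_torusBump_pos d n).le]
  refine pow_le_one₀ (by positivity) ?_
  rw [div_le_one (integral_norm_torusBump_pos d n)]
  exact norm_mFourierCoeff_torusBump_le d n x

/-- The normalized bumps form an approximate identity at 0, where every character equals 1. -/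
theorem tendsto_cutoffSeq (d : ℕ) (x : Fin d → ℤ) :
    Tendsto (fun n => cutoffSeq d n x) atTop (𝓝 1) := by
  have key : Tendsto (fun n => mFourierCoeff (torusBump d n) x / mFourierCoeff (torusBump d n) 0)
      atTop (𝓝 1) := by
    rw [Metric.tendsto_atTop]
    intro ε hε
    have hc : ContinuousAt (fun θ : UnitAddTorus (Fin d) => mFourier (-x) θ) 0 := by fun_prop
    obtain ⟨δ, hδ, hball⟩ := Metric.continuousAt_iff.1 hc (ε / 2) (by positivity)
    obtain ⟨n₀, hn₀⟩ := exists_nat_one_div_lt hδ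
    refine ⟨n₀, fun n hn => ?_⟩
    have hI := integral_norm_torusBump_pos d n
    rw [dist_eq_norm, div_sub_one (by rw [integral_norm_torusBump]; exact_mod_cast hI.ne'),
      norm_div, integral_norm_torusBump, Complex.norm_real, Real.norm_of_nonneg hI.le,
      div_lt_iff₀ hI, ← integral_norm_torusBump]
    have hi : ∀ y, Integrable (fun t => mFourier (-y) t * torusBump d n t) (torusMeasure d) :=
      fun y => Continuous.integrable_of_hasCompactSupport
        (by fun_prop) (HasCompactSupport.of_compactSpace _)
    calc ‖mFourierCoeff (torusBump d n) x - mFourierCoeff (torusBump d n) 0‖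
        = ‖∫ t, (mFourier (-x) t - 1) * torusBump d n t ∂torusMeasure d‖ := by
          simp only [mFourierCoeff_eq_integral_torusMeasure]
          rw [← integral_sub (hi x) (hi 0)]
          congr 2; funext t; simp [mFourier_zero, sub_mul]
      _ ≤ ∫ t, (ε / 2) * ‖torusBump d n t‖ ∂torusMeasure d := by
          refine norm_integral_le_of_norm_le ((integrable_torusBump d n).norm.const_mul _)
            (Eventually.of_forall fun t => ?_)
          rw [norm_mul]
          by_cases ht : ‖t‖ < δ
          · refine mul_le_mul_of_nonneg_right ?_ (norm_nonneg _)
            have := hball (x := t) (by simpa using ht)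
            rw [dist_eq_norm, mFourier_apply_zero] at this
            exact this.le
          · have : torusBump d n t = 0 := by
              have h1 : 1 / ((n : ℝ) + 1) ≤ 1 / ((n₀ : ℝ) + 1) := by gcongr
              simp only [torusBump, ContinuousMap.coe_mk]
              rw [max_eq_left (by linarith)]; simp
            simp [this]
      _ = (ε / 2) * ∫ t, ‖torusBump d n t‖ ∂torusMeasure d := integral_const_mul _ _
      _ < _ := by
        refine mul_lt_mul_of_pos_right ?_ hI
        linarith
  simpa [cutoffSeq] using key.pow 2

/-- This is the purpose of the square in `cutoffSeq`: the coefficients of a bump are square summable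
by Parseval. -/
theorem summable_cutoffSeq (d n : ℕ) : Summable (cutoffSeq d n) := by
  refine Summable.of_norm ?_
  simp only [cutoffSeq, norm_pow, norm_div, div_pow]
  refine Summable.div_const ?_ _
  have := (hasSum_sq_mFourierCoeff 
    (ContinuousMap.toLp (E := ℂ) 2 (torusMeasure d) ℂ (torusBump d n))).summable
  refine this.congr fun x => ?_
  rw [← mFourierCoeff_toLp]
  rfl

/-- The continuous function on the torus with Fourier coefficients `cutoffSeq`. -/
def cutoffKernel (d n : ℕ) (θ : UnitAddTorus (Fin d)) : ℂ :=
  (mFourierCoeff (torusBump d n) 0 ^ 2)⁻¹ * torusConv (torusBump d n) (torusBump d n) θ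

theorem continuous_cutoffKernel (d n : ℕ) : Continuous (cutoffKernel d n) :=
  (continuous_torusConv (integrable_torusBump d n) (by fun_prop)).const_mul _

theorem mFourierCoeff_cutoffKernel (d n : ℕ) (x : Fin d → ℤ) :
    mFourierCoeff (cutoffKernel d n) x = cutoffSeq d n x := by
  have : mFourierCoeff (cutoffKernel d n) x = (mFourierCoeff (torusBump d n) 0 ^ 2)⁻¹ *
      mFourierCoeff (torusConv (torusBump d n) (torusBump d n)) x := by
    simp only [mFourierCoeff_eq_integral_torusMeasure, cutoffKernel]
    rw [← integral_const_mul]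
    congr 1; funext t; ring
  rw [this, mFourierCoeff_torusConv (integrable_torusBump d n) (by fun_prop), cutoffSeq, div_pow]
  ring

/-- Convolving the bump with itself doubles the radius of its support. -/
theorem cutoffKernel_eq_zero {d n : ℕ} {θ : UnitAddTorus (Fin d)}
    (h : 2 / ((n : ℝ) + 1) < ‖θ‖) : cutoffKernel d n θ = 0 := by
  rw [cutoffKernel, torusConv, integral_eq_zero_of_ae, mul_zero]
  refine Eventually.of_forall fun φ => ?_
  have hz : ∀ ψ : UnitAddTorus (Fin d), 1 / ((n : ℝ) + 1) ≤ ‖ψ‖ → torusBump d n ψ = 0 := by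
    intro ψ hψ
    simp only [torusBump, ContinuousMap.coe_mk]
    rw [max_eq_left (by linarith)]; simp
  by_cases h1 : 1 / ((n : ℝ) + 1) ≤ ‖φ‖
  · simp [hz φ h1]
  · have h2 : ‖θ‖ ≤ ‖θ - φ‖ + ‖φ‖ := by simpa using norm_add_le (θ - φ) φ
    have h3 : 2 / ((n : ℝ) + 1) = 1 / ((n : ℝ) + 1) + 1 / ((n : ℝ) + 1) := by ring
    simp [hz (θ - φ) (by linarith)]

/-- The spectrum of `G` is contained in `E`, with room to spare. -/
def Banded (G : (Fin d → ℤ) → ℂ) (E : Set (UnitAddTorus (Fin d))) : Prop :=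
  ∀ᶠ n in atTop, HasSpectrum (fun x => cutoffSeq d n x * G x) E

theorem Banded.mono {G : (Fin d → ℤ) → ℂ} {E E' : Set (UnitAddTorus (Fin d))}
    (h : Banded G E) (hE : E ⊆ E') : Banded G E' :=
  Eventually.mono h fun _ hn => hn.mono hE

theorem Banded.sum {α : Type*} (F : Finset α) (g : α → (Fin d → ℤ) → ℂ)
    {E : Set (UnitAddTorus (Fin d))}
    (h : ∀ a ∈ F, Banded (g a) E) : Banded (fun x => ∑ a ∈ F, g a x) E := by
  have := (Filter.eventually_all_finset F).2 h
  filter_upwards [this] with n hn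
  simp only [Finset.mul_sum]
  exact HasSpectrum.sum F _ hn

/-- Correlations of functions whose spectra do not interact vanish. -/
theorem tsum_prod_mul_conj_eq_zero {r : ℕ} (hr : 1 ≤ r) (a b : Fin r → (Fin d → ℤ) → ℂ)
    (E E' : Fin r → Set (UnitAddTorus (Fin d)))
    (ha : ∀ i, Banded (a i) (E i)) (hb : ∀ i, Banded (b i) (E' i))
    (hs : Summable fun x => ∏ i, (a i x * conj (b i x)))
    (h0 : ∀ θ θ' : Fin r → UnitAddTorus (Fin d), (∀ i, θ i ∈ E i) → (∀ i, θ' i ∈ E' i) →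
      ∑ i, (θ i - θ' i) ≠ 0) :
    ∑' x, ∏ i, (a i x * conj (b i x)) = 0 := by
  have : Nonempty (Fin r) := ⟨⟨0, hr⟩⟩
  -- With cut-offs inserted, every factor is summable with honest spectrum, and by `h0` the spectrum
  -- of the product avoids 0.
  have hz : ∀ᶠ n in atTop, ∑' x, ∏ i, ((cutoffSeq d n x * a i x) *
      conj (cutoffSeq d n x * b i x)) = 0 := by
    filter_upwards [eventually_all.2 ha, eventually_all.2 hb] with n hn hn'
    refine (HasSpectrum.prod Finset.univ Finset.univ_nonempty
      (fun i x => (cutoffSeq d n x * a i x) * conj (cutoffSeq d n x * b i x)) _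
      fun i _ => (hn i).mul (hn' i).map_conj).tsum_eq_zero ?_
    rintro ⟨φ, hφ, hφ0⟩
    choose θ hθ θ' hθ' hsum using fun i => hφ i (Finset.mem_univ i)
    refine h0 θ (fun i => -θ' i) hθ hθ' ?_
    rw [hφ0]
    exact Finset.sum_congr rfl fun i _ => by rw [hsum i]; abel
  -- The cut-offs are bounded by 1 and tend to 1, so they are removed by dominated convergence.
  have hlim : Tendsto (fun n => ∑' x, ∏ i, ((cutoffSeq d n x * a i x) *
      conj (cutoffSeq d n x * b i x))) atTop (𝓝 (∑' x, ∏ i, (a i x * conj (b i x)))) := by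
    refine tendsto_tsum_of_dominated_convergence hs.norm (fun x => ?_)
      (Eventually.of_forall fun n x => ?_)
    · refine tendsto_finsetProd _ fun i _ => ?_
      have h1 := tendsto_cutoffSeq d x
      have h2 := (h1.mul_const (a i x)).mul
        ((Complex.continuous_conj.tendsto _).comp (h1.mul_const (b i x)))
      simpa using h2
    · rw [norm_prod, norm_prod]
      refine Finset.prod_le_prod (fun i _ => norm_nonneg _) fun i _ => ?_
      simp only [norm_mul, RCLike.norm_conj]
      have h1 := norm_cutoffSeq_le_one d n x
      have h2 : ‖cutoffSeq d n x‖ * ‖a i x‖ ≤ ‖a i x‖ :=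
        mul_le_of_le_one_left (norm_nonneg _) h1
      have h3 : ‖cutoffSeq d n x‖ * ‖b i x‖ ≤ ‖b i x‖ :=
        mul_le_of_le_one_left (norm_nonneg _) h1
      exact mul_le_mul h2 h3 (by positivity) (norm_nonneg _)
  exact tendsto_nhds_unique hlim (tendsto_const_nhds.congr' (hz.mono fun n hn => hn.symm))

end Spectrum

/-! ### Spectrum of a multiplier operator applied to a possibly non-summable function. -/

section MultiplierSpectrum

open ComplexConjugate Filter Topology

variable {d : ℕ}

/-- Joint absolute convergence, needed to interchange the convolution sum with the trigonometric
series. The summable cut-off supplies the decay in x. -/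
theorem summable_mul_multiplierOp_prod {m : UnitAddTorus (Fin d) → ℂ} {f χ : (Fin d → ℤ) → ℂ}
    {B : ℝ} (hχ : Summable χ)
    (hs : ∀ x, Summable fun y => ‖mFourierCoeff m (x - y)‖ * ‖f y‖)
    (hB : ∀ x, ∑' y, ‖mFourierCoeff m (x - y)‖ * ‖f y‖ ≤ B) :
    Summable (Function.uncurry fun x y : Fin d → ℤ =>
      ‖χ x‖ * (‖mFourierCoeff m (x - y)‖ * ‖f y‖)) := by
  refine (summable_prod_of_nonneg ?_).2 ⟨fun x => ?_, ?_⟩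
  · exact fun p => mul_nonneg (norm_nonneg _) (mul_nonneg (norm_nonneg _) (norm_nonneg _))
  · have h := (hs x).mul_left ‖χ x‖
    simpa only [Function.uncurry_apply_pair] using h
  simp only [Function.uncurry_apply_pair, tsum_mul_left]
  refine Summable.of_nonneg_of_le
    (fun x => mul_nonneg (norm_nonneg _) (tsum_nonneg fun y => by positivity)) (fun x => ?_)
    (hχ.norm.mul_right B)
  exact mul_le_mul_of_nonneg_left (hB x) (norm_nonneg _)

/-- The spectrum of `ℱ⁻¹(m f̂)` is contained in every neighbourhood of the support of `m`. -/
theorem banded_multiplierOp {m : UnitAddTorus (Fin d) → ℂ} (hm : Integrable m (torusMeasure d))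
    {f : (Fin d → ℤ) → ℂ} {B : ℝ} (hs : ∀ x, Summable fun y => ‖mFourierCoeff m (x - y)‖ * ‖f y‖)
    (hB : ∀ x, ∑' y, ‖mFourierCoeff m (x - y)‖ * ‖f y‖ ≤ B)
    {E : Set (UnitAddTorus (Fin d))} (hE : ∀ θ ∉ E, m θ = 0) {κ : ℝ} (hκ : 0 < κ) :
    Banded (multiplierOp m f) {θ | ∃ φ ∈ E, ‖θ - φ‖ ≤ κ} := by
  obtain ⟨n₀, hn₀⟩ := exists_nat_one_div_lt (half_pos hκ)
  filter_upwards [eventually_ge_atTop n₀] with n hn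
  have hn' : 2 / ((n : ℝ) + 1) ≤ κ := by
    have h1 : 1 / ((n : ℝ) + 1) ≤ 1 / ((n₀ : ℝ) + 1) := by gcongr
    have h2 : 2 / ((n : ℝ) + 1) = 2 * (1 / ((n : ℝ) + 1)) := by ring
    linarith
  have hχ := summable_cutoffSeq d n
  have hprod := summable_mul_multiplierOp_prod hχ hs hB
  have hFB : ∀ x, ‖multiplierOp m f x‖ ≤ B := fun x => by
    refine le_trans ?_ (hB x)
    have := norm_tsum_le_tsum_norm (f := fun y => mFourierCoeff m (x - y) * f y)
      (by simpa only [norm_mul] using hs x)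
    simpa only [norm_mul, multiplierOp] using this
  refine hasSpectrum_of_tsum ?_ fun θ hθ => ?_
  · refine Summable.of_norm_bounded (hχ.norm.mul_right B) fun x => ?_
    rw [norm_mul]
    exact mul_le_mul_of_nonneg_left (hFB x) (norm_nonneg _)
  · have hprod' : Summable (Function.uncurry fun x y : Fin d → ℤ =>
        cutoffSeq d n x * (mFourierCoeff m (x - y) * f y) * mFourier x θ) := by
      refine Summable.of_norm (hprod.congr fun p => ?_)
      simp only [Function.uncurry, norm_mul, norm_mFourier_apply, mul_one]
    calc ∑' x, cutoffSeq d n x * multiplierOp m f x * mFourier x θ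
        = ∑' x, ∑' y, cutoffSeq d n x * (mFourierCoeff m (x - y) * f y) * mFourier x θ := by
          refine tsum_congr fun x => ?_
          rw [multiplierOp, ← tsum_mul_left, ← tsum_mul_right]
      _ = ∑' y, ∑' x, cutoffSeq d n x * (mFourierCoeff m (x - y) * f y) * mFourier x θ :=
          hprod'.tsum_comm.symm
      _ = 0 := by
          refine (tsum_congr fun y => ?_).trans tsum_zero
          -- For fixed y, modulating m translates its coefficients by y. The inner series is then
          -- the value at θ of a convolution with `cutoffKernel`, which vanishes because θ is
          -- farther than κ from E.
          set a : UnitAddTorus (Fin d) → ℂ := fun φ => m φ * mFourier y φ with ha_def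
          have ha : Integrable a (torusMeasure d) := by
            have := hm.bdd_mul (c := 1) (f := fun φ => mFourier y φ)
              (Continuous.aestronglyMeasurable (by fun_prop))
              (Eventually.of_forall fun φ => (norm_mFourier_apply y φ).le)
            exact this.congr (Eventually.of_forall fun φ => mul_comm _ _)
          have hac : ∀ x, mFourierCoeff a x = mFourierCoeff m (x - y) := by
            intro x
            simp only [mFourierCoeff_eq_integral_torusMeasure, ha_def]
            congr 1; funext t
            have : mFourier (-(x - y)) t = mFourier (-x) t * mFourier y t := by
              rw [← mFourier_add]; congr 2; abel
            rw [this]; ring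
          set c : C(UnitAddTorus (Fin d), ℂ) :=
            ⟨torusConv a (cutoffKernel d n), continuous_torusConv ha (continuous_cutoffKernel d n)⟩
          have hc : ∀ x, mFourierCoeff c x = mFourierCoeff m (x - y) * cutoffSeq d n x := by
            intro x
            rw [← hac, ← mFourierCoeff_cutoffKernel,
              ← mFourierCoeff_torusConv ha (continuous_cutoffKernel d n)]
            rfl
          have hcs : Summable (mFourierCoeff c) := by
            have hb : ∀ x, ‖mFourierCoeff a x‖ ≤ ∫ t, ‖a t‖ ∂torusMeasure d := fun x => by
              rw [mFourierCoeff_eq_integral_torusMeasure]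
              refine (norm_integral_le_integral_norm _).trans (le_of_eq ?_)
              simp [norm_mFourier_apply]
            refine Summable.of_norm_bounded
              (hχ.norm.mul_left (∫ t, ‖a t‖ ∂torusMeasure d)) fun x => ?_
            rw [hc, norm_mul, ← hac]
            exact mul_le_mul_of_nonneg_right (hb x) (norm_nonneg _)
          have hsum := (hasSum_mFourier_series_apply_of_summable hcs θ).tsum_eq
          have hc0 : c θ = 0 := by
            refine integral_eq_zero_of_ae (Eventually.of_forall fun φ => ?_)
            by_cases hφ : φ ∈ E
            · have : κ < ‖θ - φ‖ := by
                by_contra h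
                exact hθ ⟨φ, hφ, not_lt.1 h⟩
              simp [cutoffKernel_eq_zero (hn'.trans_lt this)]
            · simp [ha_def, hE φ hφ]
          rw [hc0] at hsum
          calc _ = ∑' x, f y * (mFourierCoeff c x • mFourier x θ) := by
                refine tsum_congr fun x => ?_
                rw [hc, smul_eq_mul]; ring
            _ = 0 := by rw [tsum_mul_left, hsum, mul_zero]

end MultiplierSpectrum

/-! ### Uniform bounds for sums over translated lattices. -/

section LatticeSums

theorem tsum_pi_prod_le (d : ℕ) (a : Fin d → ℤ → ℝ≥0∞) (M : ℝ≥0∞) (h : ∀ i, ∑' n, a i n ≤ M) :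
    ∑' n : Fin d → ℤ, ∏ i, a i (n i) ≤ M ^ d := by
  induction d with
  | zero => simp [tsum_fintype]
  | succ d ih =>
    rw [← (Fin.consEquiv fun _ : Fin (d + 1) => ℤ).tsum_eq, ENNReal.tsum_prod']
    simp only [Fin.consEquiv_apply, Fin.prod_univ_succ, Fin.cons_zero, Fin.cons_succ]
    simp only [ENNReal.tsum_mul_left, ENNReal.tsum_mul_right]
    rw [pow_succ']
    exact mul_le_mul' (h 0) (ih (fun i => a i.succ) fun i => h i.succ)

/-- An integer shift reduces t to its fractional part in [0,1], for which 1 + n² ≤ 3(1 + (t + n)²).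
-/
theorem exists_tsum_inv_one_add_sq_le :
    ∃ M : ℝ≥0∞, M < ⊤ ∧ ∀ t : ℝ, ∑' n : ℤ, ENNReal.ofReal (1 + (t + n) ^ 2)⁻¹ ≤ M := by
  have hs : Summable fun n : ℤ => 3 * (1 + (n : ℝ) ^ 2)⁻¹ := by
    refine Summable.mul_left _ ?_
    have h1 : Summable fun n : ℤ => 1 / (n : ℝ) ^ 2 := Real.summable_one_div_int_pow.2 one_lt_two
    have h2 : Summable fun n : ℤ => if n = 0 then (1 : ℝ) else 0 :=
      (hasSum_ite_eq (0 : ℤ) (1 : ℝ)).summable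
    refine Summable.of_nonneg_of_le (fun n => by positivity) (fun n => ?_) (h1.add h2)
    by_cases hn : n = 0
    · simp [hn]
    · have : (0 : ℝ) < (n : ℝ) ^ 2 := by positivity
      simp only [hn, if_false, add_zero, one_div]
      exact inv_anti₀ this (by linarith)
  refine ⟨∑' n : ℤ, ENNReal.ofReal (3 * (1 + (n : ℝ) ^ 2)⁻¹),
    lt_top_iff_ne_top.2 hs.tsum_ofReal_ne_top, fun t => ?_⟩
  rw [← (Equiv.subRight ⌊t⌋).tsum_eq]
  refine ENNReal.tsum_le_tsum fun n => ENNReal.ofReal_le_ofReal ?_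
  simp only [Equiv.subRight_apply, Int.cast_sub]
  have h0 := Int.fract_nonneg t
  have h1 := (Int.fract_lt_one t).le
  have e : t + ((n : ℝ) - ⌊t⌋) = Int.fract t + n := by rw [Int.fract]; ring
  rw [e, ← div_eq_mul_inv, inv_eq_one_div, div_le_div_iff₀ (by positivity) (by positivity)]
  have h2 : Int.fract t ^ 2 ≤ 1 := by nlinarith
  nlinarith [sq_nonneg (2 * Int.fract t + n), sq_nonneg (Int.fract t + n)]

variable {d : ℕ}

/-- The lattice point `n` as a vector. -/
def latticeVec (n : Fin d → ℤ) : EuclideanSpace ℝ (Fin d) := WithLp.toLp 2 fun i => (n i : ℝ)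

theorem latticeVec_apply (n : Fin d → ℤ) (i : Fin d) : latticeVec n i = n i := rfl

/-- The sums of a Schwartz function over the translates of the lattice are uniformly bounded. -/
theorem exists_tsum_schwartz_le (ψ : SchwartzMap (EuclideanSpace ℝ (Fin d)) ℂ) :
    ∃ M : ℝ≥0∞, M < ⊤ ∧ ∀ y, ∑' n : Fin d → ℤ, ‖ψ (y + latticeVec n)‖ₑ ≤ M := by
  obtain ⟨M, hM, hMt⟩ := exists_tsum_inv_one_add_sq_le
  -- Decay of order 2d is what is needed to dominate the product of the d one-dimensional weights.
  set C : ℝ := 2 ^ (2 * d) * ((Finset.Iic (2 * d, 0)).sup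
    fun m => SchwartzMap.seminorm ℝ m.1 m.2) ψ with hC
  have hdec : ∀ z, ‖ψ z‖ ≤ C * ∏ i, (1 + z i ^ 2)⁻¹ := by
    intro z
    have h1 := SchwartzMap.one_add_le_sup_seminorm_apply (𝕜 := ℝ) (m := (2 * d, 0)) (k := 2 * d)
      (n := 0) le_rfl le_rfl ψ z
    rw [norm_iteratedFDeriv_zero] at h1
    have h2 : ∏ i, (1 + z i ^ 2) ≤ (1 + ‖z‖) ^ (2 * d) := by
      calc ∏ i, (1 + z i ^ 2) ≤ ∏ _i : Fin d, (1 + ‖z‖) ^ 2 := by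
            refine Finset.prod_le_prod (fun i _ => by positivity) fun i _ => ?_
            have h3 : ‖z i‖ ≤ ‖z‖ := PiLp.norm_apply_le z i
            have h4 : z i ^ 2 = ‖z i‖ ^ 2 := by simp
            rw [h4]
            nlinarith [norm_nonneg (z i), norm_nonneg z]
        _ = _ := by simp [← pow_mul]
    rw [Finset.prod_inv_distrib, ← div_eq_mul_inv,
      le_div_iff₀ (Finset.prod_pos fun i _ => by positivity), mul_comm]
    exact (mul_le_mul_of_nonneg_right h2 (norm_nonneg _)).trans h1
  refine ⟨ENNReal.ofReal C * M ^ d, ENNReal.mul_lt_top ENNReal.ofReal_lt_top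
    (ENNReal.pow_lt_top hM), fun y => ?_⟩
  calc ∑' n : Fin d → ℤ, ‖ψ (y + latticeVec n)‖ₑ
      ≤ ∑' n : Fin d → ℤ, ENNReal.ofReal C * ∏ i, ENNReal.ofReal (1 + (y i + n i) ^ 2)⁻¹ := by
        refine ENNReal.tsum_le_tsum fun n => ?_
        rw [← ofReal_norm, ← ENNReal.ofReal_prod_of_nonneg fun i _ => by positivity,
          ← ENNReal.ofReal_mul (by positivity)]
        exact ENNReal.ofReal_le_ofReal (hdec _)
    _ ≤ _ := by
        rw [ENNReal.tsum_mul_left]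
        exact mul_le_mul_right (tsum_pi_prod_le d (fun i n => ENNReal.ofReal (1 + (y i + n) ^ 2)⁻¹) M
          fun i => hMt _) _

end LatticeSums

/-! ### Domination of the kernel of a localized multiplier. -/

section Kernel

open ComplexConjugate Filter Topology

variable {d : ℕ}

/-- A modulated Schwartz function with compact support, from a cut-off. -/
def cutoffMod {η : EuclideanSpace ℝ (Fin d) → ℝ} (hη : IsCutoff η) (ε : Fin d → ℝ)
    (hε : ∀ i, 0 < ε i) (hd : 1 ≤ d) (v : EuclideanSpace ℝ (Fin d)) :
    SchwartzMap (EuclideanSpace ℝ (Fin d)) ℂ :=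
  HasCompactSupport.toSchwartzMap
    (f := fun ξ => (η (WithLp.toLp 2 fun i => ξ i / ε i) : ℂ) *
      Complex.exp ((2 * Real.pi * inner ℝ ξ v : ℝ) * Complex.I))
    (by
      refine HasCompactSupport.intro (K := (fun y : EuclideanSpace ℝ (Fin d) =>
        (WithLp.toLp 2 fun i => ε i * y i : EuclideanSpace ℝ (Fin d))) '' Metric.closedBall 0 1)
        ((isCompact_closedBall 0 1).image (by fun_prop)) fun ξ hξ => ?_
      have : 1 / (8 * (d : ℝ)) ≤ ‖(WithLp.toLp 2 fun i => ξ i / ε i : EuclideanSpace ℝ (Fin d))‖ := by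
        by_contra hlt
        refine hξ ⟨WithLp.toLp 2 fun i => ξ i / ε i, ?_, ?_⟩
        · have h1 : (1 : ℝ) ≤ d := by exact_mod_cast hd
          have h2 : 1 / (8 * (d : ℝ)) ≤ 1 := by
            rw [div_le_one (by positivity)]; linarith
          simp only [Metric.mem_closedBall, dist_zero_right]
          linarith
        · ext i
          have := (hε i).ne'
          simp; field_simp
      rw [hη.eq_zero _ this]; simp)
    (by
      have h1 : ContDiff ℝ ∞ fun ξ : EuclideanSpace ℝ (Fin d) =>
          (WithLp.toLp 2 fun i => ξ i / ε i : EuclideanSpace ℝ (Fin d)) := by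
        rw [contDiff_euclidean]
        intro i
        simp only [div_eq_mul_inv]
        fun_prop
      have h2 := hη.smooth.comp h1
      refine ContDiff.mul (Complex.ofRealCLM.contDiff.comp h2) ?_
      refine Complex.contDiff_exp.comp ?_
      refine ContDiff.mul (Complex.ofRealCLM.contDiff.comp ?_) contDiff_const
      exact contDiff_const.mul (ContDiff.inner ℝ contDiff_id contDiff_const))

theorem cutoffMod_apply {η : EuclideanSpace ℝ (Fin d) → ℝ} (hη : IsCutoff η) (ε : Fin d → ℝ)
    (hε : ∀ i, 0 < ε i) (hd : 1 ≤ d) (v ξ : EuclideanSpace ℝ (Fin d)) :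
    cutoffMod hη ε hε hd v ξ = (η (WithLp.toLp 2 fun i => ξ i / ε i) : ℂ) *
      Complex.exp ((2 * Real.pi * inner ℝ ξ v : ℝ) * Complex.I) := rfl

/-- Modulation becomes translation, so one Schwartz function serves for all frequencies v. -/
theorem fourier_cutoffMod {η : EuclideanSpace ℝ (Fin d) → ℝ} (hη : IsCutoff η) (ε : Fin d → ℝ)
    (hε : ∀ i, 0 < ε i) (hd : 1 ≤ d) (v y : EuclideanSpace ℝ (Fin d)) :
    𝓕 (cutoffMod hη ε hε hd v) y = 𝓕 (cutoffMod hη ε hε hd 0) (y - v) := by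
  rw [SchwartzMap.fourier_coe, SchwartzMap.fourier_coe, Real.fourier_eq', Real.fourier_eq']
  congr 1; funext ξ
  simp only [cutoffMod_apply, smul_eq_mul, inner_zero_right, mul_zero, Complex.ofReal_zero,
    zero_mul, Complex.exp_zero, mul_one]
  rw [mul_left_comm, ← Complex.exp_add, mul_comm]
  congr 2
  rw [inner_sub_right]
  push_cast; ring

theorem inner_toLp_eq_integral (g : Lp (α := EuclideanSpace ℝ (Fin d)) ℂ 2 volume)
    (ζ : SchwartzMap (EuclideanSpace ℝ (Fin d)) ℂ) :
    inner ℂ (ζ.toLp 2 volume) g = ∫ ξ, g ξ * conj (ζ ξ) := by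
  rw [L2.inner_def]
  refine integral_congr_ae ?_
  filter_upwards [ζ.coeFn_toLp 2] with ξ h2
  rw [h2, RCLike.inner_apply]

theorem integral_fourierInv_mul_conj (g : Lp (α := EuclideanSpace ℝ (Fin d)) ℂ 2 volume)
    (ζ : SchwartzMap (EuclideanSpace ℝ (Fin d)) ℂ) :
    ∫ ξ, (𝓕⁻ g : Lp (α := EuclideanSpace ℝ (Fin d)) ℂ 2 volume) ξ * conj (ζ ξ) =
      ∫ y, g y * conj ((𝓕 ζ : SchwartzMap (EuclideanSpace ℝ (Fin d)) ℂ) y) := by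
  rw [← inner_toLp_eq_integral, ← inner_toLp_eq_integral, ← SchwartzMap.toLp_fourier_eq,
    ← Lp.inner_fourier_eq, FourierInvPair.fourier_fourierInv_eq]

/-- The kernel of a localized multiplier is dominated by an average of an `L^p` function. -/
theorem exists_localMultiplier_kernel_bound {Θ : EuclideanSpace ℝ (Fin d) → ℂ}
    (hΘ : IsLpMultiplier Θ)
    {η : EuclideanSpace ℝ (Fin d) → ℝ} (hη : IsCutoff η) {ε : Fin d → ℝ}
    (hε : ∀ i, 0 < ε i) (hd : 1 ≤ d) {p : ℝ≥0∞} (hp1 : 1 < p) (hp : p < ⊤) :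
    Integrable (localMultiplier Θ η ε) volume ∧
    ∃ g : EuclideanSpace ℝ (Fin d) → ℂ, MemLp g p volume ∧
      ∃ ψ : SchwartzMap (EuclideanSpace ℝ (Fin d)) ℂ, ∀ v,
        ‖∫ ξ, Complex.exp (-(2 * Real.pi * inner ℝ ξ v : ℝ) * Complex.I) *
          localMultiplier Θ η ε ξ‖ₑ ≤ ∫⁻ y, ‖ψ (y - v)‖ₑ * ‖g y‖ₑ := by
  set Ω := localMultiplier Θ η ε with hΩ
  set φ := cutoffMod hη ε hε hd 0 with hφ
  have hφ' : ∀ ξ, φ ξ = (η (WithLp.toLp 2 fun i => ξ i / ε i) : ℂ) := fun ξ => by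
    simp [hφ, cutoffMod_apply]
  have hε2 : ∀ i, 0 < (2 * ε i) := fun i => by linarith [hε i]
  -- Doubling ε makes the cut-off equal to 1 where Ω ≠ 0, since 1/(16d) is half of 1/(8d). There the
  -- conjugate of `ζ v` is just the exponential.
  set ζ : EuclideanSpace ℝ (Fin d) → SchwartzMap (EuclideanSpace ℝ (Fin d)) ℂ :=
    fun v => cutoffMod hη (fun i => 2 * ε i) hε2 hd v with hζ
  have hζΩ : ∀ v ξ, conj (ζ v ξ) * Ω ξ =
      Complex.exp (-(2 * Real.pi * inner ℝ ξ v : ℝ) * Complex.I) * Ω ξ := by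
    intro v ξ
    by_cases h0 : Ω ξ = 0
    · simp [h0]
    · have h1 : ‖(WithLp.toLp 2 fun i => ξ i / ε i : EuclideanSpace ℝ (Fin d))‖ <
          1 / (8 * (d : ℝ)) := by
        by_contra h
        exact h0 (by simp [hΩ, localMultiplier, hη.eq_zero _ (not_lt.1 h)])
      have h2 : (WithLp.toLp 2 fun i => ξ i / (2 * ε i) : EuclideanSpace ℝ (Fin d)) =
          (1 / 2 : ℝ) • WithLp.toLp 2 fun i => ξ i / ε i := by
        ext i; simp; field_simp
      have h3 : η (WithLp.toLp 2 fun i => ξ i / (2 * ε i)) = 1 := by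
        refine hη.eq_one _ ?_
        rw [h2, norm_smul, Real.norm_of_nonneg (by norm_num)]
        have : 1 / (16 * (d : ℝ)) = 1 / 2 * (1 / (8 * (d : ℝ))) := by ring
        rw [this]
        linarith
      simp only [hζ, cutoffMod_apply, h3]
      rw [map_mul, ← Complex.exp_conj, map_mul, Complex.conj_ofReal, Complex.conj_ofReal,
        Complex.conj_I, Complex.ofReal_one, one_mul]
      congr 2
      push_cast; ring
  have hlift := (hΘ.2 p hp1 hp)
  obtain ⟨A, -, hA⟩ := hlift
  -- The multiplier hypothesis is applied to the transform of the cut-off itself. The resulting g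
  -- lies in L² and L^p and satisfies 𝓕⁻ g = Θφ = Ω, so Plancherel writes the kernel as an integral
  -- of g against a translated Schwartz function.
  let ψ₀ : SchwartzMap (EuclideanSpace ℝ (Fin d)) ℂ := 𝓕 φ
  set f : Lp (α := EuclideanSpace ℝ (Fin d)) ℂ 2 volume := ψ₀.toLp 2 with hf
  have hfp : MemLp f p volume := (ψ₀.memLp p).ae_eq (ψ₀.coeFn_toLp 2).symm
  obtain ⟨g, hg, hgn⟩ := hA f hfp
  have hgp : MemLp g p volume := ⟨(Lp.aestronglyMeasurable g), hgn.trans_lt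
    (ENNReal.mul_lt_top ENNReal.coe_lt_top hfp.2)⟩
  have hgΩ : (𝓕⁻ g : Lp (α := EuclideanSpace ℝ (Fin d)) ℂ 2 volume) =ᵐ[volume] Ω := by
    have h1 : (𝓕⁻ f : Lp (α := EuclideanSpace ℝ (Fin d)) ℂ 2 volume) =ᵐ[volume] φ := by
      rw [hf, SchwartzMap.toLp_fourierInv_eq, FourierPair.fourierInv_fourier_eq]
      exact φ.coeFn_toLp 2
    filter_upwards [hg, h1] with ξ h2 h3
    rw [h2, h3, hφ']; rfl
  have hΩ2 : MemLp Ω 2 volume := (Lp.memLp (𝓕⁻ g)).ae_eq hgΩ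
  -- Ω is a product of two L² functions, because `ζ 0` equals 1 wherever Ω does not vanish.
  have hint : Integrable Ω volume := by
    have h1 := ((ζ 0).memLp 2 (μ := volume)).star.integrable_mul hΩ2
    refine h1.congr (Eventually.of_forall fun ξ => ?_)
    have := hζΩ 0 ξ
    simp only [inner_zero_right, mul_zero, neg_zero, Complex.ofReal_zero, zero_mul,
      Complex.exp_zero, one_mul] at this
    simpa using this
  refine ⟨hint, g, hgp, 𝓕 (ζ 0), fun v => ?_⟩
  let ψ : SchwartzMap (EuclideanSpace ℝ (Fin d)) ℂ := 𝓕 (ζ v)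
  have hkey : ∫ ξ, Complex.exp (-(2 * Real.pi * inner ℝ ξ v : ℝ) * Complex.I) * Ω ξ =
      ∫ y, g y * conj (ψ y) := by
    calc _ = ∫ ξ, Ω ξ * conj (ζ v ξ) := by
          congr 1; funext ξ; rw [← hζΩ, mul_comm]
      _ = ∫ ξ, (𝓕⁻ g : Lp (α := EuclideanSpace ℝ (Fin d)) ℂ 2 volume) ξ * conj (ζ v ξ) := by
          refine integral_congr_ae ?_
          filter_upwards [hgΩ] with ξ h1
          rw [h1]
      _ = _ := integral_fourierInv_mul_conj _ _
  rw [hkey]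
  refine (enorm_integral_le_lintegral_enorm _).trans (le_of_eq ?_)
  congr 1; funext y
  rw [enorm_mul, mul_comm, RCLike.enorm_conj]
  congr 2
  exact fourier_cutoffMod hη _ hε2 hd v y

end Kernel

/-! ### Functions on the torus obtained from compactly supported functions on ℝ^d. -/

section Periodization

open ComplexConjugate Filter Topology

variable {d : ℕ}

theorem eq_of_coe_eq_of_mem_Ioc {x y a : ℝ} (hx : x ∈ Set.Ioc a (a + 1)) (hy : y ∈ Set.Ioc a (a + 1))
    (h : (x : UnitAddCircle) = y) : x = y := by
  have := (AddCircle.coe_eq_coe_iff_of_mem_Ioc (p := (1 : ℝ)) (a := a) hx hy).1 h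
  exact this

/-- The periodization of a function supported in `(-1/2, 1/2)^d`. -/
theorem periodize_coe {Ω : EuclideanSpace ℝ (Fin d) → ℂ} (hΩ : ∀ ξ, Ω ξ ≠ 0 → ∀ i, |ξ i| < 1 / 2)
    (ξ : EuclideanSpace ℝ (Fin d)) (hξ : ∀ i, ξ i ∈ Set.Ioc (-(1 / 2) : ℝ) (-(1 / 2) + 1)) :
    periodize Ω (fun i => ((ξ i : ℝ) : UnitAddCircle)) = Ω ξ := by
  rw [periodize, tsum_eq_single ⟨ξ, rfl⟩]
  rintro ⟨x, hx⟩ hne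
  by_contra h0
  refine hne (Subtype.ext ?_)
  ext i
  have h1 := abs_lt.1 (hΩ x h0 i)
  exact eq_of_coe_eq_of_mem_Ioc ⟨by linarith, by linarith⟩ (hξ i) (congrFun hx i)

theorem periodize_ne_zero {Ω : EuclideanSpace ℝ (Fin d) → ℂ} {θ : UnitAddTorus (Fin d)}
    (h : periodize Ω θ ≠ 0) :
    ∃ ξ : EuclideanSpace ℝ (Fin d), Ω ξ ≠ 0 ∧ (fun i => ((ξ i : ℝ) : UnitAddCircle)) = θ := by
  by_contra hcon
  push Not at hcon
  refine h ?_
  rw [periodize]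
  refine (tsum_congr fun x => ?_).trans tsum_zero
  by_contra h0
  exact hcon x h0 x.2

/-- On the fundamental box (-1/2, 1/2]^d only one lift contributes, so the periodization is Ω itself
there. -/
theorem integrable_periodize {Ω : EuclideanSpace ℝ (Fin d) → ℂ}
    (hΩ : ∀ ξ, Ω ξ ≠ 0 → ∀ i, |ξ i| < 1 / 2) (hi : Integrable Ω volume) :
    Integrable (periodize Ω) (torusMeasure d) := by
  have h1 : MeasurePreserving (measurableEquivPiIoc fun _ : Fin d => (-(1 / 2) : ℝ)) (torusMeasure d)
      (Measure.comap Subtype.val volume) := measurePreserving_equivPiIoc _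
  have hms : MeasurableSet {x : Fin d → ℝ | ∀ i, x i ∈ Set.Ioc (-(1 / 2) : ℝ) (-(1 / 2) + 1)} :=
    MeasurableSet.univ_pi' fun i => measurableSet_Ioc
  have h2 := (measurePreserving_subtype_coe (μa := (volume : Measure (Fin d → ℝ))) hms).comp h1
  have h3 : Integrable (fun x : Fin d → ℝ => Ω (WithLp.toLp 2 x)) volume :=
    ((EuclideanSpace.volume_preserving_symm_measurableEquiv_toLp (Fin d)).symm).integrable_comp_of_integrable hi
  have h4 := h2.integrable_comp_of_integrable h3.restrict
  refine h4.congr (Eventually.of_forall fun θ => ?_)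
  have h5 := periodize_coe hΩ (WithLp.toLp 2 fun i => (AddCircle.equivIoc 1 (-(1 / 2) : ℝ) (θ i)).1)
    (fun i => (AddCircle.equivIoc 1 (-(1 / 2) : ℝ) (θ i)).2)
  have h6 : (fun i => (((AddCircle.equivIoc 1 (-(1 / 2) : ℝ) (θ i)).1 : ℝ) : UnitAddCircle)) = θ :=
    funext fun i => AddCircle.coe_equivIoc
  simp only [h6] at h5
  rw [h5]; rfl

theorem mFourier_neg_coe (n : Fin d → ℤ) (ξ : EuclideanSpace ℝ (Fin d)) :
    mFourier (-n) (fun i => ((ξ i : ℝ) : UnitAddCircle)) =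
      Complex.exp (-(2 * Real.pi * inner ℝ ξ (latticeVec n) : ℝ) * Complex.I) := by
  simp only [mFourier, ContinuousMap.coe_mk, fourier_coe_apply, ← Complex.exp_sum]
  congr 1
  rw [PiLp.inner_apply]
  simp only [latticeVec_apply, RCLike.inner_apply, conj_trivial, Pi.neg_apply]
  push_cast
  rw [Finset.mul_sum, ← Finset.sum_neg_distrib, Finset.sum_mul]
  refine Finset.sum_congr rfl fun i _ => ?_
  ring

theorem mFourierCoeff_periodize {Ω : EuclideanSpace ℝ (Fin d) → ℂ}
    (hΩ : ∀ ξ, Ω ξ ≠ 0 → ∀ i, |ξ i| < 1 / 2) (n : Fin d → ℤ) :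
    mFourierCoeff (periodize Ω) n = ∫ ξ : EuclideanSpace ℝ (Fin d),
      Complex.exp (-(2 * Real.pi * inner ℝ ξ (latticeVec n) : ℝ) * Complex.I) * Ω ξ := by
  set Box : Set (Fin d → ℝ) :=
    {x : Fin d → ℝ | ∀ i, x i ∈ Set.Ioc (-(1 / 2) : ℝ) (-(1 / 2) + 1)} with hBox
  have hms : MeasurableSet Box := MeasurableSet.univ_pi' fun i => measurableSet_Ioc
  set G : EuclideanSpace ℝ (Fin d) → ℂ := fun ξ =>
    Complex.exp (-(2 * Real.pi * inner ℝ ξ (latticeVec n) : ℝ) * Complex.I) * Ω ξ with hG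
  have h1 : ∫ ξ, G ξ = ∫ x : Fin d → ℝ, G (WithLp.toLp 2 x) :=
    ((EuclideanSpace.volume_preserving_symm_measurableEquiv_toLp (Fin d)).symm.integral_comp'
      G).symm
  rw [mFourierCoeff_eq_integral _ _ fun _ => (-(1 / 2) : ℝ), h1,
    ← setIntegral_eq_integral_of_forall_compl_eq_zero (s := Box)
      (f := fun x => G (WithLp.toLp 2 x))]
  · refine setIntegral_congr_fun hms fun x hx => ?_
    have h5 := periodize_coe hΩ (WithLp.toLp 2 x) hx
    have h6 := mFourier_neg_coe n (WithLp.toLp 2 x)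
    simp only at h5 h6
    simp only [smul_eq_mul]
    rw [h5, h6]
  · intro x hx
    have : Ω (WithLp.toLp 2 x) = 0 := by
      by_contra h0
      refine hx fun i => ?_
      have h1 := abs_lt.1 (hΩ _ h0 i)
      simp only at h1
      exact ⟨by linarith [h1.1], by linarith [h1.2]⟩
    rw [hG]; dsimp only
    rw [this, mul_zero]

end Periodization

/-! ### Absolute convergence of the convolutions with ℓ^{2r} functions. -/

section Convergence

open ComplexConjugate Filter Topology

variable {d : ℕ}

theorem latticeVec_sub (m n : Fin d → ℤ) : latticeVec (m - n) = latticeVec m - latticeVec n := by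
  ext i; simp [latticeVec_apply]

theorem conjExponent_two_mul {r : ℕ} (hr : 1 ≤ r) :
    (2 * r / (2 * r - 1) : ℝ).HolderConjugate (2 * r) := by
  have h : (1 : ℝ) ≤ r := by exact_mod_cast hr
  have h2 := Real.HolderConjugate.conjExponent (p := (2 * r : ℝ)) (by linarith)
  exact h2.symm

/-- The convolutions of a localized multiplier with an `ℓ^{2r}` function converge absolutely and
uniformly. -/
theorem exists_tsum_mFourierCoeff_periodize_le {Θ : EuclideanSpace ℝ (Fin d) → ℂ}
    (hΘ : IsLpMultiplier Θ)
    {η : EuclideanSpace ℝ (Fin d) → ℝ} (hη : IsCutoff η) {ε : Fin d → ℝ}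
    (hε : ∀ i, 0 < ε i) (hd : 1 ≤ d)
    (hsupp : ∀ ξ, localMultiplier Θ η ε ξ ≠ 0 → ∀ i, |ξ i| < 1 / 2) {r : ℕ} (hr : 1 ≤ r)
    {f : (Fin d → ℤ) → ℂ} (hf : Summable fun y => ‖f y‖ ^ (2 * r)) :
    ∃ B : ℝ≥0∞, B < ⊤ ∧ ∀ x,
      ∑' y, ‖mFourierCoeff (periodize (localMultiplier Θ η ε)) (x - y)‖ₑ * ‖f y‖ₑ ≤ B := by
  set P : ℝ := 2 * r / (2 * r - 1) with hP
  have hconj := conjExponent_two_mul hr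
  rw [← hP] at hconj
  have hP1 : 1 < P := hconj.lt
  have hP0 : 0 < P := by linarith
  obtain ⟨-, g, hg, ψ, hψ⟩ := exists_localMultiplier_kernel_bound hΘ hη hε hd
    (p := ENNReal.ofReal P) (by simpa using hP1) ENNReal.ofReal_lt_top
  obtain ⟨M, hM, hMψ⟩ := exists_tsum_schwartz_le ψ
  have hgfin : ∫⁻ y, ‖g y‖ₑ ^ P < ⊤ := by
    have := lintegral_rpow_enorm_lt_top_of_eLpNorm_lt_top (by simpa using hP0)
      ENNReal.ofReal_ne_top hg.2
    simpa [ENNReal.toReal_ofReal hP0.le] using this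
  have hψfin : ∫⁻ y, ‖ψ y‖ₑ < ⊤ := ψ.integrable.2
  have hffin : ∑' y, ‖f y‖ₑ ^ (2 * r : ℝ) < ⊤ := by
    have h1 : ∀ y, ‖f y‖ₑ ^ (2 * r : ℝ) = ENNReal.ofReal (‖f y‖ ^ (2 * r)) := fun y => by
      rw [ENNReal.ofReal_pow (norm_nonneg _), ofReal_norm, ← ENNReal.rpow_natCast]
      push_cast; rfl
    simp only [h1]
    exact lt_top_iff_ne_top.2 hf.tsum_ofReal_ne_top
  have hgm : AEMeasurable (fun y => ‖g y‖ₑ) volume := hg.1.enorm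
  have hψm : ∀ v, Measurable fun y => ‖ψ (y - v)‖ₑ := fun v =>
    (ψ.continuous.comp (continuous_id.sub continuous_const)).measurable.enorm
  refine ⟨M * (∫⁻ y, ‖g y‖ₑ ^ P) + (∫⁻ y, ‖ψ y‖ₑ) * ∑' y, ‖f y‖ₑ ^ (2 * r : ℝ), ?_, fun x => ?_⟩
  · exact ENNReal.add_lt_top.2 ⟨ENNReal.mul_lt_top hM hgfin, ENNReal.mul_lt_top hψfin hffin⟩
  have hpt : ∀ n, ‖mFourierCoeff (periodize (localMultiplier Θ η ε)) (x - n)‖ₑ * ‖f n‖ₑ ≤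
      (∫⁻ y, ‖ψ (y - latticeVec (x - n))‖ₑ * ‖g y‖ₑ ^ P) +
        (∫⁻ y, ‖ψ y‖ₑ) * ‖f n‖ₑ ^ (2 * r : ℝ) := by
    intro n
    -- Young's inequality, with the factors 1/P and 1/(2r) dropped, separates g from f under the
    -- weight ψ. Summation over n then uses the lattice bound M for ψ in the first term and the
    -- ℓ^{2r} sum of f in the second.
    have hY : ∀ a b : ℝ≥0∞, a * b ≤ a ^ P + b ^ (2 * r : ℝ) := fun a b => by
      refine (ENNReal.young_inequality a b hconj).trans (add_le_add ?_ ?_)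
      · exact ENNReal.div_le_of_le_mul (le_mul_of_one_le_right' (by simpa using hP1.le))
      · refine ENNReal.div_le_of_le_mul (le_mul_of_one_le_right' ?_)
        rw [← ENNReal.ofReal_one]
        exact ENNReal.ofReal_le_ofReal hconj.symm.lt.le
    calc _ ≤ (∫⁻ y, ‖ψ (y - latticeVec (x - n))‖ₑ * ‖g y‖ₑ) * ‖f n‖ₑ := by
          rw [mFourierCoeff_periodize hsupp]
          exact mul_le_mul_left (hψ _) _
      _ = ∫⁻ y, ‖ψ (y - latticeVec (x - n))‖ₑ * ‖g y‖ₑ * ‖f n‖ₑ := by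
          rw [lintegral_mul_const'']
          exact (hψm _).aemeasurable.mul hgm
      _ ≤ ∫⁻ y, (‖ψ (y - latticeVec (x - n))‖ₑ * ‖g y‖ₑ ^ P +
            ‖ψ (y - latticeVec (x - n))‖ₑ * ‖f n‖ₑ ^ (2 * r : ℝ)) := by
          refine lintegral_mono fun y => ?_
          dsimp only
          rw [mul_assoc, ← mul_add]
          exact mul_le_mul_right (hY _ _) _
      _ = _ := by
          rw [lintegral_add_right _ ((hψm _).mul_const _), lintegral_mul_const _ (hψm _),
            lintegral_sub_right_eq_self (fun y => ‖ψ y‖ₑ)]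
  calc _ ≤ ∑' n, ((∫⁻ y, ‖ψ (y - latticeVec (x - n))‖ₑ * ‖g y‖ₑ ^ P) +
        (∫⁻ y, ‖ψ y‖ₑ) * ‖f n‖ₑ ^ (2 * r : ℝ)) := ENNReal.tsum_le_tsum hpt
    _ = (∫⁻ y, ∑' n, ‖ψ (y - latticeVec (x - n))‖ₑ * ‖g y‖ₑ ^ P) +
        (∫⁻ y, ‖ψ y‖ₑ) * ∑' n, ‖f n‖ₑ ^ (2 * r : ℝ) := by
        rw [ENNReal.tsum_add, ENNReal.tsum_mul_left, lintegral_tsum]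
        exact fun n => (hψm _).aemeasurable.mul (hgm.pow_const _)
    _ ≤ _ := by
        refine add_le_add ?_ le_rfl
        rw [← lintegral_const_mul'' _ (hgm.pow_const _)]
        refine lintegral_mono fun y => ?_
        dsimp only
        rw [ENNReal.tsum_mul_right]
        refine mul_le_mul_left (le_trans (le_of_eq ?_) (hMψ (y - latticeVec x))) _
        refine tsum_congr fun n => ?_
        rw [latticeVec_sub]
        congr 2; abel

end Convergence

/-! ### Convergence and spectrum of the functions `f_u`. -/

section MultiplierAt

open ComplexConjugate Filter Topology

variable {d : ℕ}

theorem abs_le_of_localMultiplier_ne_zero {Θ : EuclideanSpace ℝ (Fin d) → ℂ}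
    {η : EuclideanSpace ℝ (Fin d) → ℝ} (hη : IsCutoff η) {ε : Fin d → ℝ} (hε : ∀ i, 0 < ε i)
    (hd : 1 ≤ d) {ξ : EuclideanSpace ℝ (Fin d)} (h : localMultiplier Θ η ε ξ ≠ 0) (i : Fin d) :
    |ξ i| ≤ ε i / 8 := by
  have h1 : ‖(WithLp.toLp 2 fun i => ξ i / ε i : EuclideanSpace ℝ (Fin d))‖ <
      1 / (8 * (d : ℝ)) := by
    by_contra h'
    exact h (by simp [localMultiplier, hη.eq_zero _ (not_lt.1 h')])
  have h2 : 1 / (8 * (d : ℝ)) ≤ 1 / 8 := by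
    have : (1 : ℝ) ≤ d := by exact_mod_cast hd
    refine one_div_le_one_div_of_le (by norm_num) (by linarith)
  have h3 := PiLp.norm_apply_le (WithLp.toLp 2 fun i => ξ i / ε i : EuclideanSpace ℝ (Fin d)) i
  simp only [Real.norm_eq_abs, abs_div, abs_of_pos (hε i)] at h3
  have h4 := (h3.trans h1.le).trans h2
  rw [div_le_iff₀ (hε i)] at h4
  linarith

theorem mFourierCoeff_sub_right (P : UnitAddTorus (Fin d) → ℂ) (c : UnitAddTorus (Fin d))
    (x : Fin d → ℤ) :
    mFourierCoeff (fun ξ => P (ξ - c)) x = mFourier (-x) c * mFourierCoeff P x := by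
  simp only [mFourierCoeff_eq_integral_torusMeasure]
  rw [← integral_const_mul, 
    ← integral_sub_right_eq_self (μ := torusMeasure d)
      (fun t => mFourier (-x) c * (mFourier (-x) t * P t)) c]
  congr 1; funext t
  have : mFourier (-x) t = mFourier (-x) c * mFourier (-x) (t - c) := by
    rw [← mFourier_apply_add]; congr 1; abel
  rw [this]; ring

theorem nsmul_frac (b : Fin d → ℕ) {Q : ℕ} (hQ : Q ≠ 0) : Q • frac b Q = 0 := by
  ext i
  simp only [frac, Pi.smul_apply, Pi.zero_apply]
  rw [← AddCircle.coe_nsmul, nsmul_eq_mul, mul_div_cancel₀ _ (by exact_mod_cast hQ)]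
  have := AddCircle.coe_eq_zero_iff (p := (1 : ℝ)) (x := (b i : ℝ))
  exact this.2 ⟨b i, by simp⟩

theorem norm_coe_unitAddCircle_le (x : ℝ) : ‖(x : UnitAddCircle)‖ ≤ |x| := by
  rw [UnitAddCircle.norm_eq]
  simpa using round_le x 0

variable {Θ : EuclideanSpace ℝ (Fin d) → ℂ} {η : EuclideanSpace ℝ (Fin d) → ℝ} {ε : Fin d → ℝ}
  {k : ℕ} {β : Fin k → ℕ}

theorem integrable_multiplierAt
    (hi : Integrable (periodize (localMultiplier Θ η ε)) (torusMeasure d)) (Q₀ : ℕ) (Λ : Set ℕ)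
    (q : (j : Fin k) → Fin (β j) → ℕ) (u : UnitAddTorus (Fin d)) :
    Integrable (multiplierAt Θ η ε Q₀ Λ q u) (torusMeasure d) := by
  by_cases h : ∃ s : (j : Fin k) → Fin (β j),
      u ∈ setV d q Finset.univ (fun j => s j) ∧ (∏ j, q j (s j)) ∈ Λ
  · have e : multiplierAt Θ η ε Q₀ Λ q u = fun ξ =>
        ∑ b ∈ Fintype.piFinset (fun _ : Fin d => Finset.Icc 1 Q₀),
          periodize (localMultiplier Θ η ε) (ξ - frac b Q₀ - u) := by
      funext ξ; simp only [multiplierAt, if_pos h]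
    rw [e]
    refine integrable_finsetSum _ fun b _ => ?_
    simp only [sub_sub]
    exact hi.comp_sub_right _
  · have e : multiplierAt Θ η ε Q₀ Λ q u = fun ξ => 0 := by
      funext ξ; simp only [multiplierAt, if_neg h]
    rw [e]; exact integrable_zero _ _ _

/-- Translating a multiplier multiplies its coefficients by a unimodular phase, and there are Q₀^d
translates. -/
theorem norm_mFourierCoeff_multiplierAt_le
    (hi : Integrable (periodize (localMultiplier Θ η ε)) (torusMeasure d)) (Q₀ : ℕ) (Λ : Set ℕ)
    (q : (j : Fin k) → Fin (β j) → ℕ) (u : UnitAddTorus (Fin d)) (x : Fin d → ℤ) :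
    ‖mFourierCoeff (multiplierAt Θ η ε Q₀ Λ q u) x‖ ≤
      (Q₀ ^ d : ℕ) * ‖mFourierCoeff (periodize (localMultiplier Θ η ε)) x‖ := by
  by_cases h : ∃ s : (j : Fin k) → Fin (β j),
      u ∈ setV d q Finset.univ (fun j => s j) ∧ (∏ j, q j (s j)) ∈ Λ
  · have e : mFourierCoeff (multiplierAt Θ η ε Q₀ Λ q u) x =
        ∑ b ∈ Fintype.piFinset (fun _ : Fin d => Finset.Icc 1 Q₀),
          mFourier (-x) (frac b Q₀ + u) * mFourierCoeff (periodize (localMultiplier Θ η ε)) x := by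
      simp only [← mFourierCoeff_sub_right]
      simp only [mFourierCoeff_eq_integral_torusMeasure]
      rw [← integral_finsetSum]
      · congr 1; funext t
        simp only [multiplierAt, if_pos h, Finset.mul_sum, sub_sub]
      · intro b _
        have := (hi.comp_sub_right (frac b Q₀ + u)).bdd_mul (c := 1) (f := fun t => mFourier (-x) t)
          (Continuous.aestronglyMeasurable (by fun_prop))
          (Eventually.of_forall fun t => (norm_mFourier_apply _ t).le)
        exact this
    rw [e]
    refine (norm_sum_le _ _).trans (le_of_eq ?_)
    simp only [norm_mul, norm_mFourier_apply, one_mul, Finset.sum_const, nsmul_eq_mul]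
    simp
  · have e : multiplierAt Θ η ε Q₀ Λ q u = fun ξ => 0 := by
      funext ξ; simp only [multiplierAt, if_neg h]
    have : mFourierCoeff (multiplierAt Θ η ε Q₀ Λ q u) x = 0 := by
      rw [e, mFourierCoeff_eq_integral_torusMeasure]; simp
    rw [this, norm_zero]; positivity

theorem exists_of_multiplierAt_ne_zero (hη : IsCutoff η) (hε : ∀ i, 0 < ε i) (hd : 1 ≤ d) {κ : ℝ}
    (hεκ : ∀ i, ε i ≤ κ) {Q₀ : ℕ} (hQ : Q₀ ≠ 0) {Λ : Set ℕ}
    {q : (j : Fin k) → Fin (β j) → ℕ} {u θ : UnitAddTorus (Fin d)}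
    (h : multiplierAt Θ η ε Q₀ Λ q u θ ≠ 0) :
    ∃ y : UnitAddTorus (Fin d), Q₀ • y = 0 ∧ ‖θ - u - y‖ ≤ κ := by
  rw [multiplierAt] at h
  split_ifs at h
  · obtain ⟨b, -, hb⟩ := Finset.exists_ne_zero_of_sum_ne_zero h
    obtain ⟨ξ, hξ, hθ⟩ := periodize_ne_zero hb
    refine ⟨frac b Q₀, nsmul_frac b hQ, ?_⟩
    have hκ : 0 ≤ κ := (hε ⟨0, hd⟩).le.trans (hεκ _)
    rw [sub_right_comm, ← hθ, pi_norm_le_iff_of_nonneg hκ]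
    intro i
    have h1 := abs_le_of_localMultiplier_ne_zero hη hε hd hξ i
    refine (norm_coe_unitAddCircle_le _).trans ?_
    linarith [hε i, hεκ i]
  · exact absurd rfl h

/-- Absolute convergence, uniform boundedness and spectrum of the functions `f_u`. -/
theorem multiplierOp_multiplierAt (hΘ : IsLpMultiplier Θ) (hη : IsCutoff η) (hε : ∀ i, 0 < ε i)
    (hd : 1 ≤ d) {κ : ℝ} (hκ : 0 < κ) (hεκ : ∀ i, ε i ≤ κ) (hκ1 : κ ≤ 1) {Q₀ : ℕ} (hQ : Q₀ ≠ 0)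
    (Λ : Set ℕ) (q : (j : Fin k) → Fin (β j) → ℕ) {r : ℕ} (hr : 1 ≤ r)
    {f : (Fin d → ℤ) → ℂ} (hf : Summable fun y => ‖f y‖ ^ (2 * r)) (u : UnitAddTorus (Fin d)) :
    (∀ x, Summable fun y => mFourierCoeff (multiplierAt Θ η ε Q₀ Λ q u) (x - y) * f y) ∧
    Banded (multiplierOp (multiplierAt Θ η ε Q₀ Λ q u) f)
      {θ | ∃ y : UnitAddTorus (Fin d), Q₀ • y = 0 ∧ ‖θ - u - y‖ ≤ 2 * κ} := by
  have hsupp : ∀ ξ, localMultiplier Θ η ε ξ ≠ 0 → ∀ i, |ξ i| < 1 / 2 := fun ξ hξ i => by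
    have := abs_le_of_localMultiplier_ne_zero hη hε hd hξ i
    linarith [hεκ i]
  have hi := integrable_periodize hsupp (exists_localMultiplier_kernel_bound hΘ hη hε hd
    (p := 2) (by norm_num) (by norm_num)).1
  obtain ⟨B, hB, hBx⟩ := exists_tsum_mFourierCoeff_periodize_le hΘ hη hε hd hsupp hr hf
  have hle : ∀ x y, ‖mFourierCoeff (multiplierAt Θ η ε Q₀ Λ q u) (x - y)‖ * ‖f y‖ ≤
      (Q₀ ^ d : ℕ) * (‖mFourierCoeff (periodize (localMultiplier Θ η ε)) (x - y)‖ * ‖f y‖) := by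
    intro x y
    rw [← mul_assoc]
    exact mul_le_mul_of_nonneg_right (norm_mFourierCoeff_multiplierAt_le hi _ _ _ _ _)
      (norm_nonneg _)
  have hof : ∀ x y, ‖mFourierCoeff (periodize (localMultiplier Θ η ε)) (x - y)‖ₑ * ‖f y‖ₑ =
      ENNReal.ofReal (‖mFourierCoeff (periodize (localMultiplier Θ η ε)) (x - y)‖ * ‖f y‖) := by
    intro x y
    rw [ENNReal.ofReal_mul (norm_nonneg _), ofReal_norm, ofReal_norm]
  have hs0 : ∀ x, Summable fun y =>
      ‖mFourierCoeff (periodize (localMultiplier Θ η ε)) (x - y)‖ * ‖f y‖ := by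
    intro x
    have h1 := (hBx x).trans_lt hB
    simp only [hof] at h1
    have h2 := ENNReal.summable_toReal h1.ne
    refine h2.congr fun y => ?_
    rw [ENNReal.toReal_ofReal (by positivity)]
  have hB0 : ∀ x, ∑' y, ‖mFourierCoeff (periodize (localMultiplier Θ η ε)) (x - y)‖ * ‖f y‖ ≤
      B.toReal := by
    intro x
    have h1 := hBx x
    simp only [hof] at h1
    rw [← ENNReal.ofReal_tsum_of_nonneg (fun y => by positivity) (hs0 x)] at h1
    exact (ENNReal.ofReal_le_iff_le_toReal hB.ne).1 h1
  have hs : ∀ x, Summable fun y =>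
      ‖mFourierCoeff (multiplierAt Θ η ε Q₀ Λ q u) (x - y)‖ * ‖f y‖ := fun x =>
    Summable.of_nonneg_of_le (fun y => by positivity) (hle x) ((hs0 x).mul_left _)
  refine ⟨fun x => Summable.of_norm (by simpa only [norm_mul] using hs x), ?_⟩
  have hBd := banded_multiplierOp (integrable_multiplierAt hi Q₀ Λ q u) (f := f)
    (B := (Q₀ ^ d : ℕ) * B.toReal) hs (fun x => by
      refine ((hs x).tsum_le_tsum (hle x) ((hs0 x).mul_left _)).trans ?_
      rw [tsum_mul_left]
      exact mul_le_mul_of_nonneg_left (hB0 x) (by positivity))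
    (E := {θ | ∃ y : UnitAddTorus (Fin d), Q₀ • y = 0 ∧ ‖θ - u - y‖ ≤ κ})
    (fun θ hθ => by
      by_contra h0
      exact hθ (exists_of_multiplierAt_ne_zero hη hε hd hεκ hQ h0)) hκ
  -- One κ comes from the support of the multiplier, the other from the enlargement in
  -- `banded_multiplierOp`.
  refine hBd.mono ?_
  rintro θ ⟨φ, ⟨y, hy, hφ⟩, hθ⟩
  refine ⟨y, hy, ?_⟩
  have e : θ - u - y = (θ - φ) + (φ - u - y) := by abel
  rw [e]
  exact (norm_add_le _ _).trans (by linarith)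

end MultiplierAt

/-! ### Torsion points of the torus with coprime denominators. -/

section Arithmetic

variable {d : ℕ}

theorem eq_zero_of_nsmul_eq_zero_of_coprime {G : Type*} [AddCommGroup G] {m n : ℕ}
    (h : m.Coprime n) {y : G} (hm : m • y = 0) (hn : n • y = 0) : y = 0 := by
  have h1 := Nat.dvd_gcd (addOrderOf_dvd_iff_nsmul_eq_zero.2 hm)
    (addOrderOf_dvd_iff_nsmul_eq_zero.2 hn)
  rw [h.gcd_eq_one, Nat.dvd_one, AddMonoid.addOrderOf_eq_one_iff] at h1
  exact h1

theorem nsmul_eq_zero_of_dvd {G : Type*} [AddCommGroup G] {m n : ℕ} (h : m ∣ n) {y : G}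
    (hm : m • y = 0) : n • y = 0 :=
  addOrderOf_dvd_iff_nsmul_eq_zero.1 ((addOrderOf_dvd_iff_nsmul_eq_zero.2 hm).trans h)

/-- A torsion point of the torus which is closer to `0` than the inverse of its order vanishes. -/
theorem eq_zero_of_nsmul_eq_zero_of_norm_lt {n : ℕ} (hn : 0 < n) {y : UnitAddTorus (Fin d)}
    (h : n • y = 0) (hy : n * ‖y‖ < 1) : y = 0 := by
  ext i
  by_contra h0
  have hi : n • y i = 0 := congrFun h i
  have hfin : IsOfFinAddOrder (y i) := isOfFinAddOrder_iff_nsmul_eq_zero.2 ⟨n, hn, hi⟩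
  have h1 := AddCircle.le_add_order_smul_norm_of_isOfFinAddOrder hfin h0
  have h2 : (addOrderOf (y i) : ℝ) ≤ n := by
    exact_mod_cast Nat.le_of_dvd hn (addOrderOf_dvd_iff_nsmul_eq_zero.2 hi)
  have h3 : ‖y i‖ ≤ ‖y‖ := norm_le_pi_norm y i
  rw [nsmul_eq_mul] at h1
  have h4 : (addOrderOf (y i) : ℝ) * ‖y i‖ ≤ n * ‖y‖ := by gcongr
  linarith

theorem nsmul_eq_zero_of_mem_fracs {n : ℕ} (hn : n ≠ 0) {t : UnitAddTorus (Fin d)}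
    (ht : t ∈ fracs d n) : n • t = 0 := by
  classical
  obtain ⟨a, -, rfl⟩ := Finset.mem_image.1 ht
  exact nsmul_frac a hn

theorem ne_zero_of_mem_fracs {n : ℕ} (hn : 2 ≤ n) {t : UnitAddTorus (Fin d)}
    (ht : t ∈ fracs d n) : t ≠ 0 := by
  classical
  obtain ⟨a, ha, rfl⟩ := Finset.mem_image.1 ht
  intro h0
  have hgcd := (Finset.mem_filter.1 ha).2
  have hdvd : n ∣ Finset.univ.gcd a := by
    refine Finset.dvd_gcd fun i _ => ?_
    have hi : ((a i / n : ℝ) : UnitAddCircle) = 0 := congrFun h0 i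
    obtain ⟨m, hm⟩ := (AddCircle.coe_eq_zero_iff (p := (1 : ℝ))).1 hi
    have hn0 : (n : ℝ) ≠ 0 := by exact_mod_cast (by omega : n ≠ 0)
    rw [zsmul_eq_mul, mul_one, eq_div_iff hn0] at hm
    have : m * (n : ℤ) = a i := by exact_mod_cast hm
    exact Int.natCast_dvd_natCast.1 ⟨m, by rw [← this, mul_comm]⟩
  rw [Nat.gcd_eq_left hdvd] at hgcd
  omega

/-- The set of all sums `∑_{j ∈ J} v_j` with `v_j ∈ X_j`. -/
def sumset {k : ℕ} (J : Finset (Fin k)) (X : Fin k → Finset (UnitAddTorus (Fin d))) :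
    Finset (UnitAddTorus (Fin d)) := by
  classical exact (Fintype.piFinset fun j : J => X j).image fun u => ∑ j, u j

theorem mem_sumset {k : ℕ} {J : Finset (Fin k)} {X : Fin k → Finset (UnitAddTorus (Fin d))}
    {u : UnitAddTorus (Fin d)} :
    u ∈ sumset J X ↔ ∃ v : Fin k → UnitAddTorus (Fin d), (∀ j ∈ J, v j ∈ X j) ∧ u = ∑ j ∈ J, v j := by
  classical
  rw [sumset, Finset.mem_image]
  constructor
  · rintro ⟨v, hv, rfl⟩
    refine ⟨fun j => if h : j ∈ J then v ⟨j, h⟩ else 0, fun j hj => ?_, ?_⟩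
    · simpa [hj] using Fintype.mem_piFinset.1 hv ⟨j, hj⟩
    · rw [← Finset.sum_coe_sort J (fun j => if h : j ∈ J then v ⟨j, h⟩ else 0)]
      exact Finset.sum_congr rfl fun j _ => by simp
  · rintro ⟨v, hv, rfl⟩
    exact ⟨fun j => v j, Fintype.mem_piFinset.2 fun j => hv j j.2, Finset.sum_coe_sort J v⟩

/-- The fractions in the column `j`. -/
def colPts (d : ℕ) {k : ℕ} {β : Fin k → ℕ} (q : (j : Fin k) → Fin (β j) → ℕ) (j : Fin k) :
    Finset (UnitAddTorus (Fin d)) := by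
  classical exact Finset.univ.biUnion fun s : Fin (β j) => fracs d (q j s)

theorem mem_colPts {k : ℕ} {β : Fin k → ℕ} {q : (j : Fin k) → Fin (β j) → ℕ} {j : Fin k}
    {t : UnitAddTorus (Fin d)} : t ∈ colPts d q j ↔ ∃ s, t ∈ fracs d (q j s) := by
  simp [colPts]

theorem setU_eq_sumset {k : ℕ} {β : Fin k → ℕ} (q : (j : Fin k) → Fin (β j) → ℕ)
    (M : Finset (Fin k)) : setU d q M = sumset M (colPts d q) := rfl

theorem sumset_congr {k : ℕ} {J : Finset (Fin k)} {X X' : Fin k → Finset (UnitAddTorus (Fin d))}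
    (h : ∀ j ∈ J, X j = X' j) : sumset J X = sumset J X' := by
  ext u
  simp only [mem_sumset]
  constructor
  · rintro ⟨v, hv, rfl⟩; exact ⟨v, fun j hj => h j hj ▸ hv j hj, rfl⟩
  · rintro ⟨v, hv, rfl⟩; exact ⟨v, fun j hj => (h j hj).symm ▸ hv j hj, rfl⟩

theorem add_mem_sumset_union {k : ℕ} {J J' : Finset (Fin k)} (hd : Disjoint J J')
    {X X' Y : Fin k → Finset (UnitAddTorus (Fin d))} (hX : ∀ j ∈ J, X j ⊆ Y j)
    (hX' : ∀ j ∈ J', X' j ⊆ Y j) {u u' : UnitAddTorus (Fin d)} (hu : u ∈ sumset J X)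
    (hu' : u' ∈ sumset J' X') : u + u' ∈ sumset (J ∪ J') Y := by
  classical
  obtain ⟨v, hv, rfl⟩ := mem_sumset.1 hu
  obtain ⟨v', hv', rfl⟩ := mem_sumset.1 hu'
  refine mem_sumset.2 ⟨fun j => if j ∈ J then v j else v' j, fun j hj => ?_, ?_⟩
  · by_cases h : j ∈ J
    · simpa [h] using hX j h (hv j h)
    · have h' := (Finset.mem_union.1 hj).resolve_left h
      simpa [h] using hX' j h' (hv' j h')
  · rw [Finset.sum_union hd]
    congr 1
    · exact Finset.sum_congr rfl fun j hj => by simp [hj]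
    · exact Finset.sum_congr rfl fun j hj => by simp [Finset.disjoint_right.1 hd hj]

theorem mem_sumset_singleton {k : ℕ} {j : Fin k} {X : Fin k → Finset (UnitAddTorus (Fin d))}
    {t : UnitAddTorus (Fin d)} (ht : t ∈ X j) : t ∈ sumset {j} X :=
  mem_sumset.2 ⟨fun _ => t, by simpa using ht, by simp⟩

/-- A family of moduli, pairwise coprime, coprime to `Q₀` and at most `b`. -/
structure CoprimeModuli {k : ℕ} {β : Fin k → ℕ} (q : (j : Fin k) → Fin (β j) → ℕ)
    (Q₀ b : ℕ) : Prop where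
  two_le : ∀ j s, 2 ≤ q j s
  le : ∀ j s, q j s ≤ b
  coprime : ∀ x y : (Σ j : Fin k, Fin (β j)), x ≠ y → Nat.Coprime (q x.1 x.2) (q y.1 y.2)
  coprime_left : ∀ j s, Nat.Coprime Q₀ (q j s)
  pos : 0 < Q₀

namespace CoprimeModuli

variable {k : ℕ} {β : Fin k → ℕ} {q : (j : Fin k) → Fin (β j) → ℕ} {Q₀ b : ℕ}

theorem coprime_same (h : CoprimeModuli q Q₀ b) {j : Fin k} {s s' : Fin (β j)} (hs : s ≠ s') :
    Nat.Coprime (q j s) (q j s') :=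
  h.coprime ⟨j, s⟩ ⟨j, s'⟩ fun e => hs (by simpa using e)

theorem coprime_of_ne (h : CoprimeModuli q Q₀ b) {i j : Fin k} (hij : i ≠ j) (s : Fin (β i))
    (s' : Fin (β j)) : Nat.Coprime (q i s) (q j s') :=
  h.coprime ⟨i, s⟩ ⟨j, s'⟩ fun e => hij (congrArg Sigma.fst e)

theorem ne_zero (h : CoprimeModuli q Q₀ b) (j : Fin k) (s : Fin (β j)) : q j s ≠ 0 := by
  have := h.two_le j s; omega

/-- The product of all moduli in a column. -/
def colProd {k : ℕ} {β : Fin k → ℕ} (q : (j : Fin k) → Fin (β j) → ℕ) (j : Fin k) : ℕ :=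
  ∏ s, q j s

theorem nsmul_colProd (h : CoprimeModuli q Q₀ b) {j : Fin k} {t : UnitAddTorus (Fin d)}
    (ht : t ∈ colPts d q j) : colProd q j • t = 0 := by
  obtain ⟨s, hs⟩ := mem_colPts.1 ht
  exact nsmul_eq_zero_of_dvd (Finset.dvd_prod_of_mem _ (Finset.mem_univ s))
    (nsmul_eq_zero_of_mem_fracs (h.ne_zero j s) hs)

theorem eq_of_mem_fracs (h : CoprimeModuli q Q₀ b) {j : Fin k} {s s' : Fin (β j)}
    {t : UnitAddTorus (Fin d)} (ht : t ∈ fracs d (q j s)) (ht' : t ∈ fracs d (q j s')) :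
    s = s' := by
  by_contra hne
  exact ne_zero_of_mem_fracs (h.two_le j s) ht
    (eq_zero_of_nsmul_eq_zero_of_coprime (h.coprime_same hne)
      (nsmul_eq_zero_of_mem_fracs (h.ne_zero j s) ht)
      (nsmul_eq_zero_of_mem_fracs (h.ne_zero j s') ht'))

/-- The splitting into t and u is unique: a difference t - t' = u' - u is annihilated both by the
product of column j and by the product of the columns in J, which are coprime. -/
theorem sum_sumset_insert (h : CoprimeModuli q Q₀ b) {J : Finset (Fin k)} {j : Fin k} (hj : j ∉ J)
    {X : Fin k → Finset (UnitAddTorus (Fin d))} (hX : ∀ i, X i ⊆ colPts d q i)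
    {E : Type*} [AddCommMonoid E] (φ : UnitAddTorus (Fin d) → E) :
    ∑ u ∈ sumset (insert j J) X, φ u = ∑ t ∈ X j, ∑ u ∈ sumset J X, φ (t + u) := by
  classical
  have hkill : ∀ u ∈ sumset J X, (∏ i ∈ J, colProd q i) • u = 0 := by
    intro u hu
    obtain ⟨v, hv, rfl⟩ := mem_sumset.1 hu
    rw [Finset.smul_sum]
    exact Finset.sum_eq_zero fun i hi => nsmul_eq_zero_of_dvd (Finset.dvd_prod_of_mem _ hi)
      (h.nsmul_colProd (hX i (hv i hi)))
  have hco : (colProd q j).Coprime (∏ i ∈ J, colProd q i) :=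
    Nat.Coprime.prod_right fun i hi => Nat.Coprime.prod_left fun s _ =>
      Nat.Coprime.prod_right fun s' _ =>
        h.coprime_of_ne (fun e : j = i => hj (by rw [e]; exact hi)) s s'
  have himg : sumset (insert j J) X = (X j ×ˢ sumset J X).image fun p => p.1 + p.2 := by
    ext u
    simp only [Finset.mem_image, Finset.mem_product, Prod.exists, mem_sumset]
    constructor
    · rintro ⟨v, hv, rfl⟩
      refine ⟨v j, ∑ i ∈ J, v i, ⟨hv j (by simp), v, fun i hi => hv i (by simp [hi]), rfl⟩, ?_⟩
      rw [Finset.sum_insert hj]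
    · rintro ⟨t, _, ⟨ht, v, hv, rfl⟩, rfl⟩
      refine ⟨Function.update v j t, fun i hi => ?_, ?_⟩
      · rcases eq_or_ne i j with rfl | hne
        · simpa using ht
        · rw [Function.update_of_ne hne]
          exact hv i ((Finset.mem_insert.1 hi).resolve_left hne)
      · rw [Finset.sum_insert hj, Function.update_self]
        congr 1
        refine Finset.sum_congr rfl fun i hi => ?_
        rw [Function.update_of_ne]
        rintro rfl; exact hj hi
  rw [himg, Finset.sum_image, Finset.sum_product]
  rintro ⟨t, u⟩ hp ⟨t', u'⟩ hp' he
  simp only [Finset.coe_product, Set.mem_prod, Finset.mem_coe] at hp hp'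
  simp only at he
  have e1 : t - t' = u' - u := by
    rw [sub_eq_sub_iff_add_eq_add, he]; abel
  have e2 : t - t' = 0 := by
    refine eq_zero_of_nsmul_eq_zero_of_coprime hco ?_ ?_
    · rw [smul_sub, h.nsmul_colProd (hX j hp.1), h.nsmul_colProd (hX j hp'.1), sub_zero]
    · rw [e1, smul_sub, hkill _ hp.2, hkill _ hp'.2, sub_zero]
  have e3 : t = t' := sub_eq_zero.1 e2
  subst e3
  simpa using he

/-- `y` has a denominator at most `B` and prime to the column `j`. -/
def DenAway {k : ℕ} {β : Fin k → ℕ} (q : (j : Fin k) → Fin (β j) → ℕ) (j : Fin k) (B : ℕ)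
    (y : UnitAddTorus (Fin d)) : Prop :=
  ∃ n : ℕ, 0 < n ∧ n ≤ B ∧ n.Coprime (colProd q j) ∧ n • y = 0

theorem DenAway.add {j : Fin k} {B B' : ℕ} {y y' : UnitAddTorus (Fin d)}
    (hy : DenAway q j B y) (hy' : DenAway q j B' y') : DenAway q j (B * B') (y + y') := by
  obtain ⟨n, hn, hnB, hc, h0⟩ := hy
  obtain ⟨n', hn', hnB', hc', h0'⟩ := hy'
  refine ⟨n * n', Nat.mul_pos hn hn', Nat.mul_le_mul hnB hnB', hc.mul_left hc', ?_⟩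
  rw [smul_add, nsmul_eq_zero_of_dvd (dvd_mul_right n n') h0,
    nsmul_eq_zero_of_dvd (dvd_mul_left n' n) h0', add_zero]

/-- The product of the moduli actually used is a denominator. It has at most k factors, each at most
b and prime to column j. -/
theorem denAway_of_mem_sumset (h : CoprimeModuli q Q₀ b) (hb : 1 ≤ b) {J : Finset (Fin k)}
    {j : Fin k} (hj : j ∉ J)
    {X : Fin k → Finset (UnitAddTorus (Fin d))} (hX : ∀ i, X i ⊆ colPts d q i)
    {u : UnitAddTorus (Fin d)} (hu : u ∈ sumset J X) : DenAway q j (b ^ k) u := by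
  obtain ⟨v, hv, rfl⟩ := mem_sumset.1 hu
  have hs : ∀ i, ∃ n : ℕ, 0 < n ∧ n ≤ b ∧ (i ∈ J → n.Coprime (colProd q j) ∧ n • v i = 0) := by
    intro i
    by_cases hi : i ∈ J
    · obtain ⟨s, hs⟩ := mem_colPts.1 (hX i (hv i hi))
      exact ⟨q i s, Nat.pos_of_ne_zero (h.ne_zero _ _), h.le _ _, fun _ =>
        ⟨Nat.Coprime.prod_right fun s' _ =>
          h.coprime_of_ne (fun e : i = j => hj (by rw [← e]; exact hi)) _ _,
        nsmul_eq_zero_of_mem_fracs (h.ne_zero _ _) hs⟩⟩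
    · exact ⟨1, one_pos, hb, fun h => absurd h hi⟩
  choose n hn hnb hnJ using hs
  refine ⟨∏ i ∈ J, n i, Finset.prod_pos fun i _ => hn i, ?_,
    Nat.Coprime.prod_left fun i hi => (hnJ i hi).1, ?_⟩
  · calc ∏ i ∈ J, n i ≤ ∏ _i ∈ J, b := Finset.prod_le_prod' fun i _ => hnb i
      _ = b ^ J.card := by simp
      _ ≤ b ^ k := Nat.pow_le_pow_right hb (by simpa using Finset.card_le_univ J)
  · rw [Finset.smul_sum]
    exact Finset.sum_eq_zero fun i hi => nsmul_eq_zero_of_dvd (Finset.dvd_prod_of_mem _ hi)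
      (hnJ i hi).2

/-- If points near `t_i + y_i` and `t'_i + y'_i` have the same sum, then already
`∑ t_i = ∑ t'_i`, provided that the denominators are small. -/
theorem sum_sub_eq_zero (h : CoprimeModuli q Q₀ b) {j : Fin k} {r B : ℕ} {κ : ℝ}
    (hsep : ((B * b : ℕ) : ℝ) ^ (2 * r) * (2 * r * κ) < 1)
    {t t' θ θ' : Fin r → UnitAddTorus (Fin d)} (ht : ∀ i, t i ∈ colPts d q j)
    (ht' : ∀ i, t' i ∈ colPts d q j)
    (hθ : ∀ i, ∃ y, DenAway q j B y ∧ ‖θ i - t i - y‖ ≤ κ)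
    (hθ' : ∀ i, ∃ y, DenAway q j B y ∧ ‖θ' i - t' i - y‖ ≤ κ)
    (hsum : ∑ i, (θ i - θ' i) = 0) : ∑ i, (t i - t' i) = 0 := by
  choose y hy hyn using hθ
  choose y' hy' hyn' using hθ'
  choose n hn hnB hnc hn0 using hy
  choose n' hn' hnB' hnc' hn0' using hy'
  choose s hs using fun i => mem_colPts.1 (ht i)
  choose s' hs' using fun i => mem_colPts.1 (ht' i)
  -- This rational point differs from ∑(θ_i - θ'_i) = 0 by 2r errors of size at most κ.
  set e : UnitAddTorus (Fin d) := ∑ i, ((t i + y i) - (t' i + y' i)) with he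
  have henorm : ‖e‖ ≤ 2 * r * κ := by
    have e1 : e = ∑ i, ((θ' i - t' i - y' i) - (θ i - t i - y i)) := by
      have : e = ∑ i, ((θ' i - t' i - y' i) - (θ i - t i - y i)) + ∑ i, (θ i - θ' i) := by
        rw [he, ← Finset.sum_add_distrib]
        exact Finset.sum_congr rfl fun i _ => by abel
      rw [this, hsum, add_zero]
    rw [e1]
    calc _ ≤ ∑ i : Fin r, (κ + κ) := (norm_sum_le _ _).trans (Finset.sum_le_sum fun i _ =>
            (norm_sub_le _ _).trans (add_le_add (hyn' i) (hyn i)))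
      _ = _ := by simp; ring
  -- A common denominator of e made of 2r factors, each at most Bb. By `hsep` the point e is closer
  -- to 0 than 1/n₀, hence zero.
  set n₀ : ℕ := (∏ i, n i * q j (s i)) * ∏ i, n' i * q j (s' i) with hn₀
  have hn₀pos : 0 < n₀ := Nat.mul_pos
    (Finset.prod_pos fun i _ => Nat.mul_pos (hn i) (Nat.pos_of_ne_zero (h.ne_zero _ _)))
    (Finset.prod_pos fun i _ => Nat.mul_pos (hn' i) (Nat.pos_of_ne_zero (h.ne_zero _ _)))
  have hn₀le : n₀ ≤ (B * b) ^ (2 * r) := by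
    have h1 : ∏ i, n i * q j (s i) ≤ (B * b) ^ r := by
      simpa using Finset.prod_le_pow_card Finset.univ (fun i => n i * q j (s i)) (B * b)
        fun i _ => Nat.mul_le_mul (hnB i) (h.le _ _)
    have h2 : ∏ i, n' i * q j (s' i) ≤ (B * b) ^ r := by
      simpa using Finset.prod_le_pow_card Finset.univ (fun i => n' i * q j (s' i)) (B * b)
        fun i _ => Nat.mul_le_mul (hnB' i) (h.le _ _)
    rw [two_mul, pow_add]
    exact Nat.mul_le_mul h1 h2
  have hκ : 0 ≤ 2 * r * κ := (norm_nonneg _).trans henorm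
  have he0 : e = 0 := by
    refine eq_zero_of_nsmul_eq_zero_of_norm_lt hn₀pos ?_ ?_
    · rw [he, Finset.smul_sum]
      refine Finset.sum_eq_zero fun i _ => ?_
      have d1 : n i * q j (s i) ∣ n₀ :=
        (Finset.dvd_prod_of_mem (fun i => n i * q j (s i)) (Finset.mem_univ i)).mul_right _
      have d2 : n' i * q j (s' i) ∣ n₀ :=
        (Finset.dvd_prod_of_mem (fun i => n' i * q j (s' i)) (Finset.mem_univ i)).mul_left _
      rw [smul_sub, smul_add, smul_add,
        nsmul_eq_zero_of_dvd ((dvd_mul_left _ _).trans d1)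
          (nsmul_eq_zero_of_mem_fracs (h.ne_zero _ _) (hs i)),
        nsmul_eq_zero_of_dvd ((dvd_mul_right _ _).trans d1) (hn0 i),
        nsmul_eq_zero_of_dvd ((dvd_mul_left _ _).trans d2)
          (nsmul_eq_zero_of_mem_fracs (h.ne_zero _ _) (hs' i)),
        nsmul_eq_zero_of_dvd ((dvd_mul_right _ _).trans d2) (hn0' i)]
      simp
    · refine lt_of_le_of_lt ?_ hsep
      have : (n₀ : ℝ) ≤ ((B * b : ℕ) : ℝ) ^ (2 * r) := by exact_mod_cast hn₀le
      gcongr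
  have hT : ∑ i, (t i - t' i) = -∑ i, (y i - y' i) := by
    rw [eq_neg_iff_add_eq_zero, ← Finset.sum_add_distrib, ← he0, he]
    exact Finset.sum_congr rfl fun i _ => by abel
  -- Now ∑(t_i - t'_i) = -∑(y_i - y'_i) is annihilated by two coprime integers, one for each side.
  have hco : ((∏ i, n i) * ∏ i, n' i).Coprime (colProd q j) :=
    (Nat.Coprime.prod_left fun i _ => hnc i).mul_left (Nat.Coprime.prod_left fun i _ => hnc' i)
  refine eq_zero_of_nsmul_eq_zero_of_coprime hco ?_ ?_
  · rw [hT, smul_neg, Finset.smul_sum, neg_eq_zero]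
    refine Finset.sum_eq_zero fun i _ => ?_
    rw [smul_sub,
      nsmul_eq_zero_of_dvd ((Finset.dvd_prod_of_mem n (Finset.mem_univ i)).mul_right _) (hn0 i),
      nsmul_eq_zero_of_dvd ((Finset.dvd_prod_of_mem n' (Finset.mem_univ i)).mul_left _) (hn0' i),
      sub_zero]
  · rw [Finset.smul_sum]
    refine Finset.sum_eq_zero fun i _ => ?_
    rw [smul_sub, h.nsmul_colProd (ht i), h.nsmul_colProd (ht' i), sub_zero]

/-- Multiplication by all the other moduli of the column kills every term except the one whose
modulus occurs once. If the sum vanished, that fraction would have two coprime denominators and so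
be zero. -/
theorem sum_sub_ne_zero_of_single (h : CoprimeModuli q Q₀ b) {j : Fin k} {r : ℕ}
    {τ : Fin r ⊕ Fin r → UnitAddTorus (Fin d)} {s : Fin r ⊕ Fin r → Fin (β j)}
    (hτ : ∀ i, τ i ∈ fracs d (q j (s i))) {i₀ : Fin r ⊕ Fin r} (hi₀ : ∀ i, i ≠ i₀ → s i ≠ s i₀) :
    ∑ i, (τ (.inl i) - τ (.inr i)) ≠ 0 := by
  classical
  intro h0
  set m : ℕ := ∏ s' ∈ Finset.univ.erase (s i₀), q j s' with hm
  have hmk : ∀ i, i ≠ i₀ → m • τ i = 0 := fun i hi =>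
    nsmul_eq_zero_of_dvd (Finset.dvd_prod_of_mem _ (Finset.mem_erase.2 ⟨hi₀ i hi,
      Finset.mem_univ _⟩)) (nsmul_eq_zero_of_mem_fracs (h.ne_zero _ _) (hτ i))
  have hco : m.Coprime (q j (s i₀)) := Nat.Coprime.prod_left fun s' hs' =>
    h.coprime_same (Finset.mem_erase.1 hs').1
  have hkey : m • τ i₀ = 0 := by
    have h1 : ∑ i, (m • τ (.inl i) - m • τ (.inr i)) = 0 := by
      simp only [← smul_sub, ← Finset.smul_sum, h0, smul_zero]
    rcases i₀ with i₀ | i₀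
    · rw [Finset.sum_eq_single i₀ (fun i _ hi => by
        rw [hmk _ (by simpa using hi), hmk _ (by simp), sub_zero]) (by simp)] at h1
      rwa [hmk (.inr i₀) (by simp), sub_zero] at h1
    · rw [Finset.sum_eq_single i₀ (fun i _ hi => by
        rw [hmk _ (by simp), hmk _ (by simpa using hi), sub_zero]) (by simp)] at h1
      rwa [hmk (.inl i₀) (by simp), zero_sub, neg_eq_zero] at h1
  exact ne_zero_of_mem_fracs (h.two_le _ _) (hτ i₀)
    (eq_zero_of_nsmul_eq_zero_of_coprime hco hkey
      (nsmul_eq_zero_of_mem_fracs (h.ne_zero _ _) (hτ i₀)))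

/-- The same multiplication isolates one difference t_i - t'_i, since the moduli for different i are
distinct. -/
theorem eq_of_sum_sub_eq_zero (h : CoprimeModuli q Q₀ b) {j : Fin k} {r : ℕ}
    {t t' : Fin r → UnitAddTorus (Fin d)} {s : Fin r → Fin (β j)} (hs : Function.Injective s)
    (ht : ∀ i, t i ∈ fracs d (q j (s i))) (ht' : ∀ i, t' i ∈ fracs d (q j (s i)))
    (h0 : ∑ i, (t i - t' i) = 0) : t = t' := by
  classical
  funext i₀
  set m : ℕ := ∏ s' ∈ Finset.univ.erase (s i₀), q j s' with hm
  have hco : m.Coprime (q j (s i₀)) := Nat.Coprime.prod_left fun s' hs' =>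
    h.coprime_same (Finset.mem_erase.1 hs').1
  have hq : ∀ i, q j (s i) • (t i - t' i) = 0 := fun i => by
    rw [smul_sub, nsmul_eq_zero_of_mem_fracs (h.ne_zero _ _) (ht i),
      nsmul_eq_zero_of_mem_fracs (h.ne_zero _ _) (ht' i), sub_zero]
  have h1 : m • ∑ i, (t i - t' i) = 0 := by rw [h0, smul_zero]
  rw [Finset.smul_sum, Finset.sum_eq_single i₀ (fun i _ hi =>
    nsmul_eq_zero_of_dvd (Finset.dvd_prod_of_mem _ (Finset.mem_erase.2 ⟨fun e => hi (hs e),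
      Finset.mem_univ _⟩)) (hq i)) (by simp)] at h1
  exact sub_eq_zero.1 (eq_zero_of_nsmul_eq_zero_of_coprime hco h1 (hq i₀))

end CoprimeModuli

end Arithmetic

/-! ### Induction over the columns. -/

section Iteration

open ComplexConjugate CoprimeModuli

variable {d k : ℕ} {β : Fin k → ℕ}

/-- The fractions allowed by a partial choice of moduli. -/
def assignPts (d : ℕ) {k : ℕ} {β : Fin k → ℕ} (q : (j : Fin k) → Fin (β j) → ℕ)
    (a : (j : Fin k) → Option (Fin (β j))) (j : Fin k) : Finset (UnitAddTorus (Fin d)) :=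
  -- The default ∅ is never summed over, because sumsets are taken over `assignSupp a`. It makes
  -- `assignPts_subset` valid in every column.
  (a j).elim ∅ fun s => fracs d (q j s)

/-- The columns in which a modulus is chosen. -/
def assignSupp {k : ℕ} {β : Fin k → ℕ} (a : (j : Fin k) → Option (Fin (β j))) : Finset (Fin k) :=
  Finset.univ.filter fun j => (a j).isSome

theorem assignPts_subset (q : (j : Fin k) → Fin (β j) → ℕ) (a : (j : Fin k) → Option (Fin (β j)))
    (j : Fin k) : assignPts d q a j ⊆ colPts d q j := by
  intro t ht
  rw [assignPts] at ht
  rcases h : a j with _ | s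
  · simp [h] at ht
  · rw [h] at ht
    exact mem_colPts.2 ⟨s, ht⟩

theorem mem_assignSupp {a : (j : Fin k) → Option (Fin (β j))} {j : Fin k} :
    j ∈ assignSupp a ↔ a j ≠ none := by
  simp [assignSupp, Option.isSome_iff_ne_none]

/-- The square of the square function with moduli fixed by `a` and summation over the columns
in `R`. -/
def mixedSquare {d k : ℕ} {β : Fin k → ℕ} (q : (j : Fin k) → Fin (β j) → ℕ)
    (F : UnitAddTorus (Fin d) → (Fin d → ℤ) → ℂ) (a : (j : Fin k) → Option (Fin (β j)))
    (R : Finset (Fin k)) (x : Fin d → ℤ) : ℝ :=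
  ∑ w ∈ sumset (assignSupp a ∪ R)ᶜ (colPts d q),
    ‖∑ u ∈ sumset R (colPts d q), ∑ v ∈ sumset (assignSupp a) (assignPts d q a),
      F (w + u + v) x‖ ^ 2

theorem mixedSquare_nonneg (q : (j : Fin k) → Fin (β j) → ℕ)
    (F : UnitAddTorus (Fin d) → (Fin d → ℤ) → ℂ) (a : (j : Fin k) → Option (Fin (β j)))
    (R : Finset (Fin k)) (x : Fin d → ℤ) : 0 ≤ mixedSquare q F a R x :=
  Finset.sum_nonneg fun _ _ => by positivity

/-- The constant in one step of the iteration. -/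
def stepConst (r : ℕ) : ℝ := (2 * r : ℝ) ^ (2 * r) * (2 + (2 * (r : ℝ) ^ 2) ^ r)

theorem stepConst_nonneg (r : ℕ) : 0 ≤ stepConst r := by
  unfold stepConst; positivity

/-- The sum of the functions `f_u` over all `u` with prescribed part `t` in one column. -/
def columnTerm {d k : ℕ} {β : Fin k → ℕ} (q : (j : Fin k) → Fin (β j) → ℕ)
    (F : UnitAddTorus (Fin d) → (Fin d → ℤ) → ℂ) (a : (j : Fin k) → Option (Fin (β j)))
    (R : Finset (Fin k)) (w t : UnitAddTorus (Fin d)) (x : Fin d → ℤ) : ℂ :=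
  ∑ u ∈ sumset R (colPts d q), ∑ v ∈ sumset (assignSupp a) (assignPts d q a), F (w + (t + u) + v) x

section Column

variable {q : (j : Fin k) → Fin (β j) → ℕ} {Q₀ b : ℕ}
  {F : UnitAddTorus (Fin d) → (Fin d → ℤ) → ℂ}
  {a : (j : Fin k) → Option (Fin (β j))} {R : Finset (Fin k)} {j : Fin k}

/-- The four parts use disjoint sets of columns that together exhaust all of them. Summability of `F
u` is available only for such full sums. -/
theorem add_mem_sumset_univ (hjR : j ∉ R) (ha : ∀ i ∈ insert j R, i ∉ assignSupp a)
    {w t u v : UnitAddTorus (Fin d)} (hw : w ∈ sumset (assignSupp a ∪ insert j R)ᶜ (colPts d q))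
    (ht : t ∈ colPts d q j) (hu : u ∈ sumset R (colPts d q))
    (hv : v ∈ sumset (assignSupp a) (assignPts d q a)) :
    w + (t + u) + v ∈ sumset Finset.univ (colPts d q) := by
  generalize assignSupp a = L at *
  have hcol : ∀ i, colPts d q i ⊆ colPts d q i := fun i => Finset.Subset.refl _
  have h1 := add_mem_sumset_union (J := {j}) (J' := R) (by simpa using hjR)
    (X := colPts d q) (X' := colPts d q) (Y := colPts d q)
    (fun i _ => hcol i) (fun i _ => hcol i) (mem_sumset_singleton (X := colPts d q) ht) hu
  rw [← Finset.insert_eq] at h1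
  have hd1 : Disjoint (L ∪ insert j R)ᶜ (insert j R) := by
    rw [Finset.disjoint_left]
    intro i hi hi'
    exact (Finset.mem_compl.1 hi) (Finset.mem_union_right _ hi')
  have h2 := add_mem_sumset_union hd1 (Y := colPts d q) (fun i _ => hcol i) (fun i _ => hcol i) hw h1
  have hd2 : Disjoint ((L ∪ insert j R)ᶜ ∪ insert j R) L := by
    rw [Finset.disjoint_left]
    intro i hi hi'
    rcases Finset.mem_union.1 hi with h | h
    · exact (Finset.mem_compl.1 h) (Finset.mem_union_left _ hi')
    · exact ha i h hi'
  have h3 := add_mem_sumset_union hd2 (Y := colPts d q) (fun i _ => hcol i)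
    (fun i _ => assignPts_subset q a i) h2 hv
  have h4 : (L ∪ insert j R)ᶜ ∪ insert j R ∪ L = Finset.univ := by
    rw [Finset.union_assoc, Finset.union_comm (insert j R) L, Finset.union_comm]
    exact Finset.union_compl _
  rwa [h4] at h3

theorem summable_columnTerm {r : ℕ} (hr : 1 ≤ r)
    (hFs : ∀ u ∈ sumset Finset.univ (colPts d q), Summable fun x => ‖F u x‖ ^ (2 * r))
    (hjR : j ∉ R) (ha : ∀ i ∈ insert j R, i ∉ assignSupp a)
    {w t : UnitAddTorus (Fin d)} (hw : w ∈ sumset (assignSupp a ∪ insert j R)ᶜ (colPts d q))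
    (ht : t ∈ colPts d q j) :
    Summable fun x => ‖columnTerm q F a R w t x‖ ^ (2 * r) := by
  have h2r : 2 * r ≠ 0 := by omega
  refine summable_norm_sum_pow' h2r (sumset R (colPts d q)) (fun u x =>
    ∑ v ∈ sumset (assignSupp a) (assignPts d q a), F (w + (t + u) + v) x) fun u hu => ?_
  exact summable_norm_sum_pow' h2r (sumset (assignSupp a) (assignPts d q a))
    (fun v x => F (w + (t + u) + v) x) fun v hv =>
      hFs _ (add_mem_sumset_univ hjR ha hw ht hu hv)

/-- Everything in the frequency except t has denominator prime to column j: w, u and v each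
contribute at most b^k, and the Q₀-torsion point contributes Q₀. -/
theorem banded_columnTerm (hq : CoprimeModuli q Q₀ b) (hb : 1 ≤ b) {κ : ℝ}
    (hFb : ∀ u, Banded (F u) {θ | ∃ y : UnitAddTorus (Fin d), Q₀ • y = 0 ∧ ‖θ - u - y‖ ≤ κ})
    (hjR : j ∉ R) (hja : j ∉ assignSupp a)
    {w : UnitAddTorus (Fin d)} (hw : w ∈ sumset (assignSupp a ∪ insert j R)ᶜ (colPts d q))
    (t : UnitAddTorus (Fin d)) :
    Banded (columnTerm q F a R w t)
      {θ | ∃ y, DenAway q j (b ^ k * b ^ k * b ^ k * Q₀) y ∧ ‖θ - t - y‖ ≤ κ} := by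
  have hcol : ∀ i, colPts d q i ⊆ colPts d q i := fun i => Finset.Subset.refl _
  refine Banded.sum _ _ fun u hu => Banded.sum _ _ fun v hv => (hFb _).mono ?_
  rintro θ ⟨y, hy, hθ⟩
  refine ⟨w + u + v + y, ?_, ?_⟩
  · refine DenAway.add (DenAway.add (DenAway.add ?_ ?_) ?_) ?_
    · exact denAway_of_mem_sumset hq hb (by simp) hcol hw
    · exact denAway_of_mem_sumset hq hb hjR hcol hu
    · exact denAway_of_mem_sumset hq hb hja (assignPts_subset q a) hv
    · exact ⟨Q₀, hq.pos, le_rfl, Nat.Coprime.prod_right fun s _ => hq.coprime_left j s, hy⟩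
  · have e : θ - t - (w + u + v + y) = θ - (w + (t + u) + v) - y := by abel
    rw [e]; exact hθ

/-- This and the next two lemmas express the three roles of column j through the same `columnTerm`:
summed inside the absolute value, square-summed outside, and restricted to one modulus. -/
theorem mixedSquare_insert (hq : CoprimeModuli q Q₀ b) (hjR : j ∉ R) (x : Fin d → ℤ) :
    mixedSquare q F a (insert j R) x =
      ∑ w ∈ sumset (assignSupp a ∪ insert j R)ᶜ (colPts d q),
        ‖∑ t ∈ colPts d q j, columnTerm q F a R w t x‖ ^ 2 := by
  rw [mixedSquare]
  refine Finset.sum_congr rfl fun w _ => ?_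
  rw [hq.sum_sumset_insert hjR fun i => Finset.Subset.refl _]
  rfl

theorem mixedSquare_of_not_mem (hq : CoprimeModuli q Q₀ b) (hjR : j ∉ R) (hja : j ∉ assignSupp a)
    (x : Fin d → ℤ) :
    mixedSquare q F a R x =
      ∑ w ∈ sumset (assignSupp a ∪ insert j R)ᶜ (colPts d q),
        ∑ t ∈ colPts d q j, ‖columnTerm q F a R w t x‖ ^ 2 := by
  have hc : (assignSupp a ∪ R)ᶜ = insert j (assignSupp a ∪ insert j R)ᶜ := by
    ext i
    simp only [Finset.mem_compl, Finset.mem_union, Finset.mem_insert]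
    rcases eq_or_ne i j with rfl | hij
    · simp [hjR, hja]
    · simp [hij]
  rw [mixedSquare, hc, hq.sum_sumset_insert (by simp) fun i => Finset.Subset.refl _,
    Finset.sum_comm]
  refine Finset.sum_congr rfl fun w _ => Finset.sum_congr rfl fun t _ => ?_
  rw [columnTerm]
  congr 2
  refine Finset.sum_congr rfl fun u _ => Finset.sum_congr rfl fun v _ => ?_
  congr 1; abel

theorem mixedSquare_update (hq : CoprimeModuli q Q₀ b) (hja : j ∉ assignSupp a)
    (s : Fin (β j)) (x : Fin d → ℤ) :
    mixedSquare q F (Function.update a j (some s)) R x =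
      ∑ w ∈ sumset (assignSupp a ∪ insert j R)ᶜ (colPts d q),
        ‖∑ t ∈ fracs d (q j s), columnTerm q F a R w t x‖ ^ 2 := by
  have hsupp : assignSupp (Function.update a j (some s)) = insert j (assignSupp a) := by
    ext i
    rw [Finset.mem_insert, mem_assignSupp, mem_assignSupp]
    rcases eq_or_ne i j with rfl | hij
    · simp
    · simp [hij]
  have hpts : ∀ i ∈ assignSupp a,
      assignPts d q (Function.update a j (some s)) i = assignPts d q a i := by
    intro i hi
    have hij : i ≠ j := fun e => hja (e ▸ hi)
    simp [assignPts, Function.update_of_ne hij]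
  have hptj : assignPts d q (Function.update a j (some s)) j = fracs d (q j s) := by
    simp [assignPts]
  have hc : (insert j (assignSupp a) ∪ R)ᶜ = (assignSupp a ∪ insert j R)ᶜ := by
    rw [Finset.insert_union, Finset.union_insert]
  rw [mixedSquare, hsupp, hc]
  refine Finset.sum_congr rfl fun w _ => ?_
  congr 2
  simp only [hq.sum_sumset_insert hja (assignPts_subset q (Function.update a j (some s))),
    sumset_congr hpts, hptj]
  rw [Finset.sum_comm]
  refine Finset.sum_congr rfl fun t _ => ?_
  refine Finset.sum_congr rfl fun u _ => Finset.sum_congr rfl fun v _ => ?_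
  congr 1; abel

end Column

/-- One column is either square-summed or gets a fixed modulus. -/
theorem tsum_mixedSquare_insert_le {q : (j : Fin k) → Fin (β j) → ℕ} {Q₀ b : ℕ}
    (hq : CoprimeModuli q Q₀ b) (hb : 1 ≤ b) {r : ℕ} (hr : 1 ≤ r) {κ : ℝ}
    (hsep : ((b ^ k * b ^ k * b ^ k * Q₀ * b : ℕ) : ℝ) ^ (2 * r) * (2 * r * κ) < 1)
    {F : UnitAddTorus (Fin d) → (Fin d → ℤ) → ℂ}
    (hFs : ∀ u ∈ sumset Finset.univ (colPts d q), Summable fun x => ‖F u x‖ ^ (2 * r))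
    (hFb : ∀ u, Banded (F u) {θ | ∃ y : UnitAddTorus (Fin d), Q₀ • y = 0 ∧ ‖θ - u - y‖ ≤ κ})
    {a : (j : Fin k) → Option (Fin (β j))} {R : Finset (Fin k)} {j : Fin k} (hjR : j ∉ R)
    (ha : ∀ i ∈ insert j R, a i = none) :
    ∑' x, mixedSquare q F a (insert j R) x ^ r ≤
      stepConst r * ∑ o : Option (Fin (β j)), ∑' x, mixedSquare q F (Function.update a j o) R x ^ r := by
  classical
  have hLR : ∀ i ∈ insert j R, i ∉ assignSupp a := fun i hi h => mem_assignSupp.1 h (ha i hi)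
  have hja : j ∉ assignSupp a := hLR j (by simp)
  have hsel : ∀ t : colPts d q j, ∃ s, t.1 ∈ fracs d (q j s) := fun t => mem_colPts.1 t.2
  -- π sends a fraction to its modulus in the column; the fibres of π are the blocks for
  -- superorthogonality.
  choose π hπ using hsel
  let H : sumset (assignSupp a ∪ insert j R)ᶜ (colPts d q) → colPts d q j → (Fin d → ℤ) → ℂ :=
    fun w t => columnTerm q F a R w.1 t.1
  have hHs : ∀ w t, Summable fun x => ‖H w t x‖ ^ (2 * r) := fun w t =>
    summable_columnTerm hr hFs hjR hLR w.2 t.2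
  have horth : ∀ (w : Fin r → sumset (assignSupp a ∪ insert j R)ᶜ (colPts d q))
      (t t' : Fin r → colPts d q j), ∑ i, ((t i).1 - (t' i).1) ≠ 0 →
      ∑' x, ∏ i, (H (w i) (t i) x * conj (H (w i) (t' i) x)) = 0 := by
    intro w t t' hne
    refine tsum_prod_mul_conj_eq_zero hr (fun i => H (w i) (t i)) (fun i => H (w i) (t' i)) _ _
      (fun i => banded_columnTerm hq hb hFb hjR hja (w i).2 _)
      (fun i => banded_columnTerm hq hb hFb hjR hja (w i).2 _)
      (summable_prod_mul_conj hr _ _ (fun i => hHs _ _) fun i => hHs _ _) ?_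
    intro θ θ' hθ hθ' h0
    exact hne (hq.sum_sub_eq_zero hsep (fun i => (t i).2) (fun i => (t' i).2) hθ hθ' h0)
  have hmain := tsum_sum_norm_sum_sq_pow_le_add hr π H hHs
    (by
      rintro w τ ⟨i₀, hi₀⟩
      refine horth w (fun i => τ (.inl i)) (fun i => τ (.inr i)) ?_
      exact hq.sum_sub_ne_zero_of_single (τ := fun i => (τ i).1) (s := fun i => π (τ i))
        (fun i => hπ (τ i)) (i₀ := i₀) hi₀)
    (by
      intro w t t' hinj heq hne
      refine horth w t t' fun h0 => hne ?_
      have := hq.eq_of_sum_sub_eq_zero (t := fun i => (t i).1) (t' := fun i => (t' i).1)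
        (s := π ∘ t) hinj (fun i => hπ (t i)) (fun i => by rw [heq]; exact hπ (t' i)) h0
      exact funext fun i => Subtype.ext (congrFun this i))
  have e1 : ∀ x, mixedSquare q F a (insert j R) x = ∑ w, ‖∑ t, H w t x‖ ^ 2 := by
    intro x
    rw [mixedSquare_insert hq hjR, ← Finset.sum_coe_sort]
    refine Finset.sum_congr rfl fun w _ => ?_
    rw [← Finset.sum_coe_sort (colPts d q j)]
  have e2 : ∀ x, mixedSquare q F (Function.update a j none) R x = ∑ w, ∑ t, ‖H w t x‖ ^ 2 := by
    intro x
    have hup : Function.update a j none = a := by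
      rw [← ha j (by simp)]; exact Function.update_eq_self j a
    rw [hup, mixedSquare_of_not_mem hq hjR hja, ← Finset.sum_coe_sort]
    refine Finset.sum_congr rfl fun w _ => ?_
    rw [← Finset.sum_coe_sort (colPts d q j)]
  have e3 : ∀ s x, mixedSquare q F (Function.update a j (some s)) R x =
      ∑ w, ‖∑ t with π t = s, H w t x‖ ^ 2 := by
    intro s x
    rw [mixedSquare_update hq hja, ← Finset.sum_coe_sort]
    refine Finset.sum_congr rfl fun w _ => ?_
    congr 2
    symm
    refine Finset.sum_nbij (fun t => t.1) ?_ ?_ ?_ ?_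
    · intro t ht
      have := (Finset.mem_filter.1 ht).2
      rw [← this]; exact hπ t
    · intro t _ t' _ h; exact Subtype.ext h
    · intro t ht
      have ht' : t ∈ fracs d (q j s) := ht
      refine ⟨⟨t, mem_colPts.2 ⟨s, ht'⟩⟩, ?_, rfl⟩
      rw [Finset.mem_coe, Finset.mem_filter]
      exact ⟨Finset.mem_univ _, hq.eq_of_mem_fracs (hπ _) ht'⟩
    · intro t _; rfl
  -- The choice `none` is the square-summed column and `some s` is the column with modulus s fixed,
  -- matching the two terms of `hmain`.
  simp only [Fintype.sum_option, e1, e2, e3]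
  refine hmain.trans ?_
  rw [stepConst, mul_assoc]
  refine mul_le_mul_of_nonneg_left ?_ (by positivity)
  have hA : 0 ≤ ∑' x, (∑ w, ∑ t, ‖H w t x‖ ^ 2) ^ r := tsum_nonneg fun x =>
    pow_nonneg (Finset.sum_nonneg fun w _ => Finset.sum_nonneg fun t _ => by positivity) _
  have hD : 0 ≤ ∑ s, ∑' x, (∑ w, ‖∑ t with π t = s, H w t x‖ ^ 2) ^ r :=
    Finset.sum_nonneg fun s _ => tsum_nonneg fun x =>
      pow_nonneg (Finset.sum_nonneg fun w _ => by positivity) _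
  have hc : 0 ≤ (2 * (r : ℝ) ^ 2) ^ r := by positivity
  rw [add_mul, mul_add, mul_add]
  linarith [mul_nonneg hc hA]

/-- Iteration over the columns in `R`. -/
theorem tsum_mixedSquare_le {q : (j : Fin k) → Fin (β j) → ℕ} {Q₀ b : ℕ}
    (hq : CoprimeModuli q Q₀ b) (hb : 1 ≤ b) {r : ℕ} (hr : 1 ≤ r) {κ : ℝ}
    (hsep : ((b ^ k * b ^ k * b ^ k * Q₀ * b : ℕ) : ℝ) ^ (2 * r) * (2 * r * κ) < 1)
    {F : UnitAddTorus (Fin d) → (Fin d → ℤ) → ℂ}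
    (hFs : ∀ u ∈ sumset Finset.univ (colPts d q), Summable fun x => ‖F u x‖ ^ (2 * r))
    (hFb : ∀ u, Banded (F u) {θ | ∃ y : UnitAddTorus (Fin d), Q₀ • y = 0 ∧ ‖θ - u - y‖ ≤ κ})
    (R : Finset (Fin k)) (a : (j : Fin k) → Option (Fin (β j))) (ha : ∀ i ∈ R, a i = none) :
    ∑' x, mixedSquare q F a R x ^ r ≤ stepConst r ^ R.card *
      ∑ a' : (j : Fin k) → Option (Fin (β j)) with ∀ i ∉ R, a' i = a i,
        ∑' x, mixedSquare q F a' ∅ x ^ r := by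
  classical
  induction R using Finset.induction_on generalizing a with
  | empty =>
    have : (Finset.univ.filter fun a' : (j : Fin k) → Option (Fin (β j)) =>
        ∀ i ∉ (∅ : Finset (Fin k)), a' i = a i) = {a} := by
      ext a'
      simp [funext_iff]
    rw [this]; simp
  | insert j R hjR ih =>
    refine (tsum_mixedSquare_insert_le hq hb hr hsep hFs hFb hjR ha).trans ?_
    rw [Finset.card_insert_of_notMem hjR, pow_succ', mul_assoc]
    refine mul_le_mul_of_nonneg_left ?_ (stepConst_nonneg r)
    -- Completed assignments are grouped by their value in column j, so that each group is the
    -- induction hypothesis for the correspondingly updated assignment.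
    rw [← Finset.sum_fiberwise_of_maps_to (g := fun a' : (j : Fin k) → Option (Fin (β j)) => a' j)
      (t := Finset.univ) (fun _ _ => Finset.mem_univ _), Finset.mul_sum]
    refine Finset.sum_le_sum fun o _ => ?_
    refine (ih (Function.update a j o) fun i hi => ?_).trans (le_of_eq ?_)
    · rw [Function.update_of_ne (fun e : i = j => hjR (by rw [← e]; exact hi))]
      exact ha i (Finset.mem_insert_of_mem hi)
    · congr 1
      refine Finset.sum_congr ?_ fun _ _ => rfl
      ext a'
      simp only [Finset.mem_filter, Finset.mem_univ, true_and]
      constructor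
      · intro h
        refine ⟨fun i hi => ?_, ?_⟩
        · simp only [Finset.mem_insert, not_or] at hi
          rw [h i hi.2, Function.update_of_ne hi.1]
        · rw [h j hjR, Function.update_self]
      · rintro ⟨h, h'⟩ i hi
        rcases eq_or_ne i j with rfl | hij
        · rw [Function.update_self, h']
        · rw [Function.update_of_ne hij, h i (by simp [hij, hi])]

end Iteration

/-! ### Translation back to the square functions, small N, and the separation condition. -/

section Final

open Filter

variable {d k : ℕ} {β : Fin k → ℕ}

theorem sumset_empty (X : Fin k → Finset (UnitAddTorus (Fin d))) : sumset ∅ X = {0} := by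
  ext u
  rw [mem_sumset]
  simp

/-- The partial choice of moduli given by `σ` on `M`. -/
def assignOf (M : Finset (Fin k)) (σ : (j : M) → Fin (β j)) (j : Fin k) : Option (Fin (β j)) :=
  if h : j ∈ M then some (σ ⟨j, h⟩) else none

theorem assignSupp_assignOf (M : Finset (Fin k)) (σ : (j : M) → Fin (β j)) :
    assignSupp (assignOf M σ) = M := by
  ext j
  rw [mem_assignSupp, assignOf]
  by_cases h : j ∈ M <;> simp [h]

theorem setV_eq_sumset (q : (j : Fin k) → Fin (β j) → ℕ) (M : Finset (Fin k))
    (σ : (j : M) → Fin (β j)) : setV d q M σ = sumset M (assignPts d q (assignOf M σ)) := by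
  have : (fun j : M => fracs d (q j (σ j))) = fun j : M => assignPts d q (assignOf M σ) j := by
    funext j
    simp [assignPts, assignOf]
  rw [setV, this, sumset]

theorem squareFunction_eq (q : (j : Fin k) → Fin (β j) → ℕ) (M : Finset (Fin k))
    (σ : (j : M) → Fin (β j)) (F : UnitAddTorus (Fin d) → (Fin d → ℤ) → ℂ) (x : Fin d → ℤ) :
    squareFunction q M M σ F x = Real.sqrt (mixedSquare q F (assignOf M σ) ∅ x) := by
  rw [squareFunction, mixedSquare, assignSupp_assignOf, Finset.union_empty, sdiff_self,
    setV_eq_sumset, setU_eq_sumset, setU_eq_sumset]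
  rfl

/-- This reindexes the outcome of the iteration by pairs (M, σ). Surjectivity is enough, because the
terms are nonnegative and only an upper bound is wanted. -/
theorem surjective_assignOf : Function.Surjective
    fun p : (Σ M : Finset (Fin k), ((j : M) → Fin (β j))) => assignOf p.1 p.2 := by
  intro a
  refine ⟨⟨assignSupp a, fun j => (a j).get (Option.isSome_iff_ne_none.2 (mem_assignSupp.1 j.2))⟩,
    ?_⟩
  funext j
  simp only [assignOf]
  by_cases h : j ∈ assignSupp a
  · simp [h]
  · rw [dif_neg h]
    exact (not_not.1 fun h' => h (mem_assignSupp.2 h')).symm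

theorem enorm_sqrt_pow (r : ℕ) {y : ℝ} (hy : 0 ≤ y) :
    ‖Real.sqrt y‖ₑ ^ (2 * r) = ENNReal.ofReal (y ^ r) := by
  rw [← ofReal_norm, ← ENNReal.ofReal_pow (norm_nonneg _), Real.norm_of_nonneg (Real.sqrt_nonneg _),
    pow_mul, Real.sq_sqrt hy]

/-- Only an inequality holds in general, since a divergent real `tsum` is 0. -/
theorem ofReal_tsum_le_tsum_ofReal {X : Type*} {g : X → ℝ} (hg : ∀ x, 0 ≤ g x) :
    ENNReal.ofReal (∑' x, g x) ≤ ∑' x, ENNReal.ofReal (g x) := by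
  by_cases h : Summable g
  · rw [ENNReal.ofReal_tsum_of_nonneg hg h]
  · rw [tsum_eq_zero_of_not_summable h]; simp

theorem lpNormPow_squareFunction (q : (j : Fin k) → Fin (β j) → ℕ) (M : Finset (Fin k))
    (σ : (j : M) → Fin (β j)) (F : UnitAddTorus (Fin d) → (Fin d → ℤ) → ℂ) (r : ℕ) :
    lpNormPow (2 * r) (squareFunction q M M σ F) =
      ∑' x, ENNReal.ofReal (mixedSquare q F (assignOf M σ) ∅ x ^ r) := by
  refine tsum_congr fun x => ?_
  rw [squareFunction_eq, enorm_sqrt_pow r (mixedSquare_nonneg _ _ _ _ _)]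

/-- The square function over all fractions. -/
theorem mixedSquare_none_empty (q : (j : Fin k) → Fin (β j) → ℕ)
    (F : UnitAddTorus (Fin d) → (Fin d → ℤ) → ℂ) (x : Fin d → ℤ) :
    mixedSquare q F (assignOf ∅ fun j => absurd j.2 (Finset.notMem_empty _)) ∅ x =
      ∑ w ∈ setU d q Finset.univ, ‖F w x‖ ^ 2 := by
  rw [mixedSquare, assignSupp_assignOf, sumset_empty, sumset_empty, setU_eq_sumset]
  simp

theorem mixedSquare_none_univ (q : (j : Fin k) → Fin (β j) → ℕ)
    (F : UnitAddTorus (Fin d) → (Fin d → ℤ) → ℂ) (x : Fin d → ℤ) :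
    mixedSquare q F (fun _ => none) Finset.univ x = ‖∑ u ∈ setU d q Finset.univ, F u x‖ ^ 2 := by
  have : assignSupp (fun j : Fin k => (none : Option (Fin (β j)))) = ∅ := by
    ext j; simp [mem_assignSupp]
  rw [mixedSquare, this, Finset.empty_union, Finset.compl_univ, sumset_empty, sumset_empty,
    setU_eq_sumset]
  simp

/-- The estimate for small parameters, by the Cauchy-Schwarz inequality. -/
theorem lpNormPow_sum_le_of_card_le (q : (j : Fin k) → Fin (β j) → ℕ)
    (F : UnitAddTorus (Fin d) → (Fin d → ℤ) → ℂ) (r : ℕ) {K : ℕ}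
    (hK : (setU d q Finset.univ).card ≤ K) :
    lpNormPow (2 * r) (fun x => ∑ u ∈ setU d q Finset.univ, F u x) ≤
      ((K : ℝ≥0) ^ r : ℝ≥0) * ∑ M : Finset (Fin k), ∑ σ : (j : M) → Fin (β j),
        lpNormPow (2 * r) (squareFunction q M M σ F) := by
  -- The summand M = ∅ suffices: it is the full square function over all fractions.
  have h1 : lpNormPow (2 * r) (fun x => ∑ u ∈ setU d q Finset.univ, F u x) ≤
      ((K : ℝ≥0) ^ r : ℝ≥0) * lpNormPow (2 * r) (squareFunction q ∅ ∅
        (fun j => absurd j.2 (Finset.notMem_empty _)) F) := by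
    rw [lpNormPow_squareFunction, ← ENNReal.tsum_mul_left]
    refine ENNReal.tsum_le_tsum fun x => ?_
    rw [mixedSquare_none_empty, ← ofReal_norm, ← ENNReal.ofReal_pow (norm_nonneg _),
      ← ENNReal.ofReal_coe_nnreal, ← ENNReal.ofReal_mul (by positivity)]
    refine ENNReal.ofReal_le_ofReal ?_
    rw [pow_mul]
    push_cast
    rw [← mul_pow]
    refine pow_le_pow_left₀ (by positivity) ?_ _
    calc ‖∑ u ∈ setU d q Finset.univ, F u x‖ ^ 2
        ≤ (∑ u ∈ setU d q Finset.univ, ‖F u x‖) ^ 2 :=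
          pow_le_pow_left₀ (norm_nonneg _) (norm_sum_le _ _) _
      _ ≤ (setU d q Finset.univ).card * ∑ u ∈ setU d q Finset.univ, ‖F u x‖ ^ 2 :=
          sq_sum_le_card_mul_sum_sq
      _ ≤ _ := by gcongr
  refine h1.trans (mul_le_mul_right ?_ _)
  refine le_trans ?_ (Finset.single_le_sum (f := fun M : Finset (Fin k) =>
    ∑ σ : (j : M) → Fin (β j), lpNormPow (2 * r) (squareFunction q M M σ F))
    (fun _ _ => zero_le) (Finset.mem_univ ∅))
  exact Finset.single_le_sum (f := fun σ : (j : (∅ : Finset (Fin k))) → Fin (β j) =>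
    lpNormPow (2 * r) (squareFunction q ∅ ∅ σ F))
    (fun _ _ => zero_le) (Finset.mem_univ _)

/-- The estimate for well separated fractions. -/
theorem lpNormPow_sum_le_of_separated {q : (j : Fin k) → Fin (β j) → ℕ} {Q₀ b : ℕ}
    (hq : CoprimeModuli q Q₀ b) (hb : 1 ≤ b) {r : ℕ} (hr : 1 ≤ r) {κ : ℝ}
    (hsep : ((b ^ k * b ^ k * b ^ k * Q₀ * b : ℕ) : ℝ) ^ (2 * r) * (2 * r * κ) < 1)
    {F : UnitAddTorus (Fin d) → (Fin d → ℤ) → ℂ}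
    (hFb : ∀ u, Banded (F u) {θ | ∃ y : UnitAddTorus (Fin d), Q₀ • y = 0 ∧ ‖θ - u - y‖ ≤ κ})
    {C : ℝ≥0} (hC : 0 < C) (hC' : stepConst r ^ k ≤ C) :
    lpNormPow (2 * r) (fun x => ∑ u ∈ setU d q Finset.univ, F u x) ≤
      (C : ℝ≥0∞) * ∑ M : Finset (Fin k), ∑ σ : (j : M) → Fin (β j),
        lpNormPow (2 * r) (squareFunction q M M σ F) := by
  set S := ∑ M : Finset (Fin k), ∑ σ : (j : M) → Fin (β j),
        lpNormPow (2 * r) (squareFunction q M M σ F) with hS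
  by_cases htop : S = ⊤
  · rw [htop, ENNReal.mul_top (by exact_mod_cast hC.ne')]; exact le_top
  -- Finiteness of the right side, through its M = ∅ summand, puts every `F u` in ℓ^{2r}. No
  -- boundedness of the operators enters.
  have hFs : ∀ u ∈ setU d q Finset.univ, Summable fun x => ‖F u x‖ ^ (2 * r) := by
    intro u hu
    have h1 := ENNReal.sum_ne_top.1 htop ∅ (Finset.mem_univ _)
    have h2 := ENNReal.sum_ne_top.1 h1 (fun j => absurd j.2 (Finset.notMem_empty _))
      (Finset.mem_univ _)
    rw [lpNormPow_squareFunction] at h2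
    simp only [mixedSquare_none_empty] at h2
    have h3 := ENNReal.summable_toReal h2
    refine Summable.of_nonneg_of_le (fun x => by positivity) (fun x => ?_) h3
    rw [ENNReal.toReal_ofReal (pow_nonneg (Finset.sum_nonneg fun w _ => by positivity) _), pow_mul]
    refine pow_le_pow_left₀ (by positivity) ?_ _
    exact Finset.single_le_sum (f := fun w => ‖F w x‖ ^ 2) (fun w _ => by positivity) hu
  have h2r : 2 * r ≠ 0 := by omega
  have hsum := summable_norm_sum_pow' h2r (setU d q Finset.univ) F hFs
  have hmain := tsum_mixedSquare_le hq hb hr hsep hFs hFb Finset.univ (fun _ => none)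
    (fun _ _ => rfl)
  simp only [mixedSquare_none_univ, Finset.card_univ, Fintype.card_fin, Finset.mem_univ,
    not_true_eq_false, IsEmpty.forall_iff, implies_true, Finset.filter_true, ← pow_mul] at hmain
  have hnn : ∀ a : (j : Fin k) → Option (Fin (β j)), 0 ≤ ∑' x, mixedSquare q F a ∅ x ^ r :=
    fun a => tsum_nonneg fun x => pow_nonneg (mixedSquare_nonneg _ _ _ _ _) _
  calc lpNormPow (2 * r) (fun x => ∑ u ∈ setU d q Finset.univ, F u x)
      = ENNReal.ofReal (∑' x, ‖∑ u ∈ setU d q Finset.univ, F u x‖ ^ (2 * r)) := by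
        rw [ENNReal.ofReal_tsum_of_nonneg (fun x => by positivity) hsum]
        refine tsum_congr fun x => ?_
        rw [ENNReal.ofReal_pow (norm_nonneg _), ofReal_norm]
    _ ≤ ENNReal.ofReal (C * ∑ a : (j : Fin k) → Option (Fin (β j)),
          ∑' x, mixedSquare q F a ∅ x ^ r) :=
        ENNReal.ofReal_le_ofReal (hmain.trans (mul_le_mul_of_nonneg_right hC'
          (Finset.sum_nonneg fun a _ => hnn a)))
    _ ≤ C * ∑ a : (j : Fin k) → Option (Fin (β j)),
          ∑' x, ENNReal.ofReal (mixedSquare q F a ∅ x ^ r) := by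
        rw [ENNReal.ofReal_mul (NNReal.coe_nonneg C), ENNReal.ofReal_coe_nnreal,
          ENNReal.ofReal_sum_of_nonneg fun a _ => hnn a]
        exact mul_le_mul_right (Finset.sum_le_sum fun a _ => ofReal_tsum_le_tsum_ofReal
          fun x => pow_nonneg (mixedSquare_nonneg _ _ _ _ _) _) _
    _ ≤ C * S := by
        refine mul_le_mul_right ?_ _
        rw [hS]
        simp only [lpNormPow_squareFunction]
        rw [← Fintype.sum_sigma' (f := fun (M : Finset (Fin k)) (σ : (j : M) → Fin (β j)) =>
          ∑' x, ENNReal.ofReal (mixedSquare q F (assignOf M σ) ∅ x ^ r))]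
        have hs := Function.surjInv_eq (surjective_assignOf (k := k) (β := β))
        -- A right inverse of `assignOf` embeds the assignments into the pairs (M, σ).
        have hinj := Function.injective_surjInv (surjective_assignOf (k := k) (β := β))
        have := ENNReal.tsum_comp_le_tsum_of_injective hinj
          (fun p : (Σ M : Finset (Fin k), ((j : M) → Fin (β j))) =>
            ∑' x, ENNReal.ofReal (mixedSquare q F (assignOf p.1 p.2) ∅ x ^ r))
        simp only [tsum_fintype] at this
        refine le_trans (le_of_eq ?_) this
        exact Finset.sum_congr rfl fun a _ => by
          have h := hs a
          rw [h]

/-- The primes exceed N₀, hence do not divide Q₀ = (N₀!)^D; the moduli are powers p^γ with p ≤ N and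
γ ≤ D. -/
theorem CoprimeModuli.of_hasOProperty {ρ : ℝ} {N : ℕ} {Λ : Set ℕ}
    {q : (j : Fin k) → Fin (β j) → ℕ}
    (h : HasOProperty (degD ρ) (primesIn ρ N) Λ β q) :
    CoprimeModuli q (bigQ ρ N) (N ^ degD ρ) where
  two_le j s := by
    obtain ⟨p, hp, γ, hγ, e⟩ := h.prime_pow j s
    rw [e]
    exact hp.1.two_le.trans (Nat.le_self_pow (by have := (Finset.mem_Icc.1 hγ).1; omega) p)
  le j s := by
    obtain ⟨p, hp, γ, hγ, e⟩ := h.prime_pow j s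
    rw [e]
    exact (Nat.pow_le_pow_left hp.2.2 γ).trans
      (Nat.pow_le_pow_right (hp.1.pos.trans_le hp.2.2) (Finset.mem_Icc.1 hγ).2)
  coprime := h.coprime
  coprime_left j s := by
    obtain ⟨p, hp, γ, hγ, e⟩ := h.prime_pow j s
    rw [e, bigQ]
    refine Nat.Coprime.pow _ _ (Nat.Coprime.symm ((Nat.Prime.coprime_iff_not_dvd hp.1).2 ?_))
    rw [hp.1.dvd_factorial]
    exact not_le.2 hp.2.1
  pos := pow_pos (Nat.factorial_pos _) _

open scoped Classical in
/-- All fractions with denominator at most `b`. -/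
def allFracs (d b : ℕ) : Finset (UnitAddTorus (Fin d)) :=
  (Finset.range (b + 1)).biUnion fun n => fracs d n

/-- The bound depends on d, b and D alone, hence is uniform over all choices of moduli. The +1 keeps
the base positive so that the exponent k can be raised to D. -/
theorem card_setU_le {q : (j : Fin k) → Fin (β j) → ℕ} {b D : ℕ} (hq : ∀ j s, q j s ≤ b)
    (hk : k ≤ D) : (setU d q Finset.univ).card ≤ ((allFracs d b).card + 1) ^ D := by
  classical
  have hsub : ∀ j, colPts d q j ⊆ allFracs d b := by
    intro j t ht
    obtain ⟨s, hs⟩ := mem_colPts.1 ht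
    exact Finset.mem_biUnion.2 ⟨q j s, Finset.mem_range.2 (Nat.lt_succ_of_le (hq j s)), hs⟩
  rw [setU_eq_sumset, sumset]
  refine Finset.card_image_le.trans ?_
  rw [Fintype.card_piFinset]
  calc ∏ j : (Finset.univ : Finset (Fin k)), (colPts d q j).card
      ≤ ∏ _j : (Finset.univ : Finset (Fin k)), ((allFracs d b).card + 1) :=
        Finset.prod_le_prod' fun j _ => (Finset.card_le_card (hsub j)).trans (Nat.le_succ _)
    _ = ((allFracs d b).card + 1) ^ k := by simp
    _ ≤ _ := Nat.pow_le_pow_right (Nat.succ_pos _) hk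

/-- The separation condition holds for all large `N`. -/
theorem exists_forall_separated {ρ : ℝ} (hρ : 0 < ρ) {r : ℕ} (hr : 1 ≤ r) :
    ∃ N₁ : ℕ, ∀ N, N₁ ≤ N → 1 ≤ N ∧ ∀ k, k ≤ degD ρ →
      ((((N ^ degD ρ) ^ k * (N ^ degD ρ) ^ k * (N ^ degD ρ) ^ k * bigQ ρ N * N ^ degD ρ : ℕ)) : ℝ) ^
        (2 * r) * (2 * r * (2 * Real.exp (-(N : ℝ) ^ (2 * ρ)))) < 1 := by
  set D := degD ρ with hD
  -- An upper bound for the exponent D(3k + 1) of N in the denominator.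
  set c : ℝ := D * (3 * D + 1) with hc
  -- With X = N^ρ, the denominator is at most exp((c/ρ + 4D)X), because log N ≤ X/ρ and Q₀ ≤
  -- exp(4DX), while κ = exp(-X²). So X ≥ A suffices: the logarithm pays for the prefactor 4r and
  -- the 1 gives strict inequality.
  set A : ℝ := 2 * r * (c / ρ + 4 * D) + Real.log (4 * r) + 1 with hA
  have hr' : (1 : ℝ) ≤ r := by exact_mod_cast hr
  have hlog : 0 ≤ Real.log (4 * r) := Real.log_nonneg (by linarith)
  have ht : Tendsto (fun N : ℕ => (N : ℝ) ^ ρ) atTop atTop :=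
    (tendsto_rpow_atTop hρ).comp tendsto_natCast_atTop_atTop
  obtain ⟨N₁, hN₁⟩ := eventually_atTop.1 ((ht.eventually_ge_atTop A).and (eventually_ge_atTop 1))
  refine ⟨N₁, fun N hN => ⟨(hN₁ N hN).2, fun k hk => ?_⟩⟩
  obtain ⟨hX, hN1⟩ := hN₁ N hN
  set X : ℝ := (N : ℝ) ^ ρ with hXdef
  have hNr : (1 : ℝ) ≤ N := by exact_mod_cast hN1
  have hNpos : (0 : ℝ) < N := by linarith
  have hX1 : 1 ≤ X := Real.one_le_rpow hNr hρ.le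
  have hX2 : (N : ℝ) ^ (2 * ρ) = X ^ 2 := by
    rw [hXdef, ← Real.rpow_natCast, ← Real.rpow_mul hNpos.le]; congr 1; push_cast; ring
  have hlogN : Real.log N ≤ X / ρ := Real.log_le_rpow_div hNpos.le hρ
  have hN0 : ((smallN ρ N : ℕ) : ℝ) ^ 2 ≤ 4 * X := by
    have h1 : ((smallN ρ N : ℕ) : ℝ) ≤ 2 * (N : ℝ) ^ (ρ / 2) := by
      rw [smallN]
      push_cast
      have h2 := Nat.floor_le (Real.rpow_nonneg hNpos.le (ρ / 2))
      have h3 : 1 ≤ (N : ℝ) ^ (ρ / 2) := Real.one_le_rpow hNr (by positivity)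
      linarith
    have h4 : ((N : ℝ) ^ (ρ / 2)) ^ 2 = X := by
      rw [hXdef, ← Real.rpow_natCast, ← Real.rpow_mul hNpos.le]; congr 1; push_cast; ring
    calc ((smallN ρ N : ℕ) : ℝ) ^ 2 ≤ (2 * (N : ℝ) ^ (ρ / 2)) ^ 2 :=
          pow_le_pow_left₀ (by positivity) h1 _
      _ = 4 * X := by rw [mul_pow, h4]; norm_num
  have hQ : ((bigQ ρ N : ℕ) : ℝ) ≤ Real.exp (4 * D * X) := by
    have h1 : ((smallN ρ N).factorial : ℝ) ≤ Real.exp (4 * X) := by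
      calc ((smallN ρ N).factorial : ℝ) ≤ (smallN ρ N : ℝ) ^ smallN ρ N := by
            exact_mod_cast Nat.factorial_le_pow _
        _ ≤ Real.exp (smallN ρ N) ^ smallN ρ N := by
            refine pow_le_pow_left₀ (by positivity) ?_ _
            linarith [Real.add_one_le_exp (smallN ρ N : ℝ)]
        _ = Real.exp ((smallN ρ N : ℝ) ^ 2) := by
            rw [← Real.exp_nat_mul, sq]
        _ ≤ _ := Real.exp_le_exp.2 hN0
    rw [bigQ, Nat.cast_pow]
    refine (pow_le_pow_left₀ (by positivity) h1 _).trans (le_of_eq ?_)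
    rw [← Real.exp_nat_mul, ← hD]; congr 1; ring
  have hP : ((((N ^ D) ^ k * (N ^ D) ^ k * (N ^ D) ^ k * bigQ ρ N * N ^ D : ℕ)) : ℝ) ≤
      Real.exp ((c / ρ + 4 * D) * X) := by
    have h1 : (((N ^ D) ^ k * (N ^ D) ^ k * (N ^ D) ^ k * N ^ D : ℕ) : ℝ) ≤
        Real.exp (c / ρ * X) := by
      have e1 : (N ^ D) ^ k * (N ^ D) ^ k * (N ^ D) ^ k * N ^ D = N ^ (D * (3 * k + 1)) := by
        simp only [← pow_mul, ← pow_add]; congr 1; ring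
      rw [e1]
      calc ((N ^ (D * (3 * k + 1)) : ℕ) : ℝ) ≤ ((N ^ (D * (3 * D + 1)) : ℕ) : ℝ) := by
            exact_mod_cast Nat.pow_le_pow_right hN1 (by gcongr)
        _ = Real.exp (c * Real.log N) := by
            rw [Nat.cast_pow, hc]
            have : ((D : ℝ) * (3 * D + 1)) = ((D * (3 * D + 1) : ℕ) : ℝ) := by push_cast; ring
            rw [this, Real.exp_nat_mul, Real.exp_log hNpos]
        _ ≤ _ := by
            refine Real.exp_le_exp.2 ?_
            have hc0 : 0 ≤ c := by positivity
            calc c * Real.log N ≤ c * (X / ρ) := mul_le_mul_of_nonneg_left hlogN hc0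
              _ = _ := by ring
    have e2 : (N ^ D) ^ k * (N ^ D) ^ k * (N ^ D) ^ k * bigQ ρ N * N ^ D =
        ((N ^ D) ^ k * (N ^ D) ^ k * (N ^ D) ^ k * N ^ D) * bigQ ρ N := by ring
    rw [e2, Nat.cast_mul, add_mul, Real.exp_add]
    exact mul_le_mul h1 hQ (by positivity) (by positivity)
  calc _ ≤ Real.exp ((c / ρ + 4 * D) * X) ^ (2 * r) * (2 * r * (2 * Real.exp (-X ^ 2))) := by
        rw [hX2]
        gcongr
    _ = Real.exp (2 * r * ((c / ρ + 4 * D) * X) + Real.log (4 * r) - X ^ 2) := by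
        rw [← Real.exp_nat_mul, sub_eq_add_neg, Real.exp_add, Real.exp_add,
          Real.exp_log (by linarith)]
        push_cast; ring
    _ < 1 := by
        rw [Real.exp_lt_one_iff]
        have h1 : A * X ≤ X ^ 2 := by
          rw [sq]; exact mul_le_mul_of_nonneg_right hX (by linarith)
        have h2 : Real.log (4 * r) ≤ Real.log (4 * r) * X := le_mul_of_one_le_right hlog hX1
        have h3 : A * X = 2 * r * ((c / ρ + 4 * D) * X) + Real.log (4 * r) * X + X := by
          rw [hA]; ring
        linarith

end Final

end IonescuWainger

end

theorem theorem2p6 (d : ℕ) (hd : 1 ≤ d) (ρ : ℝ) (hρ : 0 < ρ) (r : ℕ) (hr : 1 ≤ r) :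
    ∃ C : ℝ≥0, 0 < C ∧
      ∀ (Θ : EuclideanSpace ℝ (Fin d) → ℂ) (_ : IsLpMultiplier Θ)
        (η : EuclideanSpace ℝ (Fin d) → ℝ) (_ : IsCutoff η)
        (N : ℕ) (_ : (8 : ℝ) ^ (2 * (r : ℝ) / ρ) < (N : ℝ))
        (ε : Fin d → ℝ)
        (_ : ∀ i, 0 < ε i ∧ ε i ≤ Real.exp (-(N : ℝ) ^ (2 * ρ)))
        (Λ : Set ℕ)
        (_ : Λ ⊆ primeProducts (degD ρ)
          (primesIn ρ N) ∪ {1})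
        (k : ℕ) (β : Fin k → ℕ) (q : (j : Fin k) → Fin (β j) → ℕ)
        (_ : HasOProperty (degD ρ)
          (primesIn ρ N) Λ β q)
        (f : (Fin d → ℤ) → ℂ)
        (_ : Memℓp (E := fun _ : Fin d → ℤ => ℂ) f ((2 * r : ℕ) : ℝ≥0∞)),
        let m : UnitAddTorus (Fin d) → UnitAddTorus (Fin d) → ℂ :=
          multiplierAt Θ η ε (bigQ ρ N) Λ q
        let F : UnitAddTorus (Fin d) → (Fin d → ℤ) → ℂ :=
          fun u => multiplierOp (m u) f
        (∀ u ∈ setU d q Finset.univ, ∀ x : Fin d → ℤ,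
          Summable fun y : Fin d → ℤ => mFourierCoeff (m u) (x - y) * f y) ∧
        lpNormPow (2 * r)
            (fun x => ∑ u ∈ setU d q Finset.univ, F u x) ≤
          (C : ℝ≥0∞) * ∑ M : Finset (Fin k), ∑ σ : (j : M) → Fin (β j),
            lpNormPow (2 * r) (squareFunction q M M σ F) := by
  obtain ⟨N₁, hN₁⟩ := exists_forall_separated hρ hr
  set K : ℕ → ℕ := fun N => ((allFracs d (N ^ degD ρ)).card + 1) ^ degD ρ with hK
  -- N₁ depends only on ρ and r, so summing over the finitely many smaller N gives an admissible
  -- constant.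
  set C₁ : ℝ≥0 := ∑ N ∈ Finset.range N₁, (K N : ℝ≥0) ^ r with hC₁
  -- The base 1 + `stepConst r` is at least 1, which lets the number of columns k be replaced by D.
  set C₂ : ℝ≥0 := ⟨(1 + stepConst r) ^ degD ρ, by have := stepConst_nonneg r; positivity⟩ with hC₂
  have hC₂' : (1 + stepConst r) ^ degD ρ = (C₂ : ℝ) := rfl
  have hC₁' : ∀ N < N₁, (K N : ℝ≥0) ^ r ≤ C₁ := fun N hN =>
    Finset.single_le_sum (f := fun N => (K N : ℝ≥0) ^ r) (fun _ _ => zero_le)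
      (Finset.mem_range.2 hN)
  have hK' : ∀ N, K N = ((allFracs d (N ^ degD ρ)).card + 1) ^ degD ρ := fun _ => rfl
  clear_value C₁ C₂ K
  refine ⟨C₁ + C₂ + 1, add_pos_of_nonneg_of_pos zero_le one_pos, ?_⟩
  intro Θ hΘ η hη N hN ε hε Λ _ k β q hO f hf m F
  have h2r : 0 < ((2 * r : ℕ) : ℝ≥0∞).toReal := by
    simp only [ENNReal.toReal_natCast]
    exact_mod_cast (by omega : 0 < 2 * r)
  have hfs : Summable fun y => ‖f y‖ ^ (2 * r) := by
    have := (memℓp_gen_iff h2r).1 hf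
    simpa only [ENNReal.toReal_natCast, Real.rpow_natCast] using this
  set κ := Real.exp (-(N : ℝ) ^ (2 * ρ)) with hκ
  have hκ1 : κ ≤ 1 := Real.exp_le_one_iff.2 (neg_nonpos.2 (by positivity))
  have hq := CoprimeModuli.of_hasOProperty hO
  have hF := multiplierOp_multiplierAt hΘ hη (fun i => (hε i).1) hd (Real.exp_pos _)
    (fun i => (hε i).2) hκ1 hq.pos.ne' Λ q hr hfs
  refine ⟨fun u _ x => (hF u).1 x, ?_⟩
  rcases lt_or_ge N N₁ with hlt | hge
  · refine (lpNormPow_sum_le_of_card_le q F r (K := K N)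
      ((card_setU_le hq.le hO.le).trans_eq (hK' N).symm)).trans ?_
    refine mul_le_mul_left ?_ _
    have h1 := hC₁' N hlt
    have h2 : (K N : ℝ≥0) ^ r ≤ C₁ + C₂ + 1 :=
      h1.trans (le_self_add.trans le_self_add)
    exact_mod_cast h2
  · obtain ⟨hN1, hsep⟩ := hN₁ N hge
    refine lpNormPow_sum_le_of_separated hq (Nat.one_le_pow _ _ hN1) hr (hsep k hO.le)
      (fun u => (hF u).2) (by positivity) ?_
    have h0 := stepConst_nonneg r
    calc stepConst r ^ k ≤ (1 + stepConst r) ^ k := pow_le_pow_left₀ h0 (by linarith) _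
      _ ≤ (1 + stepConst r) ^ degD ρ := pow_le_pow_right₀ (by linarith) hO.le
      _ = (C₂ : ℝ) := hC₂'
      _ ≤ _ := by
        push_cast
        linarith [NNReal.coe_nonneg C₁]
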